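/- **Setting.** Let $\mathcal H=\mathcal K\otimes\mathbb C^{E}$, where $\mathcal K$ is a complex Hilbert space and $E\subset\mathbb R$ is a finite set labelling the orthonormal basis $|x\rangle$, $x\in E$, of the value register, and let $|\mathbf 0\rangle\in\mathcal H$ be a fixed unit vector. A unitary $O$ on $\mathcal H$ *encodes* a finite random variable $X$ if $O|\mathbf 0\rangle=\sum_{x\in E}\sqrt{\Pr[X=x]}\,|\psi_x\rangle|x\rangle$ for some unit vectors $|\psi_x\rangle\in\mathcal K$. A *quantum experiment* is one application of $O$ or $O^\dagger$, or of a controlled version of one of them. **Algorithm.** The inputs are unitaries $O_1,\dots,O_T$ on $\mathcal H$, reals $L<H$, an accuracy $\epsilon>0$, and constants $a,b>0$. Put $\epsilon'=a\,\epsilon^2/(H-L)^2$ and $k=\lceil b(H-L)/\epsilon\rceil$. 1. $U_i$ applies $O_i$ and then the controlled rotation $|x\rangle|0\rangle\mapsto|x\rangle\big(\sqrt{\tfrac{x-L}{H-L}}\,|1\rangle+\sqrt{\tfrac{H-x}{H-L}}\,|0\rangle\big)$ onto a first qubit (for $x\notin[L,H]$ the number $\frac{x-L}{H-L}$ is truncated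 to $[0,1]$). 2. $V_i=(U_i^\dagger\otimes I)(I\otimes\mathrm{CNOT})(U_i\otimes I)$, where the CNOT is controlled by the first qubit and targets a second qubit. 3. $S_i$ is the fixed-point search circuit of Yoder, Low and Chuang for the preparation $V_i$, the target projector $\Pi=|\mathbf 0\rangle|0\rangle\langle 0|\langle\mathbf 0|\otimes I$ and the accuracy $\epsilon'$: it applies $V_i$ and then, for $j=1,\dots,l$, the operator $V_i\big(I-(1-e^{-i\alpha_j})P\big)V_i^\dagger\big(I-(1-e^{i\beta_j})\Pi\big)$. Here $P$ is the projector onto $|\mathbf 0\rangle|0\rangle|0\rangle$, $l=\lceil\log(4/\epsilon')\rceil$, $\alpha_j=-\beta_{l+1-j}=2\,\mathrm{arccot}\big(\tan\tfrac{2\pi j}{2l+1}\sqrt{1-\gamma^2}\big)$ with $\mathrm{arccot}\,x=\tfrac{\pi}{2}-\arctan x$, and $\gamma^{-1}=\cosh\big(\tfrac{1}{2l+1}\operatorname{arcosh}\tfrac{2}{\epsilon'}\big)$. 4. Let $\sigma:\{0,\dots,k\}\to\{1,\dots,T\}$ say which $S_i$ is used where. Run the amplitude estimation circuit of Brassard,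 Høyer, Mosca and Tapp with a counter register of dimension $k+1$: apply the quantum Fourier transform to the counter in state $|0\rangle$; apply $S_{\sigma(0)}$ to $|\mathbf 0\rangle|0\rangle|0\rangle$; for $s=1,\dots,k$ apply, if the counter is at least $s$, the Grover iteration $\big(2S_{\sigma(s)}PS_{\sigma(s)}^\dagger-I\big)\big(I-2\,I\otimes|1\rangle\langle1|\big)$, whose second factor acts on the second qubit; apply the inverse Fourier transform; measure the counter, with outcome $y$. Put $\tilde p=\sin^2\frac{\pi y}{k+1}$. 5. Output $\tilde\mu=\dfrac{\tilde p-\sqrt{\tilde p(1-\tilde p)}}{2\tilde p-1}(H-L)+L$, where the fraction has its limit value $\frac12$ at $\tilde p=\frac12$. **Theorem.** There are absolute constants $a,b,c_\epsilon,c_m,c_T,C>0$ such that the following holds. Let $O_1,\dots,O_T$ be unitaries on the same space $\mathcal H$, with the same $|\mathbf 0\rangle$, encoding finite random variables $X_1,\dots,X_T$ with values in $[L,H]$, where $L<H$. Let $\mu\in\mathbb R$, $m\in\mathbb N$, $\epsilon>0$ and $\delta<\epsilon/2$ satisfy $|\mathbb E[X_i]-\mu|\le\delta$ for all $i$, and $$\epsilon\le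 c_\epsilon\frac{(\mu-L)(H-\mu)}{H-L},\qquad m\ge c_m\log\frac{H-L}{\epsilon},\qquad T\ge c_T\frac{H-L}{\epsilon}.$$ Then $k+1\le T$, and for every $\sigma:\{0,\dots,k\}\to\{1,\dots,T\}$ the algorithm satisfies $|\tilde\mu-\mu|\le\epsilon$ with probability at least $2/3$, and it uses at most $C\,\frac{H-L}{\epsilon}\log\frac{H-L}{\epsilon}$ quantum experiments in total. If moreover $\sigma$ is injective, then the algorithm uses each $O_i$ in at most $m$ quantum experiments. -/

import Mathlib

open scoped Kronecker

noncomputable section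

/-! ### Finite random variables and quantum random variables -/

/-- The probability `p(x) = P[X = x]` of a finite random variable `X` on `(Ω, P)`. -/
def massAt {Ω : Type*} [Fintype Ω] (P : PMF Ω) (X : Ω → ℝ) (x : ℝ) : ℝ :=
  ∑ ω, if X ω = x then (P ω).toReal else 0

/-- The expectation of a finite random variable. -/
def expectedValue {Ω : Type*} [Fintype Ω] (P : PMF Ω) (X : Ω → ℝ) : ℝ :=
  ∑ ω, (P ω).toReal * X ω

/-- The Hilbert space `𝒦 ⊗ ℂ^E` of a garbage register with state space `𝒦` and a value register
with orthonormal basis `|x⟩`, `x ∈ E`, for a finite set `E` of reals.  The vector `∑ₓ ξₓ ⊗ |x⟩` is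
the family `(ξₓ)`. -/
abbrev Register (𝒦 : Type*) (E : Finset ℝ) : Type _ := PiLp 2 (fun _ : E => 𝒦)

/-- `(𝓗, O)` is a quantum random variable encoding `X`:
`O |𝟎⟩ = ∑ₓ √p(x) |ψₓ⟩|x⟩` for some unit vectors `ψₓ`; here `z` is the vector `|𝟎⟩`. -/
def IsQuantumRandomVariable {𝒦 : Type*} [NormedAddCommGroup 𝒦] [InnerProductSpace ℂ 𝒦]
    {E : Finset ℝ} (z : Register 𝒦 E) (O : Register 𝒦 E ≃ₗᵢ[ℂ] Register 𝒦 E)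
    {Ω : Type*} [Fintype Ω] (P : PMF Ω) (X : Ω → ℝ) : Prop :=
  ∃ ψ : E → 𝒦, (∀ x, ‖ψ x‖ = 1) ∧ ∀ x : E, O z x = ((√(massAt P X x) : ℝ) : ℂ) • ψ x

/-! ### Quantum query circuits -/

/-- The state space `ℂ^A ⊗ 𝓗`: ancilla registers with computational basis `A`, and the space `𝓗`
on which the oracles act. -/
abbrev JointSpace (A 𝓗 : Type*) : Type _ := PiLp 2 (fun _ : A => 𝓗)

/-- An elementary step of a query algorithm with oracles `O_1, …, O_T` on `𝓗`: either a fixed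
unitary, or one quantum experiment, that is, one application of `O_i` (`inv = false`) or its
inverse (`inv = true`) to `𝓗`, controlled on the ancilla basis states `a` with `c a = true`
(the uncontrolled version has `c = fun _ => true`). -/
inductive Gate (A 𝓗 : Type*) [Fintype A] [NormedAddCommGroup 𝓗] [InnerProductSpace ℂ 𝓗] (T : ℕ)
  | free (W : JointSpace A 𝓗 ≃ₗᵢ[ℂ] JointSpace A 𝓗) : Gate A 𝓗 T
  | experiment (i : Fin T) (inv : Bool) (c : A → Bool) : Gate A 𝓗 T

/-- A circuit: a list of gates, the first gate of the list being applied first. -/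
abbrev Circuit (A 𝓗 : Type*) [Fintype A] [NormedAddCommGroup 𝓗] [InnerProductSpace ℂ 𝓗]
    (T : ℕ) : Type _ := List (Gate A 𝓗 T)

section Model

variable {A 𝓗 : Type*} [Fintype A] [NormedAddCommGroup 𝓗] [InnerProductSpace ℂ 𝓗] {T : ℕ}

/-- Apply `u a` to `𝓗` when the ancillas are in the basis state `a`. -/
def blockGate (u : A → (𝓗 ≃ₗᵢ[ℂ] 𝓗)) : JointSpace A 𝓗 ≃ₗᵢ[ℂ] JointSpace A 𝓗 :=
  LinearIsometryEquiv.piLpCongrRight 2 u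

/-- The unitary performed by a gate when the oracles are `O`. -/
def Gate.toUnitary (O : Fin T → (𝓗 ≃ₗᵢ[ℂ] 𝓗)) :
    Gate A 𝓗 T → (JointSpace A 𝓗 ≃ₗᵢ[ℂ] JointSpace A 𝓗)
  | .free W => W
  | .experiment i inv c =>
      blockGate fun a =>
        if c a then (if inv then (O i).symm else O i) else LinearIsometryEquiv.refl ℂ 𝓗

/-- The inverse gate. -/
def Gate.adjoint : Gate A 𝓗 T → Gate A 𝓗 T
  | .free W => .free W.symm
  | .experiment i inv c => .experiment i (!inv) c

/-- Does the gate query one of the oracles? -/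
def Gate.isExperiment : Gate A 𝓗 T → Bool
  | .free _ => false
  | .experiment _ _ _ => true

/-- Does the gate query the `i`-th oracle? -/
def Gate.isExperimentOn (i : Fin T) : Gate A 𝓗 T → Bool
  | .free _ => false
  | .experiment j _ _ => decide (j = i)

/-- The unitary performed by a circuit when the oracles are `O`. -/
def Circuit.toUnitary (O : Fin T → (𝓗 ≃ₗᵢ[ℂ] 𝓗)) :
    Circuit A 𝓗 T → (JointSpace A 𝓗 ≃ₗᵢ[ℂ] JointSpace A 𝓗)
  | [] => LinearIsometryEquiv.refl ℂ _
  | g :: C => (g.toUnitary O).trans (Circuit.toUnitary O C)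

/-- The inverse circuit. -/
def Circuit.adjoint (C : Circuit A 𝓗 T) : Circuit A 𝓗 T := (C.map Gate.adjoint).reverse

/-- The number of quantum experiments in a circuit. -/
def Circuit.experiments (C : Circuit A 𝓗 T) : ℕ := C.countP Gate.isExperiment

/-- The number of quantum experiments with the `i`-th oracle in a circuit. -/
def Circuit.experimentsOn (i : Fin T) (C : Circuit A 𝓗 T) : ℕ :=
  C.countP (Gate.isExperimentOn i)

end Model

/-! ### Elementary unitaries -/

section Unitaries

variable {𝒱 : Type*} [NormedAddCommGroup 𝒱] [InnerProductSpace ℂ 𝒱]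

theorem norm_phase_sub (z : 𝒱) (hz : ‖z‖ = 1) (α : ℝ) (v : 𝒱) :
    ‖v - ((1 - Complex.exp (α * Complex.I)) * inner ℂ z v) • z‖ = ‖v‖ := by
  have hzz : inner ℂ z z = (1 : ℂ) := by
    rw [inner_self_eq_norm_sq_to_K, hz]; simp
  have he : (starRingEnd ℂ) (Complex.exp (α * Complex.I)) * Complex.exp (α * Complex.I) = 1 := by
    rw [← Complex.exp_conj, ← Complex.exp_add]
    simp
  have key : inner ℂ (v - ((1 - Complex.exp (α * Complex.I)) * inner ℂ z v) • z)
      (v - ((1 - Complex.exp (α * Complex.I)) * inner ℂ z v) • z) = inner ℂ v v := by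
    simp only [inner_sub_left, inner_sub_right, inner_smul_left, inner_smul_right, hzz, map_mul,
      map_sub, map_one, inner_conj_symm]
    linear_combination (inner ℂ v z * inner ℂ z v) * he
  have h2 := congrArg Complex.re key
  rw [← sq_eq_sq₀ (norm_nonneg _) (norm_nonneg _)]
  rw [← inner_self_eq_norm_sq (𝕜 := ℂ), ← inner_self_eq_norm_sq (𝕜 := ℂ)]
  exact h2

/-- The unitary `I - (1 - e^{iα}) |z⟩⟨z|` for a unit vector `z`. -/
def phaseAbout (z : 𝒱) (hz : ‖z‖ = 1) (α : ℝ) : 𝒱 ≃ₗᵢ[ℂ] 𝒱 :=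
  LinearIsometryEquiv.ofSurjective
    { toFun := fun v => v - ((1 - Complex.exp (α * Complex.I)) * inner ℂ z v) • z
      map_add' := fun v w => by
        simp only [inner_add_right, mul_add, add_smul]; abel
      map_smul' := fun c v => by
        simp only [inner_smul_right, RingHom.id_apply, smul_sub, smul_smul]
        congr 2; ring
      norm_map' := norm_phase_sub z hz α }
    (by
      intro w
      refine ⟨w - ((1 - Complex.exp ((-α : ℝ) * Complex.I)) * inner ℂ z w) • z, ?_⟩
      have hzz : inner ℂ z z = (1 : ℂ) := by
        rw [inner_self_eq_norm_sq_to_K, hz]; simp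
      have he : Complex.exp (α * Complex.I) * Complex.exp ((-α : ℝ) * Complex.I) = 1 := by
        rw [← Complex.exp_add]; simp
      change (w - _) - ((1 - Complex.exp (α * Complex.I)) * inner ℂ z (w - _)) • z = w
      rw [inner_sub_right, inner_smul_right, hzz, sub_sub, ← add_smul, sub_eq_self]
      convert zero_smul ℂ z using 2
      linear_combination (-inner ℂ z w) * he)

theorem phaseAbout_apply (z : 𝒱) (hz : ‖z‖ = 1) (α : ℝ) (v : 𝒱) :
    phaseAbout z hz α v = v - ((1 - Complex.exp (α * Complex.I)) * inner ℂ z v) • z := rfl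

theorem sum_star_mul_unitary {A : Type*} [Fintype A] [DecidableEq A]
    (u : Matrix.unitaryGroup A ℂ) (b c : A) :
    ∑ a, star (u.1 a b) * u.1 a c = if b = c then 1 else 0 := by
  have h := congrFun (congrFun (Unitary.coe_star_mul_self u) b) c
  rw [Matrix.mul_apply] at h
  simpa [Matrix.star_apply, Matrix.one_apply] using h

theorem sum_norm_sq_unitary {A : Type*} [Fintype A] [DecidableEq A]
    (u : Matrix.unitaryGroup A ℂ) (f : A → 𝒱) :
    ∑ a, ‖∑ b, u.1 a b • f b‖ ^ 2 = ∑ a, ‖f a‖ ^ 2 := by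
  have key : ∑ a, inner ℂ (∑ b, u.1 a b • f b) (∑ c, u.1 a c • f c) = ∑ a, inner ℂ (f a) (f a) := by
    calc ∑ a, inner ℂ (∑ b, u.1 a b • f b) (∑ c, u.1 a c • f c)
        = ∑ a, ∑ b, ∑ c, (star (u.1 a b) * u.1 a c) * inner ℂ (f b) (f c) := by
          refine Finset.sum_congr rfl fun a _ => ?_
          rw [sum_inner]
          refine Finset.sum_congr rfl fun b _ => ?_
          rw [inner_sum]
          refine Finset.sum_congr rfl fun c _ => ?_
          rw [inner_smul_left, inner_smul_right, starRingEnd_apply, mul_assoc]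
      _ = ∑ b, ∑ c, ∑ a, (star (u.1 a b) * u.1 a c) * inner ℂ (f b) (f c) := by
          rw [Finset.sum_comm]
          exact Finset.sum_congr rfl fun b _ => Finset.sum_comm
      _ = ∑ b, inner ℂ (f b) (f b) := by
          refine Finset.sum_congr rfl fun b _ => ?_
          simp only [← Finset.sum_mul, sum_star_mul_unitary u b]
          simp
  have h2 := congrArg Complex.re key
  rw [Complex.re_sum, Complex.re_sum] at h2
  simp only [← inner_self_eq_norm_sq (𝕜 := ℂ)]
  exact h2

/-- The unitary on `ℂ^A ⊗ (𝒦 ⊗ ℂ^E)` that applies the unitary matrix `u x` to the ancillas when the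
value register is in the basis state `|x⟩`. -/
def valueControlled {A : Type*} [Fintype A] [DecidableEq A] {E : Finset ℝ}
    (u : E → Matrix.unitaryGroup A ℂ) :
    JointSpace A (Register 𝒱 E) ≃ₗᵢ[ℂ] JointSpace A (Register 𝒱 E) :=
  LinearIsometryEquiv.ofSurjective
    { toFun := fun s => WithLp.toLp 2 fun a => WithLp.toLp 2 fun x => ∑ b, (u x).1 a b • s b x
      map_add' := fun s t => by
        ext a x
        simp [smul_add, Finset.sum_add_distrib]
      map_smul' := fun c s => by
        ext a x
        simp only [PiLp.smul_apply, RingHom.id_apply, Finset.smul_sum]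
        exact Finset.sum_congr rfl fun b _ => smul_comm _ _ _
      norm_map' := fun s => by
        rw [← sq_eq_sq₀ (norm_nonneg _) (norm_nonneg _)]
        simp only [PiLp.norm_sq_eq_of_L2, LinearMap.coe_mk, AddHom.coe_mk]
        rw [Finset.sum_comm, Finset.sum_comm (s := Finset.univ (α := A))]
        exact Finset.sum_congr rfl fun x _ => sum_norm_sq_unitary (u x) fun b => s b x }
    (by
      intro t
      refine ⟨WithLp.toLp 2 fun a => WithLp.toLp 2 fun x => ∑ b, (star (u x)).1 a b • t b x, ?_⟩
      ext a x
      change ∑ b, (u x).1 a b • ∑ c, (star (u x)).1 b c • t c x = t a x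
      simp only [Finset.smul_sum, smul_smul]
      rw [Finset.sum_comm]
      simp only [← Finset.sum_smul]
      have h : ∀ c, ∑ b, (u x).1 a b * (star (u x)).1 b c = if a = c then 1 else 0 := by
        intro c
        have h := congrFun (congrFun (Unitary.coe_mul_star_self (u x)) a) c
        rw [Matrix.mul_apply] at h
        simpa [Matrix.one_apply] using h
      simp only [h, ite_smul, one_smul, zero_smul, Finset.sum_ite_eq, Finset.mem_univ, if_true])

theorem valueControlled_apply {A : Type*} [Fintype A] [DecidableEq A] {E : Finset ℝ}
    (u : E → Matrix.unitaryGroup A ℂ) (s : JointSpace A (Register 𝒱 E)) (a : A) (x : E) :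
    valueControlled u s a x = ∑ b, (u x).1 a b • s b x := rfl

end Unitaries

/-- The number `t` truncated to `[0,1]`. -/
def clampUnit (t : ℝ) : ℝ := max 0 (min 1 t)

/-- The one-qubit rotation with `|0⟩ ↦ √(1-t)|0⟩ + √t|1⟩`, `|1⟩ ↦ -√t|0⟩ + √(1-t)|1⟩`
(`false` is `0`, `true` is `1`; `t` is truncated to `[0,1]`). -/
def rotationMatrix (t : ℝ) : Matrix Bool Bool ℂ := fun b' b =>
  if b' = b then ((√(1 - clampUnit t) : ℝ) : ℂ)
  else if b' then ((√(clampUnit t) : ℝ) : ℂ) else (-(√(clampUnit t) : ℝ) : ℂ)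

theorem rotationMatrix_mem (t : ℝ) : rotationMatrix t ∈ Matrix.unitaryGroup Bool ℂ := by
  have h0 : 0 ≤ clampUnit t := le_max_left _ _
  have h1 : clampUnit t ≤ 1 := max_le zero_le_one (min_le_left _ _)
  have hs : ((√(clampUnit t) : ℝ) : ℂ) * ((√(clampUnit t) : ℝ) : ℂ) = (clampUnit t : ℂ) := by
    rw [← Complex.ofReal_mul, Real.mul_self_sqrt h0]
  have hc : ((√(1 - clampUnit t) : ℝ) : ℂ) * ((√(1 - clampUnit t) : ℝ) : ℂ)
      = 1 - (clampUnit t : ℂ) := by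
    rw [← Complex.ofReal_mul, Real.mul_self_sqrt (by linarith)]; push_cast; ring
  rw [Matrix.mem_unitaryGroup_iff]
  ext a b
  rw [Matrix.mul_apply, Fintype.sum_bool]
  cases a <;> cases b <;>
    simp only [rotationMatrix, Matrix.star_apply, Matrix.one_apply, RCLike.star_def,
      Complex.conj_ofReal, map_neg, if_true, if_false, reduceCtorEq, Bool.false_eq_true] <;>
    first | ring1 | linear_combination hs + hc

/-- The matrix of the quantum Fourier transform `|x⟩ ↦ M^{-1/2} ∑_y e^{2πi xy/M} |y⟩` with
`M = k + 1`. -/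
def fourierMatrix (k : ℕ) : Matrix (Fin (k + 1)) (Fin (k + 1)) ℂ := fun y x =>
  Complex.exp (2 * Real.pi * Complex.I * (x : ℕ) * (y : ℕ) / (k + 1 : ℕ))
    / ((√((k + 1 : ℕ) : ℝ) : ℝ) : ℂ)

theorem fourierMatrix_mem (k : ℕ) : fourierMatrix k ∈ Matrix.unitaryGroup (Fin (k + 1)) ℂ := by
  have hM : ((k + 1 : ℕ) : ℂ) ≠ 0 := by exact_mod_cast Nat.succ_ne_zero k
  have hs : ((√((k + 1 : ℕ) : ℝ) : ℝ) : ℂ) * ((√((k + 1 : ℕ) : ℝ) : ℝ) : ℂ) = ((k + 1 : ℕ) : ℂ) := by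
    rw [← Complex.ofReal_mul, Real.mul_self_sqrt (Nat.cast_nonneg _)]; norm_cast
  have hpi : (2 * Real.pi * Complex.I : ℂ) ≠ 0 := by
    simp [Real.pi_ne_zero]
  rw [Matrix.mem_unitaryGroup_iff]
  ext y y'
  rw [Matrix.mul_apply, Matrix.one_apply]
  set r : ℂ := Complex.exp (2 * Real.pi * Complex.I * (((y : ℕ) : ℂ) - ((y' : ℕ) : ℂ))
    / (k + 1 : ℕ)) with hr
  have hterm : ∀ x : Fin (k + 1), fourierMatrix k y x * star (fourierMatrix k) x y'
      = r ^ (x : ℕ) / ((k + 1 : ℕ) : ℂ) := by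
    intro x
    rw [Matrix.star_apply, fourierMatrix, fourierMatrix, RCLike.star_def, map_div₀,
      Complex.conj_ofReal, ← Complex.exp_conj, div_mul_div_comm, ← Complex.exp_add, hs, hr,
      ← Complex.exp_nat_mul]
    congr 2
    simp only [map_div₀, map_mul, Complex.conj_ofReal, Complex.conj_I, map_natCast, map_ofNat]
    field_simp
    ring
  simp only [hterm]
  rw [← Finset.sum_div, Fin.sum_univ_eq_sum_range (fun x => r ^ x) (k + 1)]
  by_cases h : y = y'
  · subst h
    simp only [hr, sub_self, mul_zero, zero_div, Complex.exp_zero, one_pow, Finset.sum_const,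
      Finset.card_range, nsmul_one, if_true]
    exact div_self hM
  · rw [if_neg h]
    have hrM : r ^ (k + 1) = 1 := by
      rw [hr, ← Complex.exp_nat_mul, Complex.exp_eq_one_iff]
      refine ⟨(y : ℕ) - (y' : ℕ), ?_⟩
      push_cast
      field_simp
    have hr1 : r ≠ 1 := by
      intro h1
      rw [hr, Complex.exp_eq_one_iff] at h1
      obtain ⟨n, hn⟩ := h1
      have h2 : (((y : ℕ) : ℂ) - ((y' : ℕ) : ℂ)) = n * ((k + 1 : ℕ) : ℂ) := by
        rw [div_eq_iff hM] at hn
        apply mul_left_cancel₀ hpi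
        linear_combination hn
      have h3 : (((y : ℕ) : ℤ) - ((y' : ℕ) : ℤ)) = n * ((k + 1 : ℕ) : ℤ) := by
        exact_mod_cast h2
      have h4 : ((k + 1 : ℕ) : ℤ) ∣ ((y : ℕ) : ℤ) - ((y' : ℕ) : ℤ) := ⟨n, by rw [h3, mul_comm]⟩
      have h5 := Int.eq_zero_of_abs_lt_dvd h4 (by rw [abs_lt]; constructor <;> omega)
      exact h (Fin.ext (by omega))
    rw [geom_sum_eq hr1, hrM, sub_self, zero_div, zero_div]

/-! ### The mean estimation algorithm -/

/-- The ancilla registers of the algorithm: a counter with values `0, …, k` and two qubits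
(`false` is `0`, `true` is `1`). -/
abbrev Ancilla (k : ℕ) : Type := Fin (k + 1) × Bool × Bool

section Algorithm

variable {𝒦 : Type*} [NormedAddCommGroup 𝒦] [InnerProductSpace ℂ 𝒦] {E : Finset ℝ}
  {T k : ℕ}

/-- The controlled rotation
`|x⟩|0⟩ ↦ |x⟩(√((x-L)/(H-L)) |1⟩ + √((H-x)/(H-L)) |0⟩)`, `x ∈ [L,H]`, on the first qubit. -/
def controlledRotation (L H : ℝ) :
    JointSpace (Ancilla k) (Register 𝒦 E) ≃ₗᵢ[ℂ] JointSpace (Ancilla k) (Register 𝒦 E) :=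
  valueControlled fun x =>
    ⟨(1 : Matrix (Fin (k + 1)) (Fin (k + 1)) ℂ) ⊗ₖ
        (rotationMatrix ((x - L) / (H - L)) ⊗ₖ (1 : Matrix Bool Bool ℂ)),
      Matrix.kronecker_mem_unitary (one_mem _)
        (Matrix.kronecker_mem_unitary (rotationMatrix_mem _) (one_mem _))⟩

/-- The CNOT gate with the first qubit as control and the second as target. -/
def cnot : JointSpace (Ancilla k) (Register 𝒦 E) ≃ₗᵢ[ℂ] JointSpace (Ancilla k) (Register 𝒦 E) :=
  LinearIsometryEquiv.piLpCongrLeft 2 ℂ (Register 𝒦 E)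
    { toFun := fun a => (a.1, a.2.1, xor a.2.1 a.2.2)
      invFun := fun a => (a.1, a.2.1, xor a.2.1 a.2.2)
      left_inv := fun a => by simp
      right_inv := fun a => by simp }

/-- The quantum Fourier transform on the counter. -/
def counterFourier :
    JointSpace (Ancilla k) (Register 𝒦 E) ≃ₗᵢ[ℂ] JointSpace (Ancilla k) (Register 𝒦 E) :=
  valueControlled fun _ =>
    ⟨fourierMatrix k ⊗ₖ (1 : Matrix (Bool × Bool) (Bool × Bool) ℂ),
      Matrix.kronecker_mem_unitary (fourierMatrix_mem k) (one_mem _)⟩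

/-- The gate `I - (1 - e^{iα}) Π`, where `Π` is the projection onto the span of the vectors
`|a⟩|z⟩`, `c a = true`. -/
def phaseGate (z : Register 𝒦 E) (hz : ‖z‖ = 1) (c : Ancilla k → Bool) (α : ℝ) :
    Gate (Ancilla k) (Register 𝒦 E) T :=
  .free (blockGate fun a =>
    if c a then phaseAbout z hz α else LinearIsometryEquiv.refl ℂ (Register 𝒦 E))

/-- The gate that multiplies the ancilla basis states `|a⟩`, `c a = true`, by `-1`. -/
def signGate (c : Ancilla k → Bool) : Gate (Ancilla k) (Register 𝒦 E) T :=
  .free (blockGate fun a =>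
    if c a then LinearIsometryEquiv.neg ℂ else LinearIsometryEquiv.refl ℂ (Register 𝒦 E))

/-- The circuit `U_i`: the oracle `O_i`, followed by the controlled rotation. -/
def circuitU (L H : ℝ) (i : Fin T) : Circuit (Ancilla k) (Register 𝒦 E) T :=
  [.experiment i false fun _ => true, .free (controlledRotation L H)]

/-- The circuit `V_i = (U_i† ⊗ I)(I ⊗ CNOT)(U_i ⊗ I)`. -/
def circuitV (L H : ℝ) (i : Fin T) : Circuit (Ancilla k) (Register 𝒦 E) T :=
  circuitU L H i ++ [.free cnot] ++ (circuitU L H i).adjoint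

/-- The number `l` of iterations of the fixed-point search with accuracy `ε'`. -/
def fixIterations (ε' : ℝ) : ℕ := ⌈Real.log (4 / ε')⌉₊

/-- The phases `α_j = 2 arccot(tan(2πj/(2l+1)) √(1-γ²))`, where
`1/γ = cosh(arcosh(1/d)/(2l+1))` and `d = ε'/2`, of the fixed-point search of Yoder, Low and
Chuang with accuracy `ε'`; here `arccot x = π/2 - arctan x`. -/
def fixPhase (ε' : ℝ) (j : ℕ) : ℝ :=
  Real.pi - 2 * Real.arctan
    (Real.tan (2 * Real.pi * j / (2 * fixIterations ε' + 1)) *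
      √(1 - ((Real.cosh (Real.arcosh (2 / ε') / (2 * fixIterations ε' + 1)))⁻¹) ^ 2))

/-- The circuit `S_i = Fix(V_i, |𝟎⟩|0⟩⟨0|⟨𝟎| ⊗ I, ε')`: the fixed-point search of Yoder, Low and
Chuang, which is `V_i` followed, for `j = 1, …, l`, by the generalized Grover iterations
`V_i (I - (1 - e^{-iα_j}) |𝟎00⟩⟨𝟎00|) V_i† (I - (1 - e^{iβ_j}) Π)` with
`Π = |𝟎⟩|0⟩⟨0|⟨𝟎| ⊗ I` and `β_j = -α_{l+1-j}` (up to an irrelevant global sign). -/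
def circuitS (z : Register 𝒦 E) (hz : ‖z‖ = 1) (L H ε' : ℝ) (i : Fin T) :
    Circuit (Ancilla k) (Register 𝒦 E) T :=
  circuitV L H i ++
    (List.range (fixIterations ε')).flatMap fun j =>
      [phaseGate z hz (fun a => !a.2.1) (-fixPhase ε' (fixIterations ε' - j))] ++
      (circuitV L H i).adjoint ++
      [phaseGate z hz (fun a => !a.2.1 && !a.2.2) (-fixPhase ε' (j + 1))] ++
      circuitV L H i

/-- The `s`-th Grover iteration of amplitude estimation,
`(2 S_i|𝟎00⟩⟨𝟎00|S_i† - I)(I - 2 I ⊗ |1⟩⟨1|)`, applied when the counter is at least `s`. -/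
def circuitGrover (z : Register 𝒦 E) (hz : ‖z‖ = 1) (L H ε' : ℝ) (i : Fin T) (s : ℕ) :
    Circuit (Ancilla k) (Register 𝒦 E) T :=
  [signGate fun a => decide (s ≤ (a.1 : ℕ)) && !a.2.2] ++
    (circuitS z hz L H ε' i).adjoint ++
    [phaseGate z hz (fun a => decide (s ≤ (a.1 : ℕ)) && !a.2.1 && !a.2.2) Real.pi] ++
    circuitS z hz L H ε' i

/-- Amplitude estimation `Amp(S, k + 1)` of Brassard, Høyer, Mosca and Tapp, in which the initial
`S` is replaced by `S_{σ 0}` and the `S` of the `s`-th Grover iteration by `S_{σ s}`,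
`s = 1, …, k`. -/
def meanCircuit (z : Register 𝒦 E) (hz : ‖z‖ = 1) (L H ε' : ℝ) (σ : Fin (k + 1) → Fin T) :
    Circuit (Ancilla k) (Register 𝒦 E) T :=
  [.free counterFourier] ++ circuitS z hz L H ε' (σ 0) ++
    (List.finRange k).flatMap
      (fun s : Fin k => circuitGrover z hz L H ε' (σ s.succ) ((s : ℕ) + 1)) ++
    [.free counterFourier.symm]

/-- The estimate `p̃ = sin²(πy/(k+1))` of the amplitude when the counter is measured to be `y`. -/
def amplitudeEstimate (k : ℕ) (y : Fin (k + 1)) : ℝ :=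
  Real.sin (Real.pi * (y : ℕ) / (k + 1 : ℕ)) ^ 2

/-- The output `(p̃ - √(p̃(1-p̃)))/(2p̃-1) · (H-L) + L`, where the quotient is continuously extended
by the value `1/2` at `p̃ = 1/2`. -/
def meanEstimate (L H p : ℝ) : ℝ :=
  (if p = 1 / 2 then 1 / 2 else (p - √(p * (1 - p))) / (2 * p - 1)) * (H - L) + L

/-- The probability that the counter is measured to be `y` when the algorithm is run on
`|0⟩|0⟩|0⟩|𝟎⟩`. -/
def outcomeProbability (z : Register 𝒦 E) (hz : ‖z‖ = 1) (L H ε' : ℝ)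
    (σ : Fin (k + 1) → Fin T) (O : Fin T → (Register 𝒦 E ≃ₗᵢ[ℂ] Register 𝒦 E))
    (y : Fin (k + 1)) : ℝ :=
  ∑ b : Bool × Bool,
    ‖(meanCircuit z hz L H ε' σ).toUnitary O
        (WithLp.toLp 2 (Pi.single ((0, false, false) : Ancilla k) z)) (y, b)‖ ^ 2

open Classical in
/-- The probability that the output of the algorithm is within `ε` of `μ`. -/
def successProbability (z : Register 𝒦 E) (hz : ‖z‖ = 1) (L H ε' : ℝ)
    (σ : Fin (k + 1) → Fin T) (O : Fin T → (Register 𝒦 E ≃ₗᵢ[ℂ] Register 𝒦 E))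
    (μ ε : ℝ) : ℝ :=
  ∑ y : Fin (k + 1),
    if |meanEstimate L H (amplitudeEstimate k y) - μ| ≤ ε
    then outcomeProbability z hz L H ε' σ O y else 0

end Algorithm

end

/-! Put e = ε/(H-L), q = (μ-L)/(H-L) and p_i = (E[X_i]-L)/(H-L), so that |p_i - q| ≤ e/2. The
component of V_i|𝟎00⟩ in the range of Π carries the amplitudes 1-p_i and p_i on the second qubit
(`inner_ket_circuitV`). The garbage states enter only through norms. After normalization the target
is cos θ_i|0⟩ + sin θ_i|1⟩ with tan θ_i = p_i/(1-p_i). It depends on the mean alone, which is why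
different oracles can stand in for each other.

The target has overlap w² = p_i² + (1-p_i)² ≥ 1/2, so fixed-point search with about log(1/ε')
iterations reaches it. The search stays in the plane of the target and the rest of the initial
state, and its amplitudes, taken after each of the two reflections, satisfy a three-term recurrence.
For the prescribed phases the solution at step 2l+1 is T_{2l+1}(x cosh v)/cosh((2l+1)v), where x is
the initial amplitude off the target (`phasedPoly_eq_chebyshev`). This Chebyshev identity is proved
by interpolation: at the 2l+2 points ±cos(2rφ - iv) the recurrence has explicit trigonometric
solutions that are periodic with period 2l+1. Since cosh((2l+1)v) = 2/ε', the amplitude left off the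
target is at most ε'/2, and S_i prepares the target up to a phase and an error ε'
(`exists_phase_circuitS`).

The phase cancels in the projector onto S_i|𝟎00⟩, so the s-th Grover iteration turns the second
qubit by 2θ_{σ(s)} up to 4ε'. The counter value j is therefore paired with an angle Θ_j whose
increments all lie near 2ϑ, tan ϑ = q/(1-q), instead of being constant as in ordinary amplitude
estimation. Exact eigenphases are not available, and a Fourier localization bound replaces them
(`sum_norm_sq_invFourier_le`): if the signal f changes from j to j+1 by the factor exp(2iϑ) up to κ,
then after a smooth cutoff Parseval's identity bounds its energy at frequencies at chord distance at
least K from 2ϑ by about (κ/K)² of the total.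

The chord between the angles of p and q is |p-q| divided by a geometric mean of p²+(1-p)² and
q²+(1-q)² (`cross_sq_mul`). Inputs have |p-q| ≤ e/2, while a rejected outcome has |p-q| > e. Hence
κ/K is close to 1/2, and the failure probability is close to 1/4. The slack between 1/4 and 1/3
absorbs the window, the imperfect searches and the rounding in the constants. -/

/-! ### A three-term recurrence solved by Chebyshev polynomials -/

section PhasedRecurrence

open Polynomial

/-- The polynomials determined by `p₀ = 1`, `p₁ = X / cosh v` and
`cos (hφ - iv) p_{h+1} + cos (hφ + iv) p_{h-1} = 2 cos (hφ) X p_h`. -/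
noncomputable def phasedPoly (φ v : ℝ) : ℕ → ℂ[X]
  | 0 => 1
  | 1 => C (1 / (Real.cosh v : ℂ)) * X
  | h + 2 =>
      C (2 * Complex.cos ((h + 1 : ℕ) * φ) / Complex.cos ((h + 1 : ℕ) * φ - v * Complex.I)) * X *
          phasedPoly φ v (h + 1) -
        C (Complex.cos ((h + 1 : ℕ) * φ + v * Complex.I) /
          Complex.cos ((h + 1 : ℕ) * φ - v * Complex.I)) * phasedPoly φ v h

theorem natDegree_phasedPoly_le (φ v : ℝ) (h : ℕ) : (phasedPoly φ v h).natDegree ≤ h := by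
  induction h using Nat.twoStepInduction with
  | zero => simp [phasedPoly]
  | one =>
    rw [phasedPoly]
    exact (natDegree_C_mul_le _ _).trans natDegree_X_le
  | more h ih1 ih2 =>
    rw [phasedPoly]
    refine (natDegree_sub_le _ _).trans (max_le ?_ ?_)
    · refine natDegree_mul_le.trans ?_
      have := (natDegree_C_mul_le (2 * Complex.cos ((h + 1 : ℕ) * φ) /
        Complex.cos ((h + 1 : ℕ) * φ - v * Complex.I)) (X : ℂ[X])).trans natDegree_X_le
      omega
    · exact (natDegree_C_mul_le _ _).trans (by omega)

theorem eval_neg_phasedPoly (φ v : ℝ) (h : ℕ) (y : ℂ) :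
    (phasedPoly φ v h).eval (-y) = (-1) ^ h * (phasedPoly φ v h).eval y := by
  induction h using Nat.twoStepInduction with
  | zero => simp [phasedPoly]
  | one => simp [phasedPoly]
  | more h ih1 ih2 =>
    simp only [phasedPoly, eval_sub, eval_mul, eval_C, eval_X, ih1, ih2]
    ring

theorem cos_sub_mul_I_ne_zero (t : ℝ) {v : ℝ} (hv : 0 < v) :
    Complex.cos (t - v * Complex.I) ≠ 0 := by
  intro h
  rw [Complex.cos_eq_zero_iff] at h
  obtain ⟨k, hk⟩ := h
  have := congrArg Complex.im hk
  simp at this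
  linarith

/-- The leading coefficient cos(hφ - iv) never vanishes for v > 0, because the zeros of the cosine
are real. So a solution is determined by its value at 0. -/
theorem eq_mul_eval_phasedPoly {φ v : ℝ} (hv : 0 < v) (y : ℂ) (s : ℕ → ℂ)
    (h1 : s 1 = y / Real.cosh v * s 0)
    (hs : ∀ h : ℕ, Complex.cos ((h + 1 : ℕ) * φ - v * Complex.I) * s (h + 2) +
      Complex.cos ((h + 1 : ℕ) * φ + v * Complex.I) * s h =
        2 * Complex.cos ((h + 1 : ℕ) * φ) * y * s (h + 1)) (h : ℕ) :
    s h = s 0 * (phasedPoly φ v h).eval y := by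
  induction h using Nat.twoStepInduction with
  | zero => simp [phasedPoly]
  | one => rw [h1]; simp [phasedPoly]; ring
  | more h ih1 ih2 =>
    have hc : Complex.cos ((h + 1 : ℕ) * φ - v * Complex.I) ≠ 0 := by
      have := cos_sub_mul_I_ne_zero ((h + 1 : ℕ) * φ) hv
      exact_mod_cast this
    simp only [phasedPoly, eval_sub, eval_mul, eval_C, eval_X]
    apply mul_left_cancel₀ hc
    have := hs h
    rw [ih1, ih2] at this
    generalize Complex.cos ((h + 1 : ℕ) * φ - v * Complex.I) = c at *
    field_simp
    linear_combination this

/-- Equal cosines have arguments equal up to sign modulo 2π. Both imaginary parts are -v ≠ 0, which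
rules out the opposite sign, and the real parts give the divisibility. -/
theorem cos_int_mul_eq_cos {L : ℕ} (hL : L ≠ 0) {v : ℝ} (hv : 0 < v) {m n : ℤ}
    (h : Complex.cos (m * (Real.pi / L : ℝ) - v * Complex.I) =
      Complex.cos (n * (Real.pi / L : ℝ) - v * Complex.I)) : (2 * L : ℤ) ∣ n - m := by
  have hL' : (L : ℝ) ≠ 0 := by exact_mod_cast hL
  obtain ⟨k, hk | hk⟩ := Complex.cos_eq_cos_iff.1 h
  · refine ⟨k, ?_⟩
    have h1 := congrArg Complex.re hk
    simp only [Complex.sub_re, Complex.add_re, Complex.mul_re, Complex.I_re, Complex.I_im,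
      Complex.ofReal_re, Complex.ofReal_im, Complex.intCast_re, Complex.intCast_im,
      Complex.re_ofNat, Complex.im_ofNat, Complex.mul_im] at h1
    have h2 : (n : ℝ) - m = 2 * L * k := by
      have hpi := Real.pi_pos.ne'
      field_simp at h1
      exact mul_left_cancel₀ hpi (by linarith)
    exact_mod_cast h2
  · have h1 := congrArg Complex.im hk
    simp only [Complex.sub_im, Complex.mul_re, Complex.I_re, Complex.I_im,
      Complex.ofReal_re, Complex.ofReal_im, Complex.intCast_re, Complex.intCast_im,
      Complex.re_ofNat, Complex.im_ofNat, Complex.mul_im] at h1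
    linarith

theorem cos_int_mul_add_eq_cos {L : ℕ} (hL : L ≠ 0) {v : ℝ} (hv : 0 < v) {m n : ℤ}
    (h : Complex.cos (m * (Real.pi / L : ℝ) + v * Complex.I) =
      Complex.cos (n * (Real.pi / L : ℝ) - v * Complex.I)) : (2 * L : ℤ) ∣ n + m := by
  have := cos_int_mul_eq_cos hL hv (m := -m) (n := n) (by
    rw [← h, ← Complex.cos_neg]; push_cast; congr 1; ring)
  simpa using this

/-- The coefficients of the trigonometric solution of the recurrence at `cos (2rφ - iv)`. -/
noncomputable def trigCoeff (φ v : ℝ) (r : ℕ) : ℕ → ℂ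
  | 0 => 1
  | i + 1 => -trigCoeff φ v r i *
      (Complex.cos ((2 * (i - r) : ℤ) * φ - v * Complex.I) -
        Complex.cos ((2 * r : ℤ) * φ - v * Complex.I)) /
      (Complex.cos ((2 * ((i + 1 : ℕ) - r) : ℤ) * φ + v * Complex.I) -
        Complex.cos ((2 * r : ℤ) * φ - v * Complex.I))

/-- The trigonometric solution of the recurrence at `cos (2rφ - iv)`. -/
noncomputable def trigSol (φ v : ℝ) (r : ℕ) (h : ℤ) : ℂ :=
  ∑ i ∈ Finset.range (2 * r + 1),
    trigCoeff φ v r i * Complex.exp (h * ((2 * (i - r) : ℤ) * φ * Complex.I))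

/-- A vanishing factor would make 2(2l+1) divide one of the integers 4r - 2i or 2(i+1) with i < 2r.
These lie between 2 and 4r ≤ 4l. -/
theorem trigCoeff_ne_zero {l r : ℕ} (hr : r ≤ l) {v : ℝ} (hv : 0 < v) {i : ℕ} (hi : i ≤ 2 * r) :
    trigCoeff (Real.pi / (2 * l + 1 : ℕ)) v r i ≠ 0 := by
  induction i with
  | zero => simp [trigCoeff]
  | succ i ih =>
    rw [trigCoeff]
    refine div_ne_zero (mul_ne_zero (neg_ne_zero.2 (ih (by omega))) ?_) ?_
    · rw [sub_ne_zero]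
      intro h
      obtain ⟨k, hk⟩ := cos_int_mul_eq_cos (by omega) hv h
      push_cast at hk
      obtain hk0 | hk0 : k ≤ 0 ∨ 1 ≤ k := by omega
      · nlinarith
      · nlinarith
    · rw [sub_ne_zero]
      intro h
      obtain ⟨k, hk⟩ := cos_int_mul_add_eq_cos (by omega) hv h
      push_cast at hk
      obtain hk0 | hk0 : k ≤ 0 ∨ 1 ≤ k := by omega
      · nlinarith
      · nlinarith

theorem trigCoeff_succ_mul {l r : ℕ} (hr : r ≤ l) {v : ℝ} (hv : 0 < v) {i : ℕ} (hi : i < 2 * r) :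
    trigCoeff (Real.pi / (2 * l + 1 : ℕ)) v r (i + 1) *
      (Complex.cos ((2 * ((i + 1 : ℕ) - r) : ℤ) * (Real.pi / (2 * l + 1 : ℕ) : ℝ) + v * Complex.I) -
        Complex.cos ((2 * r : ℤ) * (Real.pi / (2 * l + 1 : ℕ) : ℝ) - v * Complex.I)) =
    -trigCoeff (Real.pi / (2 * l + 1 : ℕ)) v r i *
      (Complex.cos ((2 * (i - r) : ℤ) * (Real.pi / (2 * l + 1 : ℕ) : ℝ) - v * Complex.I) -
        Complex.cos ((2 * r : ℤ) * (Real.pi / (2 * l + 1 : ℕ) : ℝ) - v * Complex.I)) := by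
  rw [trigCoeff, div_mul_cancel₀]
  rw [sub_ne_zero]
  intro h
  obtain ⟨k, hk⟩ := cos_int_mul_add_eq_cos (by omega) hv h
  push_cast at hk
  obtain hk0 | hk0 : k ≤ 0 ∨ 1 ≤ k := by omega
  · nlinarith
  · nlinarith

theorem trigSol_recurrence {l r : ℕ} (hr : r ≤ l) {v : ℝ} (hv : 0 < v) {φ : ℝ}
    (hφ : φ = Real.pi / (2 * l + 1 : ℕ)) (h : ℤ) :
    Complex.cos (h * φ - v * Complex.I) * trigSol φ v r (h + 1) +
      Complex.cos (h * φ + v * Complex.I) * trigSol φ v r (h - 1) =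
    2 * Complex.cos (h * φ) * Complex.cos ((2 * r : ℤ) * φ - v * Complex.I) * trigSol φ v r h := by
  set y := Complex.cos ((2 * r : ℤ) * φ - v * Complex.I) with hy
  set num : ℕ → ℂ := fun i => Complex.cos ((2 * (i - r) : ℤ) * φ - v * Complex.I) - y with hnum
  set den : ℕ → ℂ := fun i => Complex.cos ((2 * (i - r) : ℤ) * φ + v * Complex.I) - y with hden
  set w := trigCoeff φ v r with hw
  -- the term on the frequency `2(i - r) + 1`
  set F : ℕ → ℂ := fun i => Complex.exp (h * ((2 * (i - r) + 1 : ℤ) * φ * Complex.I)) with hF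
  set G : ℕ → ℂ := fun i => Complex.exp (h * ((2 * (i - r) - 1 : ℤ) * φ * Complex.I)) with hG
  -- The recurrence operator sends the exponential of even frequency 2(i-r) to the two neighbouring
  -- odd frequencies only, with weights `num i` and `den i`.
  have hterm : ∀ i : ℕ,
      Complex.cos (h * φ - v * Complex.I) *
          (w i * Complex.exp ((h + 1 : ℤ) * ((2 * (i - r) : ℤ) * φ * Complex.I))) +
        Complex.cos (h * φ + v * Complex.I) *
          (w i * Complex.exp ((h - 1 : ℤ) * ((2 * (i - r) : ℤ) * φ * Complex.I))) -
      2 * Complex.cos (h * φ) * y *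
          (w i * Complex.exp (h * ((2 * (i - r) : ℤ) * φ * Complex.I))) =
      w i * num i * F i + w i * den i * G i := by
    intro i
    simp only [hnum, hden, hF, hG]
    set j : ℤ := 2 * (i - r)
    have e1 : Complex.exp ((h + 1 : ℤ) * ((j : ℤ) * φ * Complex.I)) =
        Complex.exp (h * (j * φ * Complex.I)) * Complex.exp (j * φ * Complex.I) := by
      rw [← Complex.exp_add]; congr 1; push_cast; ring
    have e2 : Complex.exp ((h - 1 : ℤ) * ((j : ℤ) * φ * Complex.I)) =
        Complex.exp (h * (j * φ * Complex.I)) * Complex.exp (-(j * φ * Complex.I)) := by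
      rw [← Complex.exp_add]; congr 1; push_cast; ring
    have e3 : Complex.exp (h * ((j + 1 : ℤ) * φ * Complex.I)) =
        Complex.exp (h * (j * φ * Complex.I)) * Complex.exp (h * φ * Complex.I) := by
      rw [← Complex.exp_add]; congr 1; push_cast; ring
    have e4 : Complex.exp (h * ((j - 1 : ℤ) * φ * Complex.I)) =
        Complex.exp (h * (j * φ * Complex.I)) * Complex.exp (-(h * φ * Complex.I)) := by
      rw [← Complex.exp_add]; congr 1; push_cast; ring
    rw [e1, e2, e3, e4]
    have c1 : Complex.cos (h * φ - v * Complex.I) =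
        (Complex.exp (h * φ * Complex.I) * Complex.exp v +
          Complex.exp (-(h * φ * Complex.I)) * Complex.exp (-v)) / 2 := by
      rw [Complex.cos, ← Complex.exp_add, ← Complex.exp_add]
      congr 3
      · linear_combination (-(v : ℂ)) * Complex.I_sq
      · linear_combination (v : ℂ) * Complex.I_sq
    have c2 : Complex.cos (h * φ + v * Complex.I) =
        (Complex.exp (h * φ * Complex.I) * Complex.exp (-v) +
          Complex.exp (-(h * φ * Complex.I)) * Complex.exp v) / 2 := by
      rw [Complex.cos, ← Complex.exp_add, ← Complex.exp_add]
      congr 3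
      · linear_combination (v : ℂ) * Complex.I_sq
      · linear_combination (-(v : ℂ)) * Complex.I_sq
    have c3 : Complex.cos (j * φ - v * Complex.I) =
        (Complex.exp (j * φ * Complex.I) * Complex.exp v +
          Complex.exp (-(j * φ * Complex.I)) * Complex.exp (-v)) / 2 := by
      rw [Complex.cos, ← Complex.exp_add, ← Complex.exp_add]
      congr 3
      · linear_combination (-(v : ℂ)) * Complex.I_sq
      · linear_combination (v : ℂ) * Complex.I_sq
    have c4 : Complex.cos (j * φ + v * Complex.I) =
        (Complex.exp (j * φ * Complex.I) * Complex.exp (-v) +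
          Complex.exp (-(j * φ * Complex.I)) * Complex.exp v) / 2 := by
      rw [Complex.cos, ← Complex.exp_add, ← Complex.exp_add]
      congr 3
      · linear_combination (v : ℂ) * Complex.I_sq
      · linear_combination (-(v : ℂ)) * Complex.I_sq
    have c5 : Complex.cos (h * φ) =
        (Complex.exp (h * φ * Complex.I) + Complex.exp (-(h * φ * Complex.I))) / 2 := by
      rw [Complex.cos]; congr 3; ring
    rw [c1, c2, c3, c4, c5]
    ring
  -- The recursion of the coefficients cancels the two contributions to each inner odd frequency.
  -- The outermost ones vanish because y = cos(2rφ - iv) is a value of the cosine at both extreme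
  -- frequencies ±2r.
  have hsum : ∑ i ∈ Finset.range (2 * r + 1), (w i * num i * F i + w i * den i * G i) = 0 := by
    rw [Finset.sum_add_distrib, Finset.sum_range_succ, Finset.sum_range_succ']
    have hn : num (2 * r) = 0 := by
      simp only [hnum, hy]
      rw [sub_eq_zero]; push_cast; congr 1; ring
    have hd : den 0 = 0 := by
      simp only [hden, hy]
      rw [sub_eq_zero, ← Complex.cos_neg]; push_cast; congr 1; ring
    rw [hn, hd]
    simp only [mul_zero, zero_mul, add_zero]
    rw [← Finset.sum_add_distrib]
    refine Finset.sum_eq_zero fun i hi => ?_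
    have h1 := trigCoeff_succ_mul hr hv (Finset.mem_range.1 hi)
    rw [← hφ] at h1
    have h2 : G (i + 1) = F i := by
      simp only [hF, hG]; push_cast; congr 1; ring
    rw [h2]
    have h1' : w (i + 1) * den (i + 1) = -w i * num i := h1
    rw [h1']; ring
  have := Finset.sum_congr (rfl : Finset.range (2 * r + 1) = _) fun i _ => hterm i
  rw [hsum, Finset.sum_sub_distrib, Finset.sum_add_distrib, ← Finset.mul_sum, ← Finset.mul_sum,
    ← Finset.mul_sum] at this
  rw [trigSol, trigSol, trigSol]
  linear_combination this

theorem eval_phasedPoly_cos {l r : ℕ} (hr : r ≤ l) {v : ℝ} (hv : 0 < v) {φ : ℝ}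
    (hφ : φ = Real.pi / (2 * l + 1 : ℕ)) :
    (phasedPoly φ v (2 * l + 1)).eval (Complex.cos ((2 * r : ℤ) * φ - v * Complex.I)) = 1 := by
  set y := Complex.cos ((2 * r : ℤ) * φ - v * Complex.I) with hy
  -- The reflection h ↦ -h preserves the recurrence. For the even solution, the recurrence at h = 0
  -- becomes the required initial relation between `s 1` and `s 0`.
  set s : ℕ → ℂ := fun h => trigSol φ v r h + trigSol φ v r (-h) with hs
  have hL : (((2 * l + 1 : ℕ) : ℝ)) ≠ 0 := by positivity
  have hcosh : ((Real.cosh v : ℝ) : ℂ) ≠ 0 := by exact_mod_cast (Real.cosh_pos v).ne'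
  have hs1 : s 1 = y / Real.cosh v * s 0 := by
    have h0 := trigSol_recurrence hr hv hφ 0
    rw [Int.cast_zero, zero_mul, zero_sub, zero_add, zero_add, Complex.cos_neg, Complex.cos_mul_I,
      Complex.cos_zero, zero_sub, ← hy] at h0
    simp only [hs, Nat.cast_one, Nat.cast_zero, neg_zero]
    rw [Complex.ofReal_cosh] at hcosh ⊢
    field_simp
    linear_combination h0
  have hsrec : ∀ h : ℕ, Complex.cos ((h + 1 : ℕ) * φ - v * Complex.I) * s (h + 2) +
      Complex.cos ((h + 1 : ℕ) * φ + v * Complex.I) * s h =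
        2 * Complex.cos ((h + 1 : ℕ) * φ) * y * s (h + 1) := by
    intro h
    have h1 := trigSol_recurrence hr hv hφ ((h + 1 : ℕ) : ℤ)
    have h2 := trigSol_recurrence hr hv hφ (-((h + 1 : ℕ) : ℤ))
    have e1 : ((h + 1 : ℕ) : ℤ) + 1 = ((h + 2 : ℕ) : ℤ) := by push_cast; ring
    have e2 : ((h + 1 : ℕ) : ℤ) - 1 = (h : ℤ) := by push_cast; ring
    have e3 : -((h + 1 : ℕ) : ℤ) + 1 = -(h : ℤ) := by push_cast; ring
    have e4 : -((h + 1 : ℕ) : ℤ) - 1 = -((h + 2 : ℕ) : ℤ) := by push_cast; ring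
    rw [e1, e2] at h1
    rw [e3, e4] at h2
    have c1 : Complex.cos (((-((h + 1 : ℕ) : ℤ) : ℤ) : ℂ) * φ - v * Complex.I) =
        Complex.cos ((h + 1 : ℕ) * φ + v * Complex.I) := by
      rw [← Complex.cos_neg]; push_cast; congr 1; ring
    have c2 : Complex.cos (((-((h + 1 : ℕ) : ℤ) : ℤ) : ℂ) * φ + v * Complex.I) =
        Complex.cos ((h + 1 : ℕ) * φ - v * Complex.I) := by
      rw [← Complex.cos_neg]; push_cast; congr 1; ring
    have c3 : Complex.cos (((-((h + 1 : ℕ) : ℤ) : ℤ) : ℂ) * φ) =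
        Complex.cos ((h + 1 : ℕ) * φ) := by
      rw [← Complex.cos_neg]; push_cast; congr 1; ring
    rw [c1, c2, c3] at h2
    rw [Int.cast_natCast] at h1
    simp only [hs]
    linear_combination h1 + h2
  have hmul := eq_mul_eval_phasedPoly hv y s hs1 hsrec
  -- Otherwise s vanishes identically. The 2r+1 ≤ 2l+1 exponentials are distinct, so a Vandermonde
  -- argument kills every symmetrized coefficient. The middle one is twice a nonzero coefficient.
  have hs0 : s 0 ≠ 0 := by
    intro h0
    have hz : ∀ h, s h = 0 := fun h => by rw [hmul h, h0, zero_mul]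
    set w := trigCoeff φ v r with hw
    have hsum : ∀ h : ℕ, ∑ i : Fin (2 * r + 1), (w i + w (2 * r - i)) *
        Complex.exp ((2 * ((i : ℕ) - r) : ℤ) * φ * Complex.I) ^ h = 0 := by
      intro h
      rw [← hz h]
      simp only [hs, trigSol]
      rw [Fin.sum_univ_eq_sum_range (fun i => (w i + w (2 * r - i)) *
        Complex.exp ((2 * (i - r) : ℤ) * φ * Complex.I) ^ h)]
      simp only [add_mul, Finset.sum_add_distrib]
      congr 1
      · refine Finset.sum_congr rfl fun i _ => ?_
        rw [← Complex.exp_nat_mul]; push_cast; rfl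
      · rw [← Finset.sum_range_reflect]
        refine Finset.sum_congr rfl fun i hi => ?_
        have hi' := Finset.mem_range.1 hi
        have e1 : 2 * r + 1 - 1 - i = 2 * r - i := by omega
        have e2 : 2 * r - (2 * r - i) = i := by omega
        rw [← Complex.exp_nat_mul, e1, e2]
        congr 2
        rw [Nat.cast_sub (by omega)]
        push_cast
        ring
    have hinj : Function.Injective fun i : Fin (2 * r + 1) =>
        Complex.exp ((2 * ((i : ℕ) - r) : ℤ) * φ * Complex.I) := by
      intro i j hij
      obtain ⟨n, hn⟩ := Complex.exp_eq_exp_iff_exists_int.1 hij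
      have h1 := congrArg Complex.im hn
      simp only [Complex.add_im, Complex.mul_re, Complex.mul_im, Complex.I_re, Complex.I_im,
        Complex.ofReal_re, Complex.ofReal_im, Complex.intCast_re, Complex.intCast_im,
        Complex.re_ofNat, Complex.im_ofNat] at h1
      rw [hφ] at h1
      push_cast at h1 hL
      have h2 : ((i : ℕ) : ℝ) - (j : ℕ) = (2 * l + 1) * n := by
        have hpi := Real.pi_pos.ne'
        field_simp at h1
        exact mul_left_cancel₀ hpi (by linarith)
      have h3 : ((i : ℕ) : ℤ) - (j : ℕ) = (2 * l + 1) * n := by exact_mod_cast h2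
      have h4 := Int.eq_zero_of_abs_lt_dvd (Dvd.intro _ h3.symm) (by
        have := i.2; have := j.2; rw [abs_lt]; constructor <;> omega)
      exact Fin.ext (by omega)
    have hv0 := Matrix.eq_zero_of_forall_pow_sum_mul_pow_eq_zero hinj fun h => hsum h
    have hr0 := congrFun hv0 ⟨r, by omega⟩
    have hr1 : 2 * r - r = r := by omega
    simp only [Pi.zero_apply, hr1] at hr0
    have hne := trigCoeff_ne_zero hr hv (i := r) (by omega)
    rw [← hφ, ← hw] at hne
    apply hne
    linear_combination hr0 / 2
  -- All frequencies are even multiples of φ = π/(2l+1), so the solution has period 2l+1.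
  have hsL : s (2 * l + 1) = s 0 := by
    have hper : ∀ ε : ℤ, trigSol φ v r (ε * (2 * l + 1 : ℕ)) = trigSol φ v r 0 := by
      intro ε
      refine Finset.sum_congr rfl fun i _ => ?_
      congr 1
      rw [Int.cast_zero, zero_mul, Complex.exp_zero, Complex.exp_eq_one_iff]
      refine ⟨ε * (i - r), ?_⟩
      have hLc : ((2 * l + 1 : ℕ) : ℂ) ≠ 0 := by exact_mod_cast hL
      rw [hφ]
      push_cast at hLc ⊢
      field_simp
    have h1 := hper 1
    have h2 := hper (-1)
    rw [one_mul] at h1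
    rw [neg_one_mul] at h2
    simp only [hs, h1, h2, Nat.cast_zero, neg_zero]
  have h1 := hmul (2 * l + 1)
  rw [hsL] at h1
  exact (mul_left_cancel₀ hs0 (by rw [← h1, mul_one])).symm

/-- Both sides have degree at most 2l+1 and agree at the 2l+2 points ±cos(2rφ - iv), 0 ≤ r ≤ l; the
negative points follow by oddness. A negative point is a cosine at an odd multiple of φ, so parity
separates it from the positive ones. -/
theorem phasedPoly_eq_chebyshev (l : ℕ) {v : ℝ} (hv : 0 < v) {φ : ℝ}
    (hφ : φ = Real.pi / (2 * l + 1 : ℕ)) :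
    C (Complex.cosh ((2 * l + 1 : ℕ) * v)) * phasedPoly φ v (2 * l + 1) =
      Chebyshev.T ℂ (2 * l + 1 : ℕ) := by
  rw [← sub_eq_zero]
  have hL : (((2 * l + 1 : ℕ) : ℝ)) ≠ 0 := by positivity
  set f : Fin (l + 1) ⊕ Fin (l + 1) → ℂ := Sum.elim
    (fun r => Complex.cos ((2 * (r : ℕ) : ℤ) * φ - v * Complex.I))
    (fun r => -Complex.cos ((2 * (r : ℕ) : ℤ) * φ - v * Complex.I)) with hf
  have hneg : ∀ r : ℕ, -Complex.cos ((2 * r : ℤ) * φ - v * Complex.I) =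
      Complex.cos ((2 * r + (2 * l + 1 : ℕ) : ℤ) * φ - v * Complex.I) := by
    intro r
    rw [← Complex.cos_add_pi]
    have : (Real.pi : ℂ) = (2 * l + 1 : ℕ) * φ := by
      rw [hφ]
      have hLc : ((2 * l + 1 : ℕ) : ℂ) ≠ 0 := by exact_mod_cast hL
      push_cast at hLc ⊢
      field_simp
    rw [this]; push_cast; congr 1; ring
  have hfin : ∀ (r r' : Fin (l + 1)) (k : ℤ),
      2 * ((r' : ℕ) : ℤ) - 2 * ((r : ℕ) : ℤ) = 2 * ((2 * l + 1 : ℕ) : ℤ) * k → r = r' := by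
    intro r r' k hk
    have h1 := r.2
    have h2 := r'.2
    push_cast at hk
    obtain hk0 | hk0 | hk0 : k ≤ -1 ∨ k = 0 ∨ 1 ≤ k := by omega
    · nlinarith
    · subst hk0; exact Fin.ext (by omega)
    · nlinarith
  have hinj : Function.Injective f := by
    rintro (r | r) (r' | r') h
    · obtain ⟨k, hk⟩ := cos_int_mul_eq_cos (L := 2 * l + 1) (m := 2 * (r : ℕ))
        (n := 2 * (r' : ℕ)) (by omega) hv (by rw [← hφ]; exact h)
      rw [hfin r r' k hk]
    · obtain ⟨k, hk⟩ := cos_int_mul_eq_cos (L := 2 * l + 1) (m := 2 * (r : ℕ))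
        (n := 2 * (r' : ℕ) + (2 * l + 1 : ℕ)) (by omega) hv
        (by rw [← hφ, ← hneg]; exact h)
      rw [mul_assoc] at hk
      omega
    · obtain ⟨k, hk⟩ := cos_int_mul_eq_cos (L := 2 * l + 1) (m := 2 * (r' : ℕ))
        (n := 2 * (r : ℕ) + (2 * l + 1 : ℕ)) (by omega) hv
        (by rw [← hφ, ← hneg]; exact h.symm)
      rw [mul_assoc] at hk
      omega
    · obtain ⟨k, hk⟩ := cos_int_mul_eq_cos (L := 2 * l + 1) (m := 2 * (r : ℕ))
        (n := 2 * (r' : ℕ)) (by omega) hv (by rw [← hφ]; exact neg_injective h)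
      rw [hfin r r' k hk]
  have hT : ∀ r : Fin (l + 1), (Chebyshev.T ℂ (2 * l + 1 : ℕ)).eval
      (Complex.cos ((2 * (r : ℕ) : ℤ) * φ - v * Complex.I)) =
        Complex.cosh ((2 * l + 1 : ℕ) * v) := by
    intro r
    rw [Chebyshev.T_complex_cos, ← Complex.cos_mul_I, ← Complex.cos_neg]
    have hLc : ((2 * l + 1 : ℕ) : ℂ) ≠ 0 := by exact_mod_cast hL
    rw [show -((((2 * l + 1 : ℕ) : ℤ) : ℂ) * ((2 * (r : ℕ) : ℤ) * φ - v * Complex.I)) =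
      (2 * l + 1 : ℕ) * v * Complex.I - (r : ℕ) * (2 * Real.pi) by
        rw [hφ]; push_cast at hLc ⊢; field_simp; ring]
    simp [Complex.cos_sub_nat_mul_two_pi]
  refine eq_zero_of_natDegree_lt_card_of_eval_eq_zero _ hinj ?_ ?_
  · rintro (r | r)
    · simp only [hf, Sum.elim_inl, eval_sub, eval_mul, eval_C]
      rw [hT, eval_phasedPoly_cos (by have := r.2; omega) hv hφ, mul_one, sub_self]
    · simp only [hf, Sum.elim_inr, eval_sub, eval_mul, eval_C]
      rw [Chebyshev.T_eval_neg, hT, eval_neg_phasedPoly,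
        eval_phasedPoly_cos (by have := r.2; omega) hv hφ]
      have : (((2 * l + 1 : ℕ) : ℤ).negOnePow : ℤ) = -1 := by
        rw [Int.negOnePow_odd]
        · rfl
        · exact ⟨l, by push_cast; ring⟩
      rw [this, Odd.neg_one_pow ⟨l, rfl⟩]
      push_cast; ring
  · refine lt_of_le_of_lt (natDegree_sub_le _ _) ?_
    rw [Fintype.card_sum, Fintype.card_fin, Chebyshev.natDegree_T]
    refine max_lt ?_ ?_
    · refine lt_of_le_of_lt ((natDegree_C_mul_le _ _).trans (natDegree_phasedPoly_le _ _ _)) ?_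
      omega
    · omega

/-- The phase factors of the fixed-point search. -/
noncomputable def searchPhase (φ v : ℝ) (h : ℕ) : ℂ :=
  -Complex.cos (h * φ + v * Complex.I) / Complex.cos (h * φ - v * Complex.I)

/-- Since cos(hφ - iv) + cos(hφ + iv) = 2 cos(hφ) cosh v, the factor (1 - ω_h)x with ω_h the phase
factor is the coefficient of `phasedPoly` at y = x cosh v. For |y| ≤ 1 the Chebyshev polynomial is
bounded by 1. -/
theorem norm_phased_recurrence_le (l : ℕ) {v : ℝ} (hv : 0 < v) {x : ℝ}
    (hx : |x * Real.cosh v| ≤ 1) (a : ℕ → ℂ) (h0 : a 0 = 1) (h1 : a 1 = x)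
    (hrec : ∀ h, h + 1 ≤ 2 * l → a (h + 2) =
      (1 - searchPhase (Real.pi / (2 * l + 1 : ℕ)) v (h + 1)) * x * a (h + 1) +
        searchPhase (Real.pi / (2 * l + 1 : ℕ)) v (h + 1) * a h) :
    ‖a (2 * l + 1)‖ * Real.cosh ((2 * l + 1 : ℕ) * v) ≤ 1 := by
  set φ : ℝ := Real.pi / (2 * l + 1 : ℕ) with hφ
  have hcosh : ((Real.cosh v : ℝ) : ℂ) ≠ 0 := by exact_mod_cast (Real.cosh_pos v).ne'
  set y : ℝ := x * Real.cosh v with hy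
  have ha : ∀ h, h ≤ 2 * l + 1 → a h = (phasedPoly φ v h).eval (y : ℂ) := by
    intro h
    induction h using Nat.twoStepInduction with
    | zero => intro _; simp [phasedPoly, h0]
    | one =>
      intro _
      simp only [phasedPoly, h1, eval_mul, eval_C, eval_X, hy]
      rw [Complex.ofReal_mul]
      field_simp
    | more h ih1 ih2 =>
      intro hh
      rw [hrec h (by omega), ih1 (by omega), ih2 (by omega)]
      have hc : Complex.cos ((h + 1 : ℕ) * φ - v * Complex.I) ≠ 0 := by
        have := cos_sub_mul_I_ne_zero ((h + 1 : ℕ) * φ) hv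
        exact_mod_cast this
      have hadd : Complex.cos ((h + 1 : ℕ) * φ - v * Complex.I) +
          Complex.cos ((h + 1 : ℕ) * φ + v * Complex.I) =
            2 * Complex.cos ((h + 1 : ℕ) * φ) * Real.cosh v := by
        rw [Complex.cos_sub, Complex.cos_add, Complex.cos_mul_I, Complex.ofReal_cosh]; ring
      simp only [phasedPoly, eval_sub, eval_mul, eval_C, eval_X, searchPhase, hy]
      rw [Complex.ofReal_mul]
      generalize Complex.cos ((h + 1 : ℕ) * φ - v * Complex.I) = c at *
      generalize Complex.cos ((h + 1 : ℕ) * φ + v * Complex.I) = d at *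
      field_simp
      linear_combination (x * (phasedPoly φ v (h + 1)).eval (x * (Real.cosh v : ℂ))) * hadd
  have hT := congrArg (eval (y : ℂ)) (phasedPoly_eq_chebyshev l hv hφ)
  rw [eval_mul, eval_C, ← ha _ le_rfl] at hT
  have hyc : (y : ℂ) = Complex.cos (Real.arccos y : ℝ) := by
    rw [← Complex.ofReal_cos, Real.cos_arccos (abs_le.1 hx).1 (abs_le.1 hx).2]
  rw [hyc, Chebyshev.T_complex_cos] at hT
  have hn := congrArg norm hT
  rw [norm_mul, mul_comm] at hn
  have e1 : ‖Complex.cosh ((2 * l + 1 : ℕ) * v)‖ = Real.cosh ((2 * l + 1 : ℕ) * v) := by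
    rw [show (((2 * l + 1 : ℕ) : ℂ) * v) = (((2 * l + 1 : ℕ) * v : ℝ) : ℂ) by push_cast; ring,
      ← Complex.ofReal_cosh, Complex.norm_real, Real.norm_of_nonneg (Real.cosh_pos _).le]
  rw [e1] at hn
  rw [hn, show ((((2 * l + 1 : ℕ) : ℤ) : ℂ) * (Real.arccos y : ℝ)) =
    (((2 * l + 1 : ℕ) * Real.arccos y : ℝ) : ℂ) by push_cast; ring, ← Complex.ofReal_cos,
    Complex.norm_real]
  exact Real.abs_cos_le_one _

end PhasedRecurrence

/-! ### The coefficients of the fixed-point search -/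

section SearchCoefficients

/-- The coefficients `(B, A)` of the state `B t + A r` of the search from `w t + r`, `‖r‖ = x`,
after `j` generalized Grover iterations with the phase factors `β` and `ς`. -/
noncomputable def searchCoeff (w x : ℝ) (β ς : ℕ → ℂ) : ℕ → ℂ × ℂ
  | 0 => (w, 1)
  | j + 1 =>
      let B := β j * (searchCoeff w x β ς j).1
      let A := (searchCoeff w x β ς j).2
      (B - (1 - ς j) * (w * B + x ^ 2 * A) * w, A - (1 - ς j) * (w * B + x ^ 2 * A))

theorem norm_searchPhase (φ : ℝ) {v : ℝ} (hv : 0 < v) (h : ℕ) : ‖searchPhase φ v h‖ = 1 := by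
  have hc : Complex.cos (h * φ - v * Complex.I) ≠ 0 := by
    have := cos_sub_mul_I_ne_zero (h * φ) hv
    exact_mod_cast this
  have : Complex.cos (h * φ + v * Complex.I) =
      (starRingEnd ℂ) (Complex.cos (h * φ - v * Complex.I)) := by
    rw [← Complex.cos_conj]; simp
  rw [searchPhase, norm_div, norm_neg, this, RCLike.norm_conj, div_self (norm_ne_zero_iff.2 hc)]

theorem searchPhase_ne_zero (φ : ℝ) {v : ℝ} (hv : 0 < v) (h : ℕ) : searchPhase φ v h ≠ 0 := by
  rw [← norm_ne_zero_iff, norm_searchPhase φ hv]; exact one_ne_zero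

/-- Interleave the overlap wB + x²A with the initial state (even index) and the amplitude xA off the
target (odd index). Each of the two reflections of an iteration is then one step of the same
recurrence. -/
theorem norm_searchCoeff_snd_le (l : ℕ) {v : ℝ} (hv : 0 < v) {w x : ℝ} (hwx : w ^ 2 + x ^ 2 = 1)
    (hx : |x * Real.cosh v| ≤ 1) {β ς : ℕ → ℂ}
    (hβ : ∀ j < l, β j = searchPhase (Real.pi / (2 * l + 1 : ℕ)) v (2 * j + 1))
    (hς : ∀ j < l, ς j = (searchPhase (Real.pi / (2 * l + 1 : ℕ)) v (2 * j + 2))⁻¹) :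
    ‖x * (searchCoeff w x β ς l).2‖ * Real.cosh ((2 * l + 1 : ℕ) * v) ≤ 1 := by
  set ω : ℕ → ℂ := searchPhase (Real.pi / (2 * l + 1 : ℕ)) v with hω
  -- The phases about the initial state enter as inverses of ω. This unimodular factor clears them
  -- without changing norms.
  set Ω : ℕ → ℂ := fun j => ∏ i ∈ Finset.range j, ω (2 * i + 2) with hΩ
  set a : ℕ → ℂ := fun h =>
    if h % 2 = 0 then Ω (h / 2) * (w * (searchCoeff w x β ς (h / 2)).1 +
      x ^ 2 * (searchCoeff w x β ς (h / 2)).2)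
    else Ω (h / 2) * (x * (searchCoeff w x β ς (h / 2)).2) with ha
  have hae : ∀ j, a (2 * j) = Ω j * (w * (searchCoeff w x β ς j).1 +
      x ^ 2 * (searchCoeff w x β ς j).2) := fun j => by simp [ha]
  have hao : ∀ j, a (2 * j + 1) = Ω j * (x * (searchCoeff w x β ς j).2) := fun j => by
    have h1 : (2 * j + 1) % 2 = 1 := by omega
    have h2 : (2 * j + 1) / 2 = j := by omega
    simp only [ha, h1, h2, one_ne_zero, if_false]
  have hΩs : ∀ j, Ω (j + 1) = Ω j * ω (2 * j + 2) := fun j => Finset.prod_range_succ _ _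
  have hwx' : (w : ℂ) ^ 2 + (x : ℂ) ^ 2 = 1 := by exact_mod_cast hwx
  have key := norm_phased_recurrence_le l hv hx a
    (by
      have := hae 0
      rw [mul_zero] at this
      rw [this]
      simp only [hΩ, Finset.range_zero, Finset.prod_empty, searchCoeff]
      linear_combination hwx')
    (by
      have := hao 0
      rw [mul_zero, zero_add] at this
      rw [this]
      simp [hΩ, searchCoeff])
    (by
      intro h hh
      obtain ⟨j, rfl | rfl⟩ := Nat.even_or_odd' h
      · have hb := hβ j (by omega)
        have hs := hς j (by omega)
        have hne := searchPhase_ne_zero (Real.pi / (2 * l + 1 : ℕ)) hv (2 * j + 2)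
        rw [show 2 * j + 2 = 2 * (j + 1) by ring, hae, hao, hae, hΩs]
        simp only [searchCoeff]
        rw [← hω] at hne ⊢
        rw [← hb, hs]
        linear_combination Ω j * (w * β j * (searchCoeff w x β ς j).1 + x ^ 2 * (searchCoeff w x β ς j).2) *
            mul_inv_cancel₀ hne - Ω j * ω (2 * j + 2) * (1 - (ω (2 * j + 2))⁻¹) *
          (w * β j * (searchCoeff w x β ς j).1 + x ^ 2 * (searchCoeff w x β ς j).2) * hwx'
      · have hb := hβ j (by omega)
        have hs := hς j (by omega)
        have hne := searchPhase_ne_zero (Real.pi / (2 * l + 1 : ℕ)) hv (2 * j + 2)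
        rw [show 2 * j + 1 + 2 = 2 * (j + 1) + 1 by ring,
          show 2 * j + 1 + 1 = 2 * (j + 1) by ring, hao, hao, hae, hΩs]
        simp only [searchCoeff]
        rw [← hω] at hne ⊢
        rw [hs, show 2 * (j + 1) = 2 * j + 2 by ring]
        linear_combination x * ω (2 * j + 2) * Ω j *
            (w * β j * (searchCoeff w x β ς j).1 + x ^ 2 * (searchCoeff w x β ς j).2) *
            mul_inv_cancel₀ hne + (1 - ω (2 * j + 2)) * x * Ω j * ω (2 * j + 2) *
          (1 - (ω (2 * j + 2))⁻¹) *
          (w * β j * (searchCoeff w x β ς j).1 + x ^ 2 * (searchCoeff w x β ς j).2) * hwx')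
  rw [hao, norm_mul] at key
  have hΩn : ‖Ω l‖ = 1 := by
    simp only [hΩ, norm_prod]
    exact Finset.prod_eq_one fun i _ => norm_searchPhase _ hv _
  rwa [hΩn, one_mul] at key

theorem exp_two_arctan (u : ℝ) :
    Complex.exp ((2 * Real.arctan u : ℝ) * Complex.I) * (1 - u * Complex.I) = 1 + u * Complex.I := by
  have hs : (√(1 + u ^ 2) : ℝ) ≠ 0 := by positivity
  have hs2 : √(1 + u ^ 2) ^ 2 = 1 + u ^ 2 := Real.sq_sqrt (by positivity)
  have hsc : ((√(1 + u ^ 2) : ℝ) : ℂ) ≠ 0 := by exact_mod_cast hs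
  have hs2c : ((√(1 + u ^ 2) : ℝ) : ℂ) ^ 2 = 1 + (u : ℂ) ^ 2 := by exact_mod_cast hs2
  have h1 : Complex.exp ((Real.arctan u : ℝ) * Complex.I) =
      (1 + u * Complex.I) / ((√(1 + u ^ 2) : ℝ) : ℂ) := by
    rw [Complex.exp_mul_I, ← Complex.ofReal_cos, ← Complex.ofReal_sin, Real.cos_arctan,
      Real.sin_arctan]
    push_cast
    field_simp
  have h2 : Complex.exp ((2 * Real.arctan u : ℝ) * Complex.I) =
      Complex.exp ((Real.arctan u : ℝ) * Complex.I) ^ 2 := by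
    rw [← Complex.exp_nat_mul]; push_cast; congr 1; ring
  rw [h2, h1, div_pow, hs2c]
  have h3 : (1 : ℂ) + (u : ℂ) ^ 2 ≠ 0 := by rw [← hs2c]; exact pow_ne_zero _ hsc
  rw [div_mul_eq_mul_div, div_eq_iff h3]
  linear_combination (-(u : ℂ) ^ 2 * (1 + u * Complex.I)) * Complex.I_sq

theorem sqrt_one_sub_inv_cosh_sq {v : ℝ} (hv : 0 ≤ v) :
    √(1 - ((Real.cosh v)⁻¹) ^ 2) = Real.sinh v / Real.cosh v := by
  have hc := Real.cosh_pos v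
  have : 1 - ((Real.cosh v)⁻¹) ^ 2 = (Real.sinh v / Real.cosh v) ^ 2 := by
    have := Real.cosh_sq v
    field_simp
    linarith
  rw [this, Real.sqrt_sq (div_nonneg (Real.sinh_nonneg_iff.2 hv) hc.le)]

/-- The rate `v` with `1 / γ = cosh v` for the fixed-point search with accuracy `ε'`. -/
noncomputable def fixRate (ε' : ℝ) : ℝ := Real.arcosh (2 / ε') / (2 * fixIterations ε' + 1)

theorem fixRate_pos {ε' : ℝ} (h0 : 0 < ε') (h2 : ε' < 2) : 0 < fixRate ε' := by
  refine div_pos (Real.arcosh_pos ?_) (by positivity)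
  rw [lt_div_iff₀ h0]; linarith

/-- A zero would give 4j = (2l+1)(2n+1), an even number equal to an odd one. So the tangent in the
phases never meets a pole. -/
theorem cos_two_pi_mul_div_ne_zero (j l : ℕ) :
    Real.cos (2 * Real.pi * j / (2 * l + 1)) ≠ 0 := by
  intro h
  obtain ⟨n, hn⟩ := Real.cos_eq_zero_iff.1 h
  have hl : (2 * (l : ℝ) + 1) ≠ 0 := by positivity
  have hpi := Real.pi_pos.ne'
  field_simp at hn
  have h1 : (4 * (j : ℤ)) = (2 * l + 1) * (2 * n + 1) := by
    have h' : (4 * (j : ℝ)) = (2 * l + 1) * (2 * n + 1) := by linarith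
    exact_mod_cast h'
  have h2 := congrArg (· % 2) h1
  simp [Int.mul_emod, Int.add_emod] at h2

/-- With 1/γ = cosh v one has √(1-γ²) = tanh v. Moreover cos(ψ ∓ iv) = cos ψ cosh v (1 ± iu) with u
= tan ψ tanh v, so the quotient of the two cosines is an exponential of 2 arctan u. -/
theorem exp_neg_fixPhase {ε' : ℝ} (h0 : 0 < ε') (h2 : ε' < 2) (j : ℕ) :
    Complex.exp ((-fixPhase ε' j : ℝ) * Complex.I) =
      (searchPhase (Real.pi / (2 * fixIterations ε' + 1 : ℕ)) (fixRate ε') (2 * j))⁻¹ := by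
  have hv := fixRate_pos h0 h2
  set l := fixIterations ε' with hl
  set v := fixRate ε' with hvdef
  set ψ : ℝ := 2 * Real.pi * j / (2 * l + 1) with hψ
  have hcos : Real.cos ψ ≠ 0 := cos_two_pi_mul_div_ne_zero j l
  have hcosh := (Real.cosh_pos v).ne'
  set u : ℝ := Real.tan ψ * (Real.sinh v / Real.cosh v) with hu
  have hfix : fixPhase ε' j = Real.pi - 2 * Real.arctan u := by
    rw [fixPhase, hu, ← sqrt_one_sub_inv_cosh_sq hv.le, hvdef, fixRate, hψ, hl]
  have h1 : Complex.exp ((-fixPhase ε' j : ℝ) * Complex.I) =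
      -Complex.exp ((2 * Real.arctan u : ℝ) * Complex.I) := by
    rw [hfix, show ((-(Real.pi - 2 * Real.arctan u) : ℝ) : ℂ) * Complex.I =
      (2 * Real.arctan u : ℝ) * Complex.I - Real.pi * Complex.I by push_cast; ring,
      Complex.exp_sub, Complex.exp_pi_mul_I]
    ring
  have hang : ((2 * j : ℕ) : ℂ) * ((Real.pi / (2 * l + 1 : ℕ) : ℝ) : ℂ) = (ψ : ℂ) := by
    rw [hψ]; push_cast; ring
  have hm : Complex.cos (ψ - v * Complex.I) = (Real.cos ψ * Real.cosh v : ℝ) * (1 + u * Complex.I) := by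
    rw [Complex.cos_sub, Complex.cos_mul_I, Complex.sin_mul_I, ← Complex.ofReal_cos,
      ← Complex.ofReal_sin, ← Complex.ofReal_cosh, ← Complex.ofReal_sinh]
    have : Real.cos ψ * Real.cosh v * u = Real.sin ψ * Real.sinh v := by
      rw [hu, Real.tan_eq_sin_div_cos]; field_simp
    have hc : (Real.cos ψ : ℂ) * Real.cosh v * u = Real.sin ψ * Real.sinh v := by exact_mod_cast this
    push_cast at hc ⊢
    linear_combination (-Complex.I) * hc
  have hp : Complex.cos (ψ + v * Complex.I) = (Real.cos ψ * Real.cosh v : ℝ) * (1 - u * Complex.I) := by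
    rw [Complex.cos_add, Complex.cos_mul_I, Complex.sin_mul_I, ← Complex.ofReal_cos,
      ← Complex.ofReal_sin, ← Complex.ofReal_cosh, ← Complex.ofReal_sinh]
    have : Real.cos ψ * Real.cosh v * u = Real.sin ψ * Real.sinh v := by
      rw [hu, Real.tan_eq_sin_div_cos]; field_simp
    have hc : (Real.cos ψ : ℂ) * Real.cosh v * u = Real.sin ψ * Real.sinh v := by exact_mod_cast this
    push_cast at hc ⊢
    linear_combination Complex.I * hc
  have hne : (1 - u * Complex.I) ≠ 0 := by
    intro h
    have := congrArg Complex.re h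
    simp at this
  have hcc : ((Real.cos ψ * Real.cosh v : ℝ) : ℂ) ≠ 0 := by
    exact_mod_cast mul_ne_zero hcos hcosh
  rw [h1, searchPhase, hang, hm, hp, ← exp_two_arctan u, inv_div]
  have he := Complex.exp_ne_zero ((2 * Real.arctan u : ℝ) * Complex.I)
  rw [eq_div_iff (neg_ne_zero.2 (mul_ne_zero hcc hne))]
  ring

/-- The angles 2(l-j)φ and (2j+1)φ add up to π. This is why the choice β_j = -α_{l+1-j} supplies the
phase factors of odd index. -/
theorem inv_searchPhase_reflect {l : ℕ} (v : ℝ) {j : ℕ} (hj : j < l) :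
    (searchPhase (Real.pi / (2 * l + 1 : ℕ)) v (2 * (l - j)))⁻¹ =
      searchPhase (Real.pi / (2 * l + 1 : ℕ)) v (2 * j + 1) := by
  have hL : ((2 * l + 1 : ℕ) : ℂ) ≠ 0 := by exact_mod_cast (by omega : 2 * l + 1 ≠ 0)
  have h : ((2 * (l - j) : ℕ) : ℂ) * ((Real.pi / (2 * l + 1 : ℕ) : ℝ) : ℂ) =
      Real.pi - ((2 * j + 1 : ℕ) : ℂ) * ((Real.pi / (2 * l + 1 : ℕ) : ℝ) : ℂ) := by
    rw [Nat.cast_mul, Nat.cast_sub hj.le]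
    push_cast at hL ⊢
    field_simp
    ring
  rw [searchPhase, searchPhase, h, inv_div]
  rw [show (Real.pi : ℂ) - ((2 * j + 1 : ℕ) : ℂ) * ((Real.pi / (2 * l + 1 : ℕ) : ℝ) : ℂ) -
      v * Complex.I = Real.pi - (((2 * j + 1 : ℕ) : ℂ) * ((Real.pi / (2 * l + 1 : ℕ) : ℝ) : ℂ) +
      v * Complex.I) by ring,
    show (Real.pi : ℂ) - ((2 * j + 1 : ℕ) : ℂ) * ((Real.pi / (2 * l + 1 : ℕ) : ℝ) : ℂ) +
      v * Complex.I = Real.pi - (((2 * j + 1 : ℕ) : ℂ) * ((Real.pi / (2 * l + 1 : ℕ) : ℝ) : ℂ) -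
      v * Complex.I) by ring, Complex.cos_pi_sub, Complex.cos_pi_sub]
  rw [neg_neg]

theorem arcosh_le_log {y : ℝ} (hy : 1 ≤ y) : Real.arcosh y ≤ Real.log (2 * y) := by
  rw [Real.arcosh]
  refine Real.log_le_log (by positivity) ?_
  have : √(y ^ 2 - 1) ≤ y := Real.sqrt_le_iff.2 ⟨by linarith, by linarith⟩
  linarith

/-- The state of the fixed-point search is within `ε' / 2` of the target subspace. -/
theorem norm_fixSearchCoeff_le {ε' : ℝ} (h0 : 0 < ε') (h2 : ε' < 2) {w x : ℝ}
    (hwx : w ^ 2 + x ^ 2 = 1) (hx : x ^ 2 ≤ 1 / 2) :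
    ‖x * (searchCoeff w x
      (fun j => Complex.exp ((-fixPhase ε' (fixIterations ε' - j) : ℝ) * Complex.I))
      (fun j => Complex.exp ((-fixPhase ε' (j + 1) : ℝ) * Complex.I)) (fixIterations ε')).2‖ ≤
        ε' / 2 := by
  have hv := fixRate_pos h0 h2
  have h1 : 1 < 2 / ε' := by rw [lt_div_iff₀ h0]; linarith
  have hcosh : Real.cosh ((2 * fixIterations ε' + 1 : ℕ) * fixRate ε') = 2 / ε' := by
    rw [fixRate, ← Real.cosh_arcosh h1.le]
    congr 1
    push_cast
    rw [Real.cosh_arcosh h1.le]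
    field_simp
  -- The iteration count is at least log(4/ε') ≥ arcosh(2/ε').
  have hvle : fixRate ε' ≤ 1 / 2 := by
    have ha := arcosh_le_log h1.le
    have hl : Real.log (4 / ε') ≤ fixIterations ε' := Nat.le_ceil _
    rw [show 2 * (2 / ε') = 4 / ε' by ring] at ha
    rw [fixRate, div_le_iff₀ (by positivity)]
    linarith
  have hch : Real.cosh (fixRate ε') ^ 2 ≤ 2 := by
    have h3 : Real.cosh (fixRate ε') ≤ Real.exp (1 / 8) := by
      refine (Real.cosh_le_exp_half_sq _).trans (Real.exp_le_exp.2 ?_)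
      nlinarith
    have h4 : Real.exp (1 / 8) ^ 2 ≤ 2 := by
      rw [← Real.exp_nat_mul, ← Real.exp_log (show (0 : ℝ) < 2 by norm_num)]
      refine Real.exp_le_exp.2 ?_
      have := Real.log_two_gt_d9
      norm_num at this ⊢
      linarith
    exact (pow_le_pow_left₀ (Real.cosh_pos _).le h3 2).trans h4
  -- x² ≤ 1/2 and cosh² v ≤ 2 keep the argument of the Chebyshev polynomial in [-1,1].
  have hxc : |x * Real.cosh (fixRate ε')| ≤ 1 := by
    rw [← sq_le_one_iff_abs_le_one, mul_pow]
    nlinarith [sq_nonneg x, sq_nonneg (Real.cosh (fixRate ε'))]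
  have key := norm_searchCoeff_snd_le (fixIterations ε') hv hwx hxc
    (β := fun j => Complex.exp ((-fixPhase ε' (fixIterations ε' - j) : ℝ) * Complex.I))
    (ς := fun j => Complex.exp ((-fixPhase ε' (j + 1) : ℝ) * Complex.I))
    (fun j hj => by rw [exp_neg_fixPhase h0 h2, inv_searchPhase_reflect _ hj])
    (fun j hj => by rw [exp_neg_fixPhase h0 h2, mul_add, mul_one])
  rw [hcosh, mul_div_assoc', div_le_one h0] at key
  linarith

end SearchCoefficients

/-! ### Frequency localization of the discrete Fourier transform -/

section Signal

/-- The inverse discrete Fourier transform of a signal. -/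
noncomputable def invFourier {k : ℕ} (g : Fin (k + 1) → ℂ) (y : Fin (k + 1)) : ℂ :=
  ∑ j, (star (fourierMatrix k)) y j * g j

theorem invFourier_sub {k : ℕ} (f g : Fin (k + 1) → ℂ) (y : Fin (k + 1)) :
    invFourier (fun j => f j - g j) y = invFourier f y - invFourier g y := by
  simp only [invFourier, mul_sub, Finset.sum_sub_distrib]

theorem invFourier_const_mul {k : ℕ} (c : ℂ) (g : Fin (k + 1) → ℂ) (y : Fin (k + 1)) :
    invFourier (fun j => c * g j) y = c * invFourier g y := by
  simp only [invFourier, Finset.mul_sum]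
  exact Finset.sum_congr rfl fun j _ => by ring

theorem sum_norm_sq_invFourier {k : ℕ} (g : Fin (k + 1) → ℂ) :
    ∑ y, ‖invFourier g y‖ ^ 2 = ∑ j, ‖g j‖ ^ 2 :=
  sum_norm_sq_unitary (star (⟨fourierMatrix k, fourierMatrix_mem k⟩ :
    Matrix.unitaryGroup (Fin (k + 1)) ℂ)) g

theorem star_fourierMatrix_apply (k : ℕ) (y j : Fin (k + 1)) :
    star (fourierMatrix k) y j =
      Complex.exp (-(2 * Real.pi * Complex.I * (y : ℕ) * (j : ℕ) / (k + 1 : ℕ))) /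
        ((√((k + 1 : ℕ) : ℝ) : ℝ) : ℂ) := by
  rw [Matrix.star_apply, fourierMatrix, RCLike.star_def, map_div₀, Complex.conj_ofReal,
    ← Complex.exp_conj]
  congr 2
  simp only [map_div₀, map_mul, Complex.conj_ofReal, Complex.conj_I, map_natCast, map_ofNat]
  ring

/-- Addition in `Fin (k + 1)` wraps around, so this is the cyclic shift, which the transform
diagonalizes. -/
theorem invFourier_shift {k : ℕ} (g : Fin (k + 1) → ℂ) (y : Fin (k + 1)) :
    invFourier (fun j => g (j + 1)) y =
      Complex.exp (2 * Real.pi * Complex.I * (y : ℕ) / (k + 1 : ℕ)) * invFourier g y := by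
  have hM : ((k + 1 : ℕ) : ℂ) ≠ 0 := by exact_mod_cast Nat.succ_ne_zero k
  have hterm : ∀ j : Fin (k + 1), star (fourierMatrix k) y j =
      Complex.exp (2 * Real.pi * Complex.I * (y : ℕ) / (k + 1 : ℕ)) *
        star (fourierMatrix k) y (j + 1) := by
    intro j
    rw [star_fourierMatrix_apply, star_fourierMatrix_apply, mul_div_assoc', ← Complex.exp_add]
    congr 1
    rw [Complex.exp_eq_exp_iff_exists_int]
    rcases eq_or_ne j (Fin.last k) with rfl | hj
    · refine ⟨-(y : ℕ), ?_⟩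
      rw [Fin.last_add_one]
      simp only [Fin.val_last, Fin.val_zero]
      push_cast at hM ⊢
      field_simp
      ring
    · refine ⟨0, ?_⟩
      have : ((j + 1 : Fin (k + 1)) : ℕ) = j + 1 :=
        Fin.val_add_one_of_lt (lt_of_le_of_ne (Fin.le_last j) hj)
      rw [this]
      push_cast at hM ⊢
      field_simp
      ring
  rw [invFourier, invFourier, Finset.mul_sum,
    ← Equiv.sum_comp (Equiv.addRight (1 : Fin (k + 1))) fun j =>
      Complex.exp (2 * Real.pi * Complex.I * (y : ℕ) / (k + 1 : ℕ)) *
        (star (fourierMatrix k) y j * g j)]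
  refine Finset.sum_congr rfl fun j _ => ?_
  rw [Equiv.coe_addRight, hterm j, mul_assoc]

/-- A trapezoid window on `{0, …, M}` with ramps of length `n`. -/
noncomputable def trapezoid (M n : ℕ) (j : ℕ) : ℝ := min 1 (min (j : ℝ) (M - j) / n)

theorem abs_trapezoid_succ_sub_le (M n j : ℕ) (hn : 0 < n) :
    |trapezoid M n (j + 1) - trapezoid M n j| ≤ 1 / n := by
  have hn' : (0 : ℝ) < n := by exact_mod_cast hn
  refine (abs_min_sub_min_le_max _ _ _ _).trans (max_le (by simp) ?_)
  rw [← sub_div, abs_div, abs_of_pos hn']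
  refine div_le_div_of_nonneg_right ?_ hn'.le
  refine (abs_min_sub_min_le_max _ _ _ _).trans (max_le ?_ ?_)
  · push_cast; simp
  · push_cast; rw [show (M : ℝ) - (j + 1) - (M - j) = -1 by ring]; simp

theorem trapezoid_zero (M n : ℕ) : trapezoid M n 0 = 0 := by simp [trapezoid]

theorem trapezoid_self (M n : ℕ) : trapezoid M n M = 0 := by simp [trapezoid]

theorem trapezoid_nonneg {M n j : ℕ} (hj : j ≤ M) : 0 ≤ trapezoid M n j := by
  have : (j : ℝ) ≤ M := by exact_mod_cast hj
  exact le_min zero_le_one (div_nonneg (le_min (Nat.cast_nonneg j) (by linarith))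
    (Nat.cast_nonneg n))

theorem trapezoid_le_one (M n j : ℕ) : trapezoid M n j ≤ 1 := min_le_left _ _

theorem trapezoid_eq_one {M n j : ℕ} (hn : 0 < n) (h1 : n ≤ j) (h2 : j + n ≤ M) :
    trapezoid M n j = 1 := by
  have hn' : (0 : ℝ) < n := by exact_mod_cast hn
  have h1' : (n : ℝ) ≤ j := by exact_mod_cast h1
  have h2' : (j : ℝ) + n ≤ M := by exact_mod_cast h2
  exact min_eq_left ((one_le_div hn').2 (le_min h1' (by linarith)))

/-- The window differs from 1 only at fewer than n positions from either end, with at most 1 lost at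
each. -/
theorem sum_one_sub_trapezoid_sq_le (k n : ℕ) (hn : 0 < n) :
    ∑ j : Fin (k + 1), (1 - trapezoid (k + 1) n j) ^ 2 ≤ (2 * n : ℝ) := by
  have hle : ∀ j : Fin (k + 1), (1 - trapezoid (k + 1) n j) ^ 2 ≤
      (if (j : ℕ) < n then (1 : ℝ) else 0) + (if (Fin.rev j : ℕ) < n then (1 : ℝ) else 0) := by
    intro j
    have h0 := trapezoid_nonneg (M := k + 1) (n := n) (j := j) j.2.le
    have h1 := trapezoid_le_one (k + 1) n j
    have h2 : (1 - trapezoid (k + 1) n j) ^ 2 ≤ 1 := by nlinarith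
    rw [Fin.val_rev]
    by_cases ha : (j : ℕ) < n
    · rw [if_pos ha]
      split_ifs <;> linarith
    · by_cases hb : k + 1 - ((j : ℕ) + 1) < n
      · rw [if_pos hb, if_neg ha]; linarith
      · rw [trapezoid_eq_one hn (by omega) (by omega), if_neg ha, if_neg hb]; norm_num
  have hcount : ∑ j : Fin (k + 1), (if (j : ℕ) < n then (1 : ℝ) else 0) ≤ n := by
    rw [Fin.sum_univ_eq_sum_range (fun j => if j < n then (1 : ℝ) else 0), Finset.sum_boole]
    have : (Finset.range (k + 1)).filter (· < n) ⊆ Finset.range n := fun j hj => by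
      simpa using (Finset.mem_filter.1 hj).2
    exact_mod_cast (Finset.card_le_card this).trans (Finset.card_range n).le
  refine (Finset.sum_le_sum fun j _ => hle j).trans ?_
  have hrev := Equiv.sum_comp Fin.revPerm fun j : Fin (k + 1) =>
    if (j : ℕ) < n then (1 : ℝ) else 0
  simp only [Fin.revPerm_apply] at hrev
  rw [Finset.sum_add_distrib, hrev]
  linarith

theorem norm_exp_sub_exp (α β : ℝ) :
    ‖Complex.exp (α * Complex.I) - Complex.exp (β * Complex.I)‖ = 2 * |Real.sin ((α - β) / 2)| := by
  have h : Complex.exp (α * Complex.I) - Complex.exp (β * Complex.I) =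
      Complex.exp (β * Complex.I) * (Complex.exp (Complex.I * (α - β : ℝ)) - 1) := by
    rw [mul_sub, ← Complex.exp_add]; push_cast; ring_nf
  rw [h, norm_mul, Complex.norm_exp_ofReal_mul_I, one_mul, Complex.norm_exp_I_mul_ofReal_sub_one,
    norm_mul, Real.norm_eq_abs, Real.norm_eq_abs, abs_two]

/-- A signal whose instantaneous frequency is close to `θ` has little energy at the
frequencies far away from `θ`. -/
theorem sum_norm_sq_invFourier_le {k : ℕ} (f : Fin (k + 1) → ℂ) (hf1 : ∀ j, ‖f j‖ = 1)
    {θ κ K : ℝ} (hκ : 0 ≤ κ) (hK : 0 < K) {n : ℕ} (hn : 0 < n)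
    (hf : ∀ j : Fin k, ‖f j.succ - Complex.exp ((2 * θ : ℝ) * Complex.I) * f j.castSucc‖ ≤ κ)
    (R : Finset (Fin (k + 1)))
    (hR : ∀ y ∈ R, K ≤ 2 * |Real.sin (Real.pi * (y : ℕ) / (k + 1 : ℕ) - θ)|) :
    ∑ y ∈ R, ‖invFourier f y‖ ^ 2 ≤
      11 / 10 * ((k + 1 : ℕ) * ((κ + 1 / n) / K) ^ 2) + 22 * n := by
  set W : ℕ → ℝ := trapezoid (k + 1) n with hW
  set e : ℂ := Complex.exp ((2 * θ : ℝ) * Complex.I) with he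
  have hen : ‖e‖ = 1 := Complex.norm_exp_ofReal_mul_I _
  set g : Fin (k + 1) → ℂ := fun j => (W j : ℂ) * f j with hg
  have hn' : (0 : ℝ) < n := by exact_mod_cast hn
  have hWabs : ∀ j : Fin (k + 1), ‖(W j : ℂ)‖ ≤ 1 := fun j => by
    rw [Complex.norm_real, Real.norm_of_nonneg (trapezoid_nonneg j.2.le)]
    exact trapezoid_le_one _ _ _
  have hdiff : ∀ j, ‖g (j + 1) - e * g j‖ ≤ κ + 1 / n := by
    intro j
    have hstep := abs_trapezoid_succ_sub_le (k + 1) n j hn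
    -- At the cyclic step from k to 0 nothing is known about f. There the window vanishes at 0 and
    -- at k+1, so its own slope bounds the difference.
    refine Fin.lastCases (motive := fun j => |trapezoid (k + 1) n (j + 1) -
      trapezoid (k + 1) n j| ≤ 1 / n → ‖g (j + 1) - e * g j‖ ≤ κ + 1 / n) ?_ ?_ j hstep
    · intro hstep
      rw [Fin.last_add_one]
      simp only [hg, Fin.val_zero, Fin.val_last] at hstep ⊢
      rw [trapezoid_self, zero_sub, abs_neg] at hstep
      rw [hW, trapezoid_zero, Complex.ofReal_zero, zero_mul, zero_sub, norm_neg, norm_mul, norm_mul,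
        hf1, hen, one_mul, mul_one, Complex.norm_real, Real.norm_eq_abs]
      linarith
    · intro i hstep
      rw [Fin.coeSucc_eq_succ]
      have hd : g i.succ - e * g i.castSucc =
          (W (i + 1) : ℂ) * (f i.succ - e * f i.castSucc) +
            ((W (i + 1) - W i : ℝ) : ℂ) * (e * f i.castSucc) := by
        simp only [hg, Fin.val_succ, Fin.val_castSucc]; push_cast; ring
      rw [hd]
      refine (norm_add_le _ _).trans (add_le_add ?_ ?_)
      · rw [norm_mul]
        have h1 := hWabs i.succ
        rw [Fin.val_succ] at h1
        exact (mul_le_of_le_one_left (norm_nonneg _) h1).trans (hf i)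
      · rw [norm_mul, norm_mul, hen, hf1, one_mul, mul_one, Complex.norm_real, Real.norm_eq_abs]
        exact hstep
  -- Shifting and subtracting e·g multiplies the transform at y by a factor of modulus at least K on
  -- R. Parseval's identity bounds the energy of the difference.
  have hdomain : ∑ y ∈ R, ‖invFourier g y‖ ^ 2 ≤ (k + 1 : ℕ) * ((κ + 1 / n) / K) ^ 2 := by
    have h1 : ∑ y, ‖invFourier (fun j => g (j + 1) - e * g j) y‖ ^ 2 ≤
        (k + 1 : ℕ) * (κ + 1 / n) ^ 2 := by
      rw [sum_norm_sq_invFourier]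
      refine (Finset.sum_le_sum fun j _ => pow_le_pow_left₀ (norm_nonneg _) (hdiff j) 2).trans ?_
      simp
    have h2 : ∑ y ∈ R, K ^ 2 * ‖invFourier g y‖ ^ 2 ≤
        ∑ y, ‖invFourier (fun j => g (j + 1) - e * g j) y‖ ^ 2 := by
      refine (Finset.sum_le_sum fun y hy => ?_).trans
        (Finset.sum_le_univ_sum_of_nonneg fun y => sq_nonneg _)
      rw [invFourier_sub, invFourier_const_mul, invFourier_shift, ← sub_mul, norm_mul, mul_pow]
      refine mul_le_mul_of_nonneg_right (pow_le_pow_left₀ hK.le ?_ 2) (sq_nonneg _)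
      refine (hR y hy).trans (le_of_eq ?_)
      rw [he, show (2 * Real.pi * Complex.I * (y : ℕ) / (k + 1 : ℕ) : ℂ) =
        (2 * (Real.pi * (y : ℕ) / (k + 1 : ℕ)) : ℝ) * Complex.I by push_cast; ring,
        norm_exp_sub_exp]
      congr 3; ring
    rw [← Finset.mul_sum] at h2
    rw [div_pow, mul_div_assoc', le_div_iff₀ (by positivity)]
    linarith
  have hrest : ∑ y ∈ R, ‖invFourier (fun j => f j - g j) y‖ ^ 2 ≤ 2 * n := by
    refine (Finset.sum_le_univ_sum_of_nonneg fun y => sq_nonneg _).trans ?_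
    rw [sum_norm_sq_invFourier]
    refine le_trans (le_of_eq ?_) (sum_one_sub_trapezoid_sq_le k n hn)
    refine Finset.sum_congr rfl fun j _ => ?_
    simp only [hg]
    rw [show f j - (W j : ℂ) * f j = ((1 - W j : ℝ) : ℂ) * f j by push_cast; ring, norm_mul, hf1,
      mul_one, Complex.norm_real, Real.norm_eq_abs, sq_abs]
  -- The unequal weights in (a+b)² ≤ 1.1a² + 11b² keep the constant of the main term close to 1; the
  -- remainder is small.
  have hsplit : ∀ y, ‖invFourier f y‖ ^ 2 ≤
      11 / 10 * ‖invFourier g y‖ ^ 2 + 11 * ‖invFourier (fun j => f j - g j) y‖ ^ 2 := by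
    intro y
    have h1 : ‖invFourier f y‖ ≤ ‖invFourier g y‖ + ‖invFourier (fun j => f j - g j) y‖ := by
      rw [invFourier_sub]
      exact norm_le_norm_add_norm_sub' _ _
    have h2 := pow_le_pow_left₀ (norm_nonneg _) h1 2
    nlinarith [sq_nonneg (‖invFourier g y‖ - 10 * ‖invFourier (fun j => f j - g j) y‖)]
  refine (Finset.sum_le_sum fun y _ => hsplit y).trans ?_
  rw [Finset.sum_add_distrib, ← Finset.mul_sum, ← Finset.mul_sum]
  linarith

end Signal

/-! ### Basis states, circuits and phase gates -/

section Circuits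

variable {A 𝓗 : Type*} [NormedAddCommGroup 𝓗]

/-- The state `|a⟩ ξ`. -/
def ket [DecidableEq A] (a : A) (ξ : 𝓗) : JointSpace A 𝓗 := WithLp.toLp 2 (Pi.single a ξ)

theorem ket_apply [DecidableEq A] (a : A) (ξ : 𝓗) (b : A) :
    ket a ξ b = if b = a then ξ else 0 := by
  simp [ket]

variable [Fintype A] [InnerProductSpace ℂ 𝓗] {T : ℕ}

theorem inner_ket_left [DecidableEq A] (a : A) (ξ : 𝓗) (v : JointSpace A 𝓗) :
    inner ℂ (ket a ξ) v = inner ℂ ξ (v a) := by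
  rw [PiLp.inner_apply, Finset.sum_eq_single a]
  · rw [ket_apply, if_pos rfl]
  · intro b _ hb
    rw [ket_apply, if_neg hb, inner_zero_left]
  · simp

theorem inner_ket_ket [DecidableEq A] {z : 𝓗} (hz : ‖z‖ = 1) (a b : A) :
    inner ℂ (ket a z) (ket b z) = if a = b then (1 : ℂ) else 0 := by
  rw [inner_ket_left, ket_apply]
  split_ifs
  · rw [inner_self_eq_norm_sq_to_K, hz]; simp
  · exact inner_zero_right _

theorem Circuit.toUnitary_append (O : Fin T → (𝓗 ≃ₗᵢ[ℂ] 𝓗)) (C D : Circuit A 𝓗 T)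
    (v : JointSpace A 𝓗) :
    Circuit.toUnitary O (C ++ D) v = Circuit.toUnitary O D (Circuit.toUnitary O C v) := by
  induction C generalizing v with
  | nil => rfl
  | cons g C ih => exact ih _

theorem Circuit.toUnitary_singleton (O : Fin T → (𝓗 ≃ₗᵢ[ℂ] 𝓗)) (g : Gate A 𝓗 T)
    (v : JointSpace A 𝓗) : Circuit.toUnitary O [g] v = g.toUnitary O v := rfl

theorem blockGate_apply (u : A → (𝓗 ≃ₗᵢ[ℂ] 𝓗)) (v : JointSpace A 𝓗) (a : A) :
    blockGate u v a = u a (v a) := rfl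

theorem Gate.toUnitary_adjoint (O : Fin T → (𝓗 ≃ₗᵢ[ℂ] 𝓗)) (g : Gate A 𝓗 T) :
    g.adjoint.toUnitary O = (g.toUnitary O).symm := by
  cases g with
  | free W => rfl
  | experiment i inv c =>
    refine LinearIsometryEquiv.ext fun v => ?_
    rw [LinearIsometryEquiv.eq_symm_apply]
    refine PiLp.ext fun a => ?_
    simp only [Gate.adjoint, Gate.toUnitary, blockGate_apply]
    cases c a <;> cases inv <;> simp

theorem Circuit.toUnitary_adjoint (O : Fin T → (𝓗 ≃ₗᵢ[ℂ] 𝓗)) (C : Circuit A 𝓗 T) :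
    Circuit.toUnitary O C.adjoint = (Circuit.toUnitary O C).symm := by
  refine LinearIsometryEquiv.ext fun v => ?_
  rw [LinearIsometryEquiv.eq_symm_apply]
  induction C generalizing v with
  | nil => rfl
  | cons g C ih =>
    have h1 : Circuit.adjoint (g :: C) = Circuit.adjoint C ++ [g.adjoint] := by
      simp [Circuit.adjoint]
    rw [h1, Circuit.toUnitary_append, Circuit.toUnitary_singleton, Gate.toUnitary_adjoint]
    change Circuit.toUnitary O C (g.toUnitary O _) = v
    rw [LinearIsometryEquiv.apply_symm_apply, ih]

end Circuits

/-! ### Gates of the algorithm on basis states, and the overlaps of V_i -/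

section Gates

variable {𝒦 : Type*} [NormedAddCommGroup 𝒦] [InnerProductSpace ℂ 𝒦] {E : Finset ℝ}
  {T k : ℕ}

theorem phaseGate_toUnitary_apply {z : Register 𝒦 E} (hz : ‖z‖ = 1) (c : Ancilla k → Bool) (α : ℝ)
    (O : Fin T → (Register 𝒦 E ≃ₗᵢ[ℂ] Register 𝒦 E))
    (v : JointSpace (Ancilla k) (Register 𝒦 E)) :
    (phaseGate (T := T) z hz c α).toUnitary O v =
      v - (1 - Complex.exp (α * Complex.I)) •
        ∑ a, if c a then inner ℂ (ket a z) v • ket a z else 0 := by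
  refine PiLp.ext fun a => ?_
  rw [PiLp.sub_apply, PiLp.smul_apply, WithLp.ofLp_sum, Finset.sum_apply, Finset.sum_eq_single a]
  · simp only [phaseGate, Gate.toUnitary, blockGate_apply]
    by_cases h : c a = true
    · rw [if_pos h, if_pos h, phaseAbout_apply, PiLp.smul_apply, ket_apply, if_pos rfl,
        inner_ket_left, smul_smul]
    · rw [if_neg h, if_neg h]; simp
  · intro b _ hb
    split_ifs
    · rw [PiLp.smul_apply, ket_apply, if_neg hb.symm, smul_zero]
    · simp
  · simp

/-- Conjugating a phase gate by a circuit. -/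
theorem toUnitary_conj_phaseGate {z : Register 𝒦 E} (hz : ‖z‖ = 1) (c : Ancilla k → Bool) (α : ℝ)
    (O : Fin T → (Register 𝒦 E ≃ₗᵢ[ℂ] Register 𝒦 E))
    (C : Circuit (Ancilla k) (Register 𝒦 E) T)
    (v : JointSpace (Ancilla k) (Register 𝒦 E)) :
    Circuit.toUnitary O (C.adjoint ++ [phaseGate z hz c α] ++ C) v =
      v - (1 - Complex.exp (α * Complex.I)) •
        ∑ a, if c a then inner ℂ (C.toUnitary O (ket a z)) v • C.toUnitary O (ket a z) else 0 := by
  rw [Circuit.toUnitary_append, Circuit.toUnitary_append, Circuit.toUnitary_singleton,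
    phaseGate_toUnitary_apply, Circuit.toUnitary_adjoint, map_sub, map_smul, map_sum,
    LinearIsometryEquiv.apply_symm_apply]
  congr 2
  refine Finset.sum_congr rfl fun a _ => ?_
  split_ifs
  · rw [map_smul]
    congr 1
    rw [← LinearIsometryEquiv.inner_map_map (C.toUnitary O), LinearIsometryEquiv.apply_symm_apply]
  · exact map_zero _

theorem signGate_toUnitary_apply (c : Ancilla k → Bool)
    (O : Fin T → (Register 𝒦 E ≃ₗᵢ[ℂ] Register 𝒦 E))
    (v : JointSpace (Ancilla k) (Register 𝒦 E)) (a : Ancilla k) :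
    (signGate (T := T) c).toUnitary O v a = if c a then -v a else v a := by
  simp only [signGate, Gate.toUnitary, blockGate_apply]
  split_ifs <;> rfl

theorem signGate_toUnitary_ket (c : Ancilla k → Bool)
    (O : Fin T → (Register 𝒦 E ≃ₗᵢ[ℂ] Register 𝒦 E)) (a : Ancilla k) (z : Register 𝒦 E) :
    (signGate (T := T) c).toUnitary O (ket a z) = if c a then -ket a z else ket a z := by
  refine PiLp.ext fun b => ?_
  rw [signGate_toUnitary_apply]
  by_cases hb : b = a
  · subst hb; split_ifs <;> simp
  · rw [ket_apply, if_neg hb]; split_ifs <;> simp [ket_apply, hb]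

theorem circuitU_toUnitary_ket_apply (L H : ℝ) (i : Fin T)
    (O : Fin T → (Register 𝒦 E ≃ₗᵢ[ℂ] Register 𝒦 E)) (z : Register 𝒦 E) (c c' : Fin (k + 1))
    (b b₁ b₂ : Bool) (x : E) :
    (circuitU (k := k) L H i).toUnitary O (ket (c, false, b) z) (c', b₁, b₂) x =
      (if c' = c ∧ b₂ = b then rotationMatrix ((x - L) / (H - L)) b₁ false else 0) • O i z x := by
  have h1 : (circuitU (k := k) L H i).toUnitary O (ket (c, false, b) z) =
      controlledRotation L H (ket (c, false, b) (O i z)) := by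
    change controlledRotation L H (blockGate _ _) = _
    congr 1
    refine PiLp.ext fun a => ?_
    rw [blockGate_apply, ket_apply, ket_apply]
    by_cases h : a = (c, false, b)
    · rw [if_pos h, if_pos h]; rfl
    · rw [if_neg h, if_neg h]; exact map_zero _
  rw [h1, controlledRotation, valueControlled_apply, Finset.sum_eq_single (c, false, b)]
  · rw [ket_apply, if_pos rfl]
    congr 1
    change (1 : Matrix (Fin (k + 1)) (Fin (k + 1)) ℂ) c' c *
      (rotationMatrix ((x - L) / (H - L)) b₁ false * (1 : Matrix Bool Bool ℂ) b₂ b) = _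
    rw [Matrix.one_apply, Matrix.one_apply]
    by_cases h2 : c' = c <;> by_cases h3 : b₂ = b <;> simp [h2, h3]
  · intro a _ ha
    rw [ket_apply, if_neg ha]; simp
  · simp

theorem cnot_apply (v : JointSpace (Ancilla k) (Register 𝒦 E)) (c : Fin (k + 1)) (b₁ b₂ : Bool) :
    cnot v (c, b₁, b₂) = v (c, b₁, xor b₁ b₂) := rfl

/-- The probability with which the controlled rotation sets the first qubit. -/
noncomputable def rotationWeight (L H : ℝ) (ξ : Register 𝒦 E) : ℝ :=
  ∑ x : E, ‖ξ x‖ ^ 2 * clampUnit ((x - L) / (H - L))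

/-- Moving the final inverse of U_i to the other side leaves the CNOT between two copies of U_i|𝟎⟩.
It copies the first qubit to the second, so b selects one value of the first qubit and the overlap
is its probability, a squared norm free of garbage. -/
theorem inner_ket_circuitV (L H : ℝ) (i : Fin T)
    (O : Fin T → (Register 𝒦 E ≃ₗᵢ[ℂ] Register 𝒦 E)) {z : Register 𝒦 E} (hz : ‖z‖ = 1)
    (c c' : Fin (k + 1)) (b : Bool) :
    inner ℂ (ket (c', false, b) z)
      ((circuitV (k := k) L H i).toUnitary O (ket (c, false, false) z)) =
    if c' = c then (if b then (rotationWeight L H (O i z) : ℂ)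
      else 1 - (rotationWeight L H (O i z) : ℂ)) else 0 := by
  have h1 : inner ℂ (ket (c', false, b) z)
      ((circuitV (k := k) L H i).toUnitary O (ket (c, false, false) z)) =
    inner ℂ ((circuitU (k := k) L H i).toUnitary O (ket (c', false, b) z))
      (cnot ((circuitU (k := k) L H i).toUnitary O (ket (c, false, false) z))) := by
    rw [circuitV, Circuit.toUnitary_append, Circuit.toUnitary_append, Circuit.toUnitary_singleton,
      Circuit.toUnitary_adjoint,
      ← LinearIsometryEquiv.inner_map_map ((circuitU (k := k) L H i).toUnitary O),
      LinearIsometryEquiv.apply_symm_apply]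
    rfl
  have hsq : ∑ x : E, ‖O i z x‖ ^ 2 = 1 := by
    rw [← PiLp.norm_sq_eq_of_L2, LinearIsometryEquiv.norm_map, hz, one_pow]
  rw [h1, PiLp.inner_apply]
  simp only [PiLp.inner_apply, Fintype.sum_prod_type, Fintype.sum_bool, cnot_apply,
    circuitU_toUnitary_ket_apply, inner_smul_left, inner_smul_right, inner_self_eq_norm_sq_to_K]
  by_cases hc : c' = c
  · subst hc
    rw [if_pos rfl, Finset.sum_eq_single c']
    · have h0 : ∀ t : ℝ, 0 ≤ clampUnit t := fun t => le_max_left _ _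
      have hle : ∀ t : ℝ, clampUnit t ≤ 1 := fun t => max_le zero_le_one (min_le_left _ _)
      cases b
      · have : (1 - (rotationWeight L H (O i z) : ℂ)) =
            ((∑ x : E, ‖O i z x‖ ^ 2 * (1 - clampUnit ((x - L) / (H - L))) : ℝ) : ℂ) := by
          simp only [mul_sub, mul_one, Finset.sum_sub_distrib, hsq, rotationWeight]
          push_cast; rfl
        rw [if_neg (by simp), this]
        simp only [rotationMatrix, Bool.xor_false, Bool.xor_true, Bool.not_false,
          Bool.xor_self, and_true, and_false, reduceCtorEq, if_true, if_false, map_zero, zero_mul,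
          mul_zero, Finset.sum_const_zero, zero_add, add_zero]
        push_cast
        refine Finset.sum_congr rfl fun x _ => ?_
        have hs : ((√(1 - clampUnit ((x - L) / (H - L))) : ℝ) : ℂ) ^ 2 =
            1 - (clampUnit ((x - L) / (H - L)) : ℂ) := by
          rw [← Complex.ofReal_pow, Real.sq_sqrt (by linarith [hle ((x - L) / (H - L))])]
          push_cast; rfl
        rw [Complex.conj_ofReal, ← hs]
        simp only [Complex.coe_algebraMap]
        ring
      · rw [if_pos rfl, rotationWeight]
        simp only [rotationMatrix, Bool.xor_false, Bool.xor_true, Bool.not_false,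
          Bool.xor_self, and_true, and_false, reduceCtorEq, if_true, if_false, map_zero, zero_mul,
          mul_zero, Finset.sum_const_zero, add_zero]
        push_cast
        refine Finset.sum_congr rfl fun x _ => ?_
        have hs : ((√(clampUnit ((x - L) / (H - L))) : ℝ) : ℂ) ^ 2 =
            (clampUnit ((x - L) / (H - L)) : ℂ) := by
          rw [← Complex.ofReal_pow, Real.sq_sqrt (h0 _)]
        rw [Complex.conj_ofReal, ← hs]
        simp only [Complex.coe_algebraMap]
        ring
    · intro d _ hd
      simp [hd]
    · simp
  · rw [if_neg hc]
    refine Finset.sum_eq_zero fun d _ => ?_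
    by_cases h2 : d = c'
    · subst h2; simp [hc]
    · simp [h2]

end Gates

/-! ### The fixed-point search and the Grover iterations on the counter blocks -/

section Search

variable {𝒦 : Type*} [NormedAddCommGroup 𝒦] [InnerProductSpace ℂ 𝒦] {E : Finset ℝ}
  {T k : ℕ}

/-- The state `|c⟩|0⟩(cos θ |0⟩ + sin θ |1⟩) z`. -/
noncomputable def tiltedKet (z : Register 𝒦 E) (θ : ℝ) (c : Fin (k + 1)) :
    JointSpace (Ancilla k) (Register 𝒦 E) :=
  (Real.cos θ : ℂ) • ket (c, false, false) z + (Real.sin θ : ℂ) • ket (c, false, true) z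

theorem inner_ket_tiltedKet {z : Register 𝒦 E} (hz : ‖z‖ = 1) (θ : ℝ) (c c' : Fin (k + 1))
    (b : Bool) : inner ℂ (ket (c', false, b) z) (tiltedKet z θ c) =
      if c' = c then (if b then (Real.sin θ : ℂ) else Real.cos θ) else 0 := by
  rw [tiltedKet, inner_add_right, inner_smul_right, inner_smul_right, inner_ket_ket hz,
    inner_ket_ket hz]
  by_cases h : c' = c <;> cases b <;> simp [h]

theorem sum_ite_first_qubit {M : Type*} [AddCommMonoid M] (f : Ancilla k → M) :
    (∑ a, if (!a.2.1) = true then f a else 0) =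
      ∑ c, (f (c, false, true) + f (c, false, false)) := by
  simp [Fintype.sum_prod_type]

theorem sum_ite_both_qubits {M : Type*} [AddCommMonoid M] (f : Ancilla k → M) :
    (∑ a, if (!a.2.1 && !a.2.2) = true then f a else 0) = ∑ c, f (c, false, false) := by
  simp [Fintype.sum_prod_type]

theorem sum_ite_counter_both_qubits {M : Type*} [AddCommMonoid M] (s : ℕ) (f : Ancilla k → M) :
    (∑ a, if (decide (s ≤ (a.1 : ℕ)) && !a.2.1 && !a.2.2) = true then f a else 0) =
      ∑ c : Fin (k + 1), if s ≤ (c : ℕ) then f (c, false, false) else 0 := by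
  simp [Fintype.sum_prod_type]

/-- As (1-p, p) = w(cos θ, sin θ), the vector w times the tilted state is the full projection of the
prepared state onto the target space. -/
theorem inner_ket_circuitV_sub {L H : ℝ} {i : Fin T}
    {O : Fin T → (Register 𝒦 E ≃ₗᵢ[ℂ] Register 𝒦 E)} {z : Register 𝒦 E} (hz : ‖z‖ = 1)
    {p θ w : ℝ} (hp : rotationWeight L H (O i z) = p)
    (hwc : w * Real.cos θ = 1 - p) (hws : w * Real.sin θ = p) (c' c : Fin (k + 1)) (b : Bool) :
    inner ℂ (ket (c', false, b) z) ((circuitV L H i).toUnitary O (ket (c, false, false) z) -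
      (w : ℂ) • tiltedKet z θ c) = 0 := by
  have hwc' : (w : ℂ) * Real.cos θ = 1 - p := by exact_mod_cast hwc
  have hws' : (w : ℂ) * Real.sin θ = p := by exact_mod_cast hws
  rw [inner_sub_right, inner_smul_right, inner_ket_circuitV L H i O hz, inner_ket_tiltedKet hz, hp]
  split_ifs
  · rw [hws', sub_self]
  · rw [hwc', sub_self]
  · rw [mul_zero, sub_self]

/-- The fixed-point search stays in the span of the target state and the rest of the
initial state. -/
theorem circuitS_toUnitary_ket {L H ε' : ℝ} {i : Fin T}
    {O : Fin T → (Register 𝒦 E ≃ₗᵢ[ℂ] Register 𝒦 E)} {z : Register 𝒦 E} (hz : ‖z‖ = 1)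
    {p θ w x : ℝ} (hp : rotationWeight L H (O i z) = p)
    (hθ : p * Real.cos θ = (1 - p) * Real.sin θ)
    (hw : w = (1 - p) * Real.cos θ + p * Real.sin θ) (hwx : w ^ 2 + x ^ 2 = 1)
    (c : Fin (k + 1)) :
    (circuitS z hz L H ε' i).toUnitary O (ket (c, false, false) z) =
      (searchCoeff w x
        (fun j => Complex.exp ((-fixPhase ε' (fixIterations ε' - j) : ℝ) * Complex.I))
        (fun j => Complex.exp ((-fixPhase ε' (j + 1) : ℝ) * Complex.I)) (fixIterations ε')).1 •
          tiltedKet z θ c +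
      (searchCoeff w x
        (fun j => Complex.exp ((-fixPhase ε' (fixIterations ε' - j) : ℝ) * Complex.I))
        (fun j => Complex.exp ((-fixPhase ε' (j + 1) : ℝ) * Complex.I)) (fixIterations ε')).2 •
          ((circuitV L H i).toUnitary O (ket (c, false, false) z) - (w : ℂ) • tiltedKet z θ c) := by
  set l := fixIterations ε' with hl
  set β : ℕ → ℂ := fun j => Complex.exp ((-fixPhase ε' (l - j) : ℝ) * Complex.I) with hβ
  set ς : ℕ → ℂ := fun j => Complex.exp ((-fixPhase ε' (j + 1) : ℝ) * Complex.I) with hς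
  set V := (circuitV (k := k) L H i).toUnitary O with hV
  set η : Fin (k + 1) → JointSpace (Ancilla k) (Register 𝒦 E) :=
    fun c => V (ket (c, false, false) z) with hη
  set t : Fin (k + 1) → JointSpace (Ancilla k) (Register 𝒦 E) := tiltedKet z θ with ht
  have hsc : Real.sin θ ^ 2 + Real.cos θ ^ 2 = 1 := Real.sin_sq_add_cos_sq θ
  have hwc : w * Real.cos θ = 1 - p := by
    rw [hw]; linear_combination (1 - p) * hsc + Real.sin θ * hθ
  have hws : w * Real.sin θ = p := by
    rw [hw]; linear_combination p * hsc - Real.cos θ * hθ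
  have hwc' : (w : ℂ) * Real.cos θ = 1 - p := by exact_mod_cast hwc
  have hws' : (w : ℂ) * Real.sin θ = p := by exact_mod_cast hws
  have hsc' : (Real.sin θ : ℂ) ^ 2 + (Real.cos θ : ℂ) ^ 2 = 1 := by exact_mod_cast hsc
  have hwx' : (w : ℂ) ^ 2 + (x : ℂ) ^ 2 = 1 := by exact_mod_cast hwx
  have hτη : ∀ c' c b, inner ℂ (ket (c', false, b) z) (η c) =
      if c' = c then (if b then (p : ℂ) else 1 - p) else 0 := fun c' c b => by
    rw [← hp]; exact inner_ket_circuitV L H i O hz c c' b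
  have hτt : ∀ c' c b, inner ℂ (ket (c', false, b) z) (t c) =
      if c' = c then (if b then (Real.sin θ : ℂ) else Real.cos θ) else 0 :=
    fun c' c b => inner_ket_tiltedKet hz θ c c' b
  have hτr : ∀ c' c b, inner ℂ (ket (c', false, b) z) (η c - (w : ℂ) • t c) = 0 :=
    fun c' c b => inner_ket_circuitV_sub hz hp hwc hws c' c b
  have hηt : ∀ c' c, inner ℂ (η c') (t c) = if c' = c then (w : ℂ) else 0 := by
    intro c' c
    rw [ht, tiltedKet, inner_add_right, inner_smul_right, inner_smul_right,
      ← inner_conj_symm, ← inner_conj_symm (η c') (ket (c, false, true) z), hτη, hτη]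
    by_cases h : c' = c
    · subst h
      simp only [if_true, Bool.false_eq_true, if_false, map_sub, map_one, Complex.conj_ofReal]
      linear_combination (-(Real.cos θ : ℂ)) * hwc' - (Real.sin θ : ℂ) * hws' + (w : ℂ) * hsc'
    · rw [if_neg (Ne.symm h), if_neg (Ne.symm h), if_neg h]; simp
  have hηη : ∀ c' c, inner ℂ (η c') (η c) = if c' = c then (1 : ℂ) else 0 := by
    intro c' c
    simp only [hη]
    rw [LinearIsometryEquiv.inner_map_map, inner_ket_ket hz]
    simp
  have hηr : ∀ c' c, inner ℂ (η c') (η c - (w : ℂ) • t c) = if c' = c then (x : ℂ) ^ 2 else 0 := by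
    intro c' c
    rw [inner_sub_right, inner_smul_right, hηη, hηt]
    split_ifs
    · linear_combination -hwx'
    · rw [mul_zero, sub_self]
  have hiter : ∀ n, Circuit.toUnitary O (circuitV L H i ++
      (List.range n).flatMap fun j =>
        [phaseGate z hz (fun a => !a.2.1) (-fixPhase ε' (l - j))] ++
        (circuitV L H i).adjoint ++
        [phaseGate z hz (fun a => !a.2.1 && !a.2.2) (-fixPhase ε' (j + 1))] ++
        circuitV L H i) (ket (c, false, false) z) =
      (searchCoeff w x β ς n).1 • t c + (searchCoeff w x β ς n).2 • (η c - (w : ℂ) • t c) := by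
    intro n
    induction n with
    | zero =>
      simp only [List.range_zero, List.flatMap_nil, List.append_nil, searchCoeff, one_smul,
        add_sub_cancel]
      rfl
    | succ n ih =>
      rw [List.range_succ, List.flatMap_append, ← List.append_assoc, Circuit.toUnitary_append, ih,
        List.flatMap_singleton, List.append_assoc, List.append_assoc, Circuit.toUnitary_append,
        Circuit.toUnitary_singleton, phaseGate_toUnitary_apply]
      set B := (searchCoeff w x β ς n).1 with hB
      set A := (searchCoeff w x β ς n).2 with hA
      -- The phase about Π acts only on the tilted part: the rest is orthogonal to the whole range
      -- of Π, and other counter values contribute nothing.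
      have h1 : (∑ a : Ancilla k, if (!a.2.1) = true then
          inner ℂ (ket a z) (B • t c + A • (η c - (w : ℂ) • t c)) • ket a z else 0) = B • t c := by
        rw [sum_ite_first_qubit]
        simp only [inner_add_right, inner_smul_right, hτr, hτt, mul_zero, add_zero]
        rw [Finset.sum_eq_single c]
        · simp only [if_true, Bool.false_eq_true, if_false]
          rw [ht, tiltedKet, smul_add, smul_smul, smul_smul, add_comm]
        · intro c' _ h
          simp [h]
        · simp
      have hb : Complex.exp ((-fixPhase ε' (l - n) : ℝ) * Complex.I) = β n := rfl
      have hs : Complex.exp ((-fixPhase ε' (n + 1) : ℝ) * Complex.I) = ς n := rfl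
      rw [h1, ← List.append_assoc, toUnitary_conj_phaseGate, sum_ite_both_qubits, hb, hs]
      have h2 : B • t c + A • (η c - (w : ℂ) • t c) - (1 - β n) • B • t c =
          (β n * B) • t c + A • (η c - (w : ℂ) • t c) := by module
      rw [h2]
      have h3 : (∑ c', inner ℂ (η c') ((β n * B) • t c + A • (η c - (w : ℂ) • t c)) • η c') =
          (w * (β n * B) + x ^ 2 * A) • η c := by
        simp only [inner_add_right, inner_smul_right, hηr, hηt]
        rw [Finset.sum_eq_single c]
        · simp only [if_true]; congr 1; ring
        · intro c' _ h
          simp [h]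
        · simp
      change _ - (1 - ς n) • (∑ c', inner ℂ (η c') ((β n * B) • t c +
        A • (η c - (w : ℂ) • t c)) • η c') = _
      rw [h3]
      simp only [searchCoeff]
      rw [← hA, ← hB]
      module
  exact hiter l

theorem inner_tiltedKet_self {z : Register 𝒦 E} (hz : ‖z‖ = 1) (θ : ℝ) (c : Fin (k + 1)) :
    inner ℂ (tiltedKet z θ c) (tiltedKet z θ c) = (1 : ℂ) := by
  conv_lhs => rw [show tiltedKet z θ c = (Real.cos θ : ℂ) • ket (c, false, false) z +
    (Real.sin θ : ℂ) • ket (c, false, true) z from rfl]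
  have hc : Real.sin θ ^ 2 + Real.cos θ ^ 2 = 1 := Real.sin_sq_add_cos_sq θ
  have hsc' : (Real.sin θ : ℂ) ^ 2 + (Real.cos θ : ℂ) ^ 2 = 1 := by exact_mod_cast hc
  simp only [inner_add_left, inner_add_right, inner_smul_left, inner_smul_right,
    inner_ket_ket hz, Complex.conj_ofReal, Prod.mk.injEq, reduceCtorEq, and_false, if_true, if_false]
  linear_combination hsc'

theorem norm_eq_one_of_inner_self {V : Type*} [NormedAddCommGroup V] [InnerProductSpace ℂ V] {v : V}
    (h : inner ℂ v v = (1 : ℂ)) : ‖v‖ = 1 := by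
  have h1 := congrArg Complex.re h
  have h2 := inner_self_eq_norm_sq (𝕜 := ℂ) v
  rw [Complex.one_re] at h1
  exact (pow_eq_one_iff_of_nonneg (norm_nonneg v) two_ne_zero).1 (h2.symm.trans h1)

theorem norm_tiltedKet {z : Register 𝒦 E} (hz : ‖z‖ = 1) (θ : ℝ) (c : Fin (k + 1)) :
    ‖tiltedKet z θ c‖ = 1 := norm_eq_one_of_inner_self (inner_tiltedKet_self hz θ c)

theorem norm_ket {z : Register 𝒦 E} (hz : ‖z‖ = 1) (a : Ancilla k) : ‖ket a z‖ = 1 :=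
  norm_eq_one_of_inner_self (by rw [inner_ket_ket hz, if_pos rfl])

/-- The fixed-point search prepares the target state, up to a phase and an error `ε'`, and it
does not change the counter. -/
theorem exists_phase_circuitS {L H ε' : ℝ} (h0 : 0 < ε') (h2 : ε' < 2) {i : Fin T}
    {O : Fin T → (Register 𝒦 E ≃ₗᵢ[ℂ] Register 𝒦 E)} {z : Register 𝒦 E} (hz : ‖z‖ = 1)
    {p θ : ℝ} (hp : rotationWeight L H (O i z) = p) (hp0 : 0 ≤ p) (hp1 : p ≤ 1)
    (hθ : p * Real.cos θ = (1 - p) * Real.sin θ) :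
    ∃ ω : ℂ, ‖ω‖ = 1 ∧ ∀ c : Fin (k + 1),
      ‖(circuitS z hz L H ε' i).toUnitary O (ket (c, false, false) z) - ω • tiltedKet z θ c‖ ≤ ε' ∧
      ∀ c' b, c' ≠ c → inner ℂ (ket (c', false, b) z)
        ((circuitS z hz L H ε' i).toUnitary O (ket (c, false, false) z)) = 0 := by
  set w := (1 - p) * Real.cos θ + p * Real.sin θ with hw
  have hsc : Real.sin θ ^ 2 + Real.cos θ ^ 2 = 1 := Real.sin_sq_add_cos_sq θ
  have hw2 : w ^ 2 = (1 - p) ^ 2 + p ^ 2 := by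
    rw [hw]
    linear_combination ((1 - p) ^ 2 + p ^ 2) * hsc -
      (p * Real.cos θ - (1 - p) * Real.sin θ) * hθ
  have hwc : w * Real.cos θ = 1 - p := by
    rw [hw]; linear_combination (1 - p) * hsc + Real.sin θ * hθ
  have hws : w * Real.sin θ = p := by
    rw [hw]; linear_combination p * hsc - Real.cos θ * hθ
  set x := √(1 - w ^ 2) with hx
  have hx2 : x ^ 2 = 1 - w ^ 2 := Real.sq_sqrt (by rw [hw2]; nlinarith)
  have hx0 : 0 ≤ x := Real.sqrt_nonneg _
  have hwx : w ^ 2 + x ^ 2 = 1 := by rw [hx2]; ring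
  have hcoeff := norm_fixSearchCoeff_le h0 h2 hwx
    (by rw [hx2, hw2]; nlinarith [sq_nonneg (2 * p - 1)])
  have hstate := fun c : Fin (k + 1) =>
    circuitS_toUnitary_ket (ε' := ε') hz hp hθ hw hwx c
  set B := (searchCoeff w x
    (fun j => Complex.exp ((-fixPhase ε' (fixIterations ε' - j) : ℝ) * Complex.I))
    (fun j => Complex.exp ((-fixPhase ε' (j + 1) : ℝ) * Complex.I)) (fixIterations ε')).1
  set A := (searchCoeff w x
    (fun j => Complex.exp ((-fixPhase ε' (fixIterations ε' - j) : ℝ) * Complex.I))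
    (fun j => Complex.exp ((-fixPhase ε' (j + 1) : ℝ) * Complex.I)) (fixIterations ε')).2
  set r : Fin (k + 1) → JointSpace (Ancilla k) (Register 𝒦 E) := fun c =>
    (circuitV L H i).toUnitary O (ket (c, false, false) z) - (w : ℂ) • tiltedKet z θ c with hr
  have hτr : ∀ c' c b, inner ℂ (ket (c', false, b) z) (r c) = 0 :=
    fun c' c b => inner_ket_circuitV_sub hz hp hwc hws c' c b
  have htr : ∀ c, inner ℂ (tiltedKet z θ c) (r c) = 0 := by
    intro c
    rw [tiltedKet, inner_add_left, inner_smul_left, inner_smul_left, hτr, hτr]; simp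
  have htn : ∀ c : Fin (k + 1), ‖tiltedKet z θ c‖ = 1 := norm_tiltedKet hz θ
  have hpyth : ∀ (c : Fin (k + 1)) (b a : ℂ), ‖b • tiltedKet z θ c + a • r c‖ ^ 2 =
      ‖b‖ ^ 2 + ‖a‖ ^ 2 * ‖r c‖ ^ 2 := by
    intro c b a
    have h := norm_add_sq_eq_norm_sq_add_norm_sq_of_inner_eq_zero (𝕜 := ℂ) (b • tiltedKet z θ c)
      (a • r c) (by rw [inner_smul_left, inner_smul_right, htr]; simp)
    rw [← sq, ← sq, ← sq, norm_smul, norm_smul, htn, mul_one] at h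
    rw [h, mul_pow]
  have hkn : ∀ c : Fin (k + 1), ‖(ket (c, false, false) z : JointSpace (Ancilla k) _)‖ = 1 :=
    fun c => norm_ket hz _
  have hrn : ∀ c, ‖r c‖ = x := by
    intro c
    have h := hpyth c w 1
    rw [one_smul, hr, add_sub_cancel, LinearIsometryEquiv.norm_map, hkn, norm_one,
      Complex.norm_real, Real.norm_eq_abs, sq_abs] at h
    have h' : ‖r c‖ ^ 2 = x ^ 2 := by rw [hr]; linarith
    exact (sq_eq_sq₀ (norm_nonneg _) hx0).1 h'
  have hBA : ‖B‖ ^ 2 + (‖A‖ * x) ^ 2 = 1 := by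
    have h := hpyth 0 B A
    rw [← hstate, LinearIsometryEquiv.norm_map, hkn, hrn] at h
    rw [mul_pow]; linarith
  rw [norm_mul, Complex.norm_real, Real.norm_of_nonneg hx0, mul_comm] at hcoeff
  have hy0 : 0 ≤ ‖A‖ * x := by positivity
  have hB0 : 0 < ‖B‖ := by
    by_contra h
    have : ‖B‖ = 0 := le_antisymm (not_lt.1 h) (norm_nonneg _)
    rw [this] at hBA
    nlinarith
  -- The coefficients B and A do not depend on c, so one phase serves all counter values and stays
  -- global in the superposition over the counter.
  refine ⟨B / ‖B‖, ?_, fun c => ⟨?_, ?_⟩⟩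
  · rw [norm_div, Complex.norm_real, norm_norm, div_self hB0.ne']
  · have hBc : (‖B‖ : ℂ) ≠ 0 := by exact_mod_cast hB0.ne'
    rw [hstate, show B • tiltedKet z θ c + A • ((circuitV L H i).toUnitary O
      (ket (c, false, false) z) - (w : ℂ) • tiltedKet z θ c) - (B / ‖B‖) • tiltedKet z θ c =
        (B - B / ‖B‖) • tiltedKet z θ c + A • r c by simp only [hr]; module]
    refine (norm_add_le _ _).trans ?_
    rw [norm_smul, norm_smul, htn, hrn, mul_one]
    have h1 : ‖B - B / ‖B‖‖ = |‖B‖ - 1| := by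
      rw [show B - B / ‖B‖ = ((‖B‖ - 1 : ℝ) : ℂ) * (B / ‖B‖) by push_cast; field_simp,
        norm_mul, norm_div, Complex.norm_real, Complex.norm_real, norm_norm, div_self hB0.ne',
        mul_one, Real.norm_eq_abs]
    -- With y = ‖A‖x ≤ ε'/2 < 1 and ‖B‖² + y² = 1, one has 1 - ‖B‖ ≤ y² ≤ y. The total error is at
    -- most 2y ≤ ε'.
    have h3 : ‖B‖ ≤ 1 := by nlinarith
    rw [h1, abs_of_nonpos (by linarith)]
    nlinarith
  · intro c' b hc
    rw [hstate, inner_add_right, inner_smul_right, inner_smul_right, inner_ket_tiltedKet hz,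
      if_neg hc]
    have := hτr c' c b
    simp only [hr] at this
    rw [this]; simp

end Search

/-! ### Amplitude estimation with imperfect Grover iterations -/

section Grover

variable {𝒦 : Type*} [NormedAddCommGroup 𝒦] [InnerProductSpace ℂ 𝒦] {E : Finset ℝ}
  {T k : ℕ}

theorem inner_tiltedKet_tiltedKet {z : Register 𝒦 E} (hz : ‖z‖ = 1) (θ Ψ : ℝ) (c : Fin (k + 1)) :
    inner ℂ (tiltedKet z θ c) (tiltedKet z Ψ c) = (Real.cos (θ - Ψ) : ℂ) := by
  rw [tiltedKet, inner_add_left, inner_smul_left, inner_smul_left, inner_ket_tiltedKet hz,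
    inner_ket_tiltedKet hz, Real.cos_sub]
  simp only [if_true, Bool.false_eq_true, if_false, Complex.conj_ofReal]
  push_cast; ring

/-- The gate negates |0⟩ and so is -(I - 2|1⟩⟨1|) on the second qubit. The other reflection is
implemented as I - 2SPS† instead of 2SPS† - I, and the two signs cancel. -/
theorem signGate_toUnitary_tiltedKet (s : ℕ) (O : Fin T → (Register 𝒦 E ≃ₗᵢ[ℂ] Register 𝒦 E))
    (z : Register 𝒦 E) (Θ : ℝ) (c : Fin (k + 1)) :
    (signGate (T := T) fun a : Ancilla k => decide (s ≤ (a.1 : ℕ)) && !a.2.2).toUnitary O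
      (tiltedKet z Θ c) = tiltedKet z (if s ≤ (c : ℕ) then Real.pi - Θ else Θ) c := by
  rw [tiltedKet, map_add, map_smul, map_smul, signGate_toUnitary_ket, signGate_toUnitary_ket]
  by_cases h : s ≤ (c : ℕ)
  · simp [h, tiltedKet, Real.cos_pi_sub, Real.sin_pi_sub]
  · simp [h, tiltedKet]

theorem tiltedKet_reflection {z : Register 𝒦 E} (θ Θ : ℝ) (c : Fin (k + 1)) :
    tiltedKet z (Real.pi - Θ) c - (2 * (Real.cos (θ - (Real.pi - Θ)) : ℂ)) • tiltedKet z θ c =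
      tiltedKet z (Θ + 2 * θ) c := by
  have h1 : Real.cos (Real.pi - Θ) - 2 * Real.cos (θ - (Real.pi - Θ)) * Real.cos θ =
      Real.cos (Θ + 2 * θ) := by
    rw [show θ - (Real.pi - Θ) = (θ + Θ) - Real.pi by ring, Real.cos_sub_pi, Real.cos_pi_sub,
      show Θ + 2 * θ = (θ + Θ) + θ by ring, Real.cos_add (θ + Θ) θ]
    have : Real.cos Θ = Real.cos (θ + Θ) * Real.cos θ + Real.sin (θ + Θ) * Real.sin θ := by
      rw [← Real.cos_sub]; congr 1; ring
    linarith
  have h2 : Real.sin (Real.pi - Θ) - 2 * Real.cos (θ - (Real.pi - Θ)) * Real.sin θ =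
      Real.sin (Θ + 2 * θ) := by
    rw [show θ - (Real.pi - Θ) = (θ + Θ) - Real.pi by ring, Real.cos_sub_pi, Real.sin_pi_sub,
      show Θ + 2 * θ = (θ + Θ) + θ by ring, Real.sin_add (θ + Θ) θ]
    have : Real.sin Θ = Real.sin (θ + Θ) * Real.cos θ - Real.cos (θ + Θ) * Real.sin θ := by
      rw [← Real.sin_sub]; congr 1; ring
    linarith
  rw [tiltedKet, tiltedKet, tiltedKet, ← h1, ← h2]
  push_cast
  module

/-- A rank-one projector does not see the phase of its vector, so t may be replaced by ωt. Changing
bra and ket one at a time costs ε each. -/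
theorem norm_inner_smul_sub_le {V : Type*} [NormedAddCommGroup V] [InnerProductSpace ℂ V]
    {F t v : V} {ω : ℂ} {ε : ℝ} (hF : ‖F‖ = 1) (ht : ‖t‖ = 1) (hv : ‖v‖ = 1) (hω : ‖ω‖ = 1)
    (h : ‖F - ω • t‖ ≤ ε) : ‖inner ℂ F v • F - inner ℂ t v • t‖ ≤ 2 * ε := by
  have hωω : (starRingEnd ℂ) ω * ω = 1 := by
    rw [← Complex.normSq_eq_conj_mul_self, Complex.normSq_eq_norm_sq, hω]; simp
  have h1 : inner ℂ F v • F - inner ℂ t v • t =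
      inner ℂ (F - ω • t) v • F + inner ℂ (ω • t) v • (F - ω • t) := by
    have h2 : inner ℂ t v • t = inner ℂ (ω • t) v • (ω • t) := by
      rw [inner_smul_left, smul_smul]; congr 1; linear_combination -inner ℂ t v * hωω
    rw [h2, inner_sub_left]; module
  rw [h1]
  refine (norm_add_le _ _).trans ?_
  rw [norm_smul, norm_smul, hF, mul_one]
  have h3 : ‖inner ℂ (F - ω • t) v‖ ≤ ε :=
    (norm_inner_le_norm _ _).trans (by rw [hv, mul_one]; exact h)
  have h4 : ‖inner ℂ (ω • t) v‖ ≤ 1 :=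
    (norm_inner_le_norm _ _).trans (by rw [norm_smul, hω, ht, hv]; norm_num)
  nlinarith [norm_nonneg (F - ω • t)]

/-- An imperfect Grover iteration rotates by the angle `2θ`, with an error of at most `4ε'`. -/
theorem circuitGrover_toUnitary_tiltedKet {L H ε' : ℝ} {i : Fin T}
    {O : Fin T → (Register 𝒦 E ≃ₗᵢ[ℂ] Register 𝒦 E)} {z : Register 𝒦 E} (hz : ‖z‖ = 1) {θ : ℝ}
    {ω : ℂ} (hω : ‖ω‖ = 1) (hS : ∀ c : Fin (k + 1),
      ‖(circuitS z hz L H ε' i).toUnitary O (ket (c, false, false) z) - ω • tiltedKet z θ c‖ ≤ ε' ∧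
      ∀ c' b, c' ≠ c → inner ℂ (ket (c', false, b) z)
        ((circuitS z hz L H ε' i).toUnitary O (ket (c, false, false) z)) = 0)
    (s : ℕ) (Θ : ℝ) (c : Fin (k + 1)) :
    ‖(circuitGrover z hz L H ε' i s).toUnitary O (tiltedKet z Θ c) -
      tiltedKet z (Θ + if s ≤ (c : ℕ) then 2 * θ else 0) c‖ ≤ 4 * ε' := by
  set F : Fin (k + 1) → JointSpace (Ancilla k) (Register 𝒦 E) := fun c =>
    (circuitS z hz L H ε' i).toUnitary O (ket (c, false, false) z) with hF
  have hFn : ∀ c, ‖F c‖ = 1 := fun c => by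
    rw [hF, LinearIsometryEquiv.norm_map, norm_ket hz]
  have hε : 0 ≤ ε' := (norm_nonneg _).trans (hS c).1
  -- The reflection sums over all counter values. Since the search fixes the counter, only the
  -- branch c survives.
  have horth : ∀ c' Ψ, c' ≠ c → inner ℂ (F c') (tiltedKet z Ψ c) = 0 := by
    intro c' Ψ h
    rw [tiltedKet, inner_add_right, inner_smul_right, inner_smul_right, ← inner_conj_symm,
      ← inner_conj_symm (F c') (ket (c, false, true) z), (hS c').2 c _ h.symm,
      (hS c').2 c _ h.symm]
    simp
  have hG : (circuitGrover z hz L H ε' i s).toUnitary O (tiltedKet z Θ c) =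
      tiltedKet z (if s ≤ (c : ℕ) then Real.pi - Θ else Θ) c - (2 : ℂ) •
        if s ≤ (c : ℕ) then
          inner ℂ (F c) (tiltedKet z (if s ≤ (c : ℕ) then Real.pi - Θ else Θ) c) • F c else 0 := by
    rw [circuitGrover, List.append_assoc, List.append_assoc, Circuit.toUnitary_append,
      Circuit.toUnitary_singleton, signGate_toUnitary_tiltedKet, ← List.append_assoc,
      toUnitary_conj_phaseGate, sum_ite_counter_both_qubits, Complex.exp_pi_mul_I,
      Finset.sum_eq_single c]
    · norm_num; rfl
    · intro c' _ h
      have := horth c' (if s ≤ (c : ℕ) then Real.pi - Θ else Θ) h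
      simp only [hF] at this
      rw [this]; simp
    · simp
  rw [hG]
  by_cases h : s ≤ (c : ℕ)
  · simp only [if_pos h]
    rw [← tiltedKet_reflection, mul_smul, ← inner_tiltedKet_tiltedKet hz θ (Real.pi - Θ) c,
      sub_sub_sub_cancel_left, ← smul_sub, norm_smul, norm_sub_rev, Complex.norm_ofNat]
    have := norm_inner_smul_sub_le (v := tiltedKet z (Real.pi - Θ) c) (hFn c)
      (norm_tiltedKet hz θ c) (norm_tiltedKet hz _ c) hω (hS c).1
    linarith
  · simp only [if_neg h, add_zero, smul_zero, sub_zero, sub_self, norm_zero]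
    positivity

/-- Unitaries do not amplify earlier errors, so the error grows by only 4ε' per iteration while the
angles add. -/
theorem flatMap_circuitGrover_toUnitary {L H ε' : ℝ} {z : Register 𝒦 E} (hz : ‖z‖ = 1)
    {O : Fin T → (Register 𝒦 E ≃ₗᵢ[ℂ] Register 𝒦 E)} (σ : Fin (k + 1) → Fin T)
    (θ : Fin (k + 1) → ℝ) (c : Fin (k + 1))
    (hG : ∀ (s : Fin k) Θ, ‖(circuitGrover z hz L H ε' (σ s.succ) ((s : ℕ) + 1)).toUnitary O
      (tiltedKet z Θ c) - tiltedKet z (Θ + if (s : ℕ) + 1 ≤ (c : ℕ) then 2 * θ s.succ else 0) c‖ ≤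
        4 * ε')
    {ω : ℂ} (hω : ‖ω‖ = 1) (l : List (Fin k)) (v : JointSpace (Ancilla k) (Register 𝒦 E)) (Θ : ℝ) :
    ‖Circuit.toUnitary O (l.flatMap fun s : Fin k =>
        circuitGrover z hz L H ε' (σ s.succ) ((s : ℕ) + 1)) v -
      ω • tiltedKet z (Θ + (l.map fun s : Fin k =>
        if (s : ℕ) + 1 ≤ (c : ℕ) then 2 * θ s.succ else 0).sum) c‖ ≤
      ‖v - ω • tiltedKet z Θ c‖ + 4 * ε' * l.length := by
  induction l generalizing v Θ with
  | nil => simp [Circuit.toUnitary]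
  | cons s l ih =>
    rw [List.flatMap_cons, Circuit.toUnitary_append, List.map_cons, List.sum_cons, ← add_assoc]
    refine (ih _ _).trans ?_
    have h1 : ‖(circuitGrover z hz L H ε' (σ s.succ) ((s : ℕ) + 1)).toUnitary O v -
        ω • tiltedKet z (Θ + if (s : ℕ) + 1 ≤ (c : ℕ) then 2 * θ s.succ else 0) c‖ ≤
        ‖v - ω • tiltedKet z Θ c‖ + 4 * ε' := by
      rw [show (circuitGrover z hz L H ε' (σ s.succ) ((s : ℕ) + 1)).toUnitary O v -
        ω • tiltedKet z (Θ + if (s : ℕ) + 1 ≤ (c : ℕ) then 2 * θ s.succ else 0) c =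
        (circuitGrover z hz L H ε' (σ s.succ) ((s : ℕ) + 1)).toUnitary O
          (v - ω • tiltedKet z Θ c) +
        ω • ((circuitGrover z hz L H ε' (σ s.succ) ((s : ℕ) + 1)).toUnitary O (tiltedKet z Θ c) -
          tiltedKet z (Θ + if (s : ℕ) + 1 ≤ (c : ℕ) then 2 * θ s.succ else 0) c) by
        rw [map_sub, map_smul]; module]
      refine (norm_add_le _ _).trans (add_le_add ?_ ?_)
      · rw [LinearIsometryEquiv.norm_map]
      · rw [norm_smul, hω, one_mul]; exact hG s Θ
    rw [List.length_cons]; push_cast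
    linarith

theorem counterFourier_ket_zero (z : Register 𝒦 E) :
    counterFourier (k := k) (ket (0, false, false) z) =
      ∑ c : Fin (k + 1), ((1 / √((k + 1 : ℕ) : ℝ) : ℝ) : ℂ) • ket (c, false, false) z := by
  refine PiLp.ext fun a => PiLp.ext fun x => ?_
  rw [counterFourier, valueControlled_apply, Finset.sum_eq_single (0, false, false)]
  · obtain ⟨c, b⟩ := a
    rw [ket_apply, if_pos rfl, WithLp.ofLp_sum, Finset.sum_apply, WithLp.ofLp_sum, Finset.sum_apply,
      Finset.sum_eq_single c]
    · change (fourierMatrix k c 0 * (1 : Matrix (Bool × Bool) (Bool × Bool) ℂ) b (false, false)) •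
        z x = (((1 / √((k + 1 : ℕ) : ℝ) : ℝ) : ℂ) • ket (c, false, false) z) (c, b) x
      rw [PiLp.smul_apply, ket_apply, Matrix.one_apply]
      by_cases hb : b = (false, false)
      · subst hb
        rw [if_pos rfl, if_pos rfl, PiLp.smul_apply, fourierMatrix]
        simp
      · rw [if_neg hb, if_neg (by simpa using hb)]; simp
    · intro c' _ h
      rw [PiLp.smul_apply, ket_apply, if_neg (by simp [h.symm])]; simp
    · simp
  · intro b _ hb
    rw [ket_apply, if_neg hb]; simp
  · simp

theorem counterFourier_symm_apply (s : JointSpace (Ancilla k) (Register 𝒦 E)) (y : Fin (k + 1))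
    (b : Bool × Bool) :
    counterFourier.symm s (y, b) = ∑ j, (star (fourierMatrix k)) y j • s (j, b) := by
  set D : JointSpace (Ancilla k) (Register 𝒦 E) :=
    WithLp.toLp 2 fun a => ∑ j, (star (fourierMatrix k)) a.1 j • s (j, a.2) with hD
  have h : counterFourier D = s := by
    refine PiLp.ext fun a => PiLp.ext fun x => ?_
    obtain ⟨y, b⟩ := a
    rw [counterFourier, valueControlled_apply, Fintype.sum_prod_type]
    have h1 : ∀ j, ∑ b', (fourierMatrix k y j *
        (1 : Matrix (Bool × Bool) (Bool × Bool) ℂ) b b') • D (j, b') x =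
        ∑ i, (fourierMatrix k y j * star (fourierMatrix k) j i) • s (i, b) x := by
      intro j
      rw [Finset.sum_eq_single b]
      · rw [Matrix.one_apply_eq, mul_one, hD]
        simp only [WithLp.ofLp_sum, Finset.sum_apply, PiLp.smul_apply, Finset.smul_sum, smul_smul]
      · intro b' _ h
        rw [Matrix.one_apply_ne h.symm]; simp
      · simp
    refine (Finset.sum_congr rfl fun j _ => h1 j).trans ?_
    rw [Finset.sum_comm]
    simp only [← Finset.sum_smul]
    have h2 : ∀ i, ∑ j, fourierMatrix k y j * star (fourierMatrix k) j i =
        if y = i then 1 else 0 := by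
      intro i
      have h := congrFun (congrFun (Matrix.mem_unitaryGroup_iff.1 (fourierMatrix_mem k)) y) i
      rw [Matrix.mul_apply] at h
      simpa [Matrix.one_apply] using h
    simp only [h2, ite_smul, one_smul, zero_smul, Finset.sum_ite_eq, Finset.mem_univ, if_true]
  have h' : counterFourier.symm s = D := by rw [← h, LinearIsometryEquiv.symm_apply_apply]
  rw [h']

end Grover

/-! ### The distribution of the measured counter -/

section Outcome

variable {𝒦 : Type*} [NormedAddCommGroup 𝒦] [InnerProductSpace ℂ 𝒦] {E : Finset ℝ}
  {T k : ℕ}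

/-- The angle reached after the Grover iterations selected by the counter value `c`. -/
noncomputable def totalAngle (θ : Fin (k + 1) → ℝ) (c : Fin (k + 1)) : ℝ :=
  θ 0 + ∑ s : Fin k, if (s : ℕ) + 1 ≤ (c : ℕ) then 2 * θ s.succ else 0

theorem totalAngle_succ (θ : Fin (k + 1) → ℝ) (j : Fin k) :
    totalAngle θ j.succ = totalAngle θ j.castSucc + 2 * θ j.succ := by
  rw [totalAngle, totalAngle, add_assoc]
  congr 1
  rw [← sub_eq_iff_eq_add', ← Finset.sum_sub_distrib, Finset.sum_eq_single j]
  · simp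
  · intro s _ hs
    have : (s : ℕ) ≠ j := fun h => hs (Fin.ext h)
    rw [Fin.val_succ, Fin.val_castSucc]
    split_ifs <;> first | omega | simp
  · simp

/-- The state before the final inverse Fourier transform is close to the ideal one. -/
theorem norm_prefix_sub_le {L H ε' : ℝ} (h0 : 0 < ε') (h2 : ε' < 2) {z : Register 𝒦 E}
    (hz : ‖z‖ = 1) {O : Fin T → (Register 𝒦 E ≃ₗᵢ[ℂ] Register 𝒦 E)} (σ : Fin (k + 1) → Fin T)
    {p θ : Fin (k + 1) → ℝ} (hp : ∀ s, rotationWeight L H (O (σ s) z) = p s) (hp0 : ∀ s, 0 ≤ p s)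
    (hp1 : ∀ s, p s ≤ 1) (hθ : ∀ s, p s * Real.cos (θ s) = (1 - p s) * Real.sin (θ s)) :
    ∃ ω : ℂ, ‖ω‖ = 1 ∧ ∀ c : Fin (k + 1),
      ‖Circuit.toUnitary O (circuitS z hz L H ε' (σ 0) ++ (List.finRange k).flatMap
        fun s : Fin k => circuitGrover z hz L H ε' (σ s.succ) ((s : ℕ) + 1))
          (ket (c, false, false) z) - ω • tiltedKet z (totalAngle θ c) c‖ ≤
        4 * (k + 1 : ℕ) * ε' := by
  choose ω hω hS using fun s : Fin (k + 1) =>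
    exists_phase_circuitS (k := k) (L := L) (H := H) h0 h2 (i := σ s) (O := O) hz (hp s) (hp0 s)
      (hp1 s) (hθ s)
  refine ⟨ω 0, hω 0, fun c => ?_⟩
  rw [Circuit.toUnitary_append]
  have h := flatMap_circuitGrover_toUnitary hz σ θ c
    (fun s Θ => circuitGrover_toUnitary_tiltedKet hz (hω s.succ) (hS s.succ) ((s : ℕ) + 1) Θ c)
    (hω 0) (List.finRange k)
    ((circuitS z hz L H ε' (σ 0)).toUnitary O (ket (c, false, false) z)) (θ 0)
  rw [List.length_finRange, ← Fin.sum_univ_def] at h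
  refine h.trans ?_
  have := (hS 0 c).1
  push_cast
  linarith

/-- With C and S the transforms of cos Θ and sin Θ, the right-hand transforms are C ± iS, and this
is the parallelogram law. It splits the outcome distribution into two signals of opposite frequency
without interference. -/
theorem norm_sq_add_norm_sq_exp {k : ℕ} (Θ : Fin (k + 1) → ℝ) (y : Fin (k + 1)) :
    ‖invFourier (fun j => (Real.cos (Θ j) : ℂ)) y‖ ^ 2 +
      ‖invFourier (fun j => (Real.sin (Θ j) : ℂ)) y‖ ^ 2 =
    (‖invFourier (fun j => Complex.exp ((Θ j : ℝ) * Complex.I)) y‖ ^ 2 +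
      ‖invFourier (fun j => Complex.exp ((-Θ j : ℝ) * Complex.I)) y‖ ^ 2) / 2 := by
  set C := invFourier (fun j => (Real.cos (Θ j) : ℂ)) y with hC
  set S := invFourier (fun j => (Real.sin (Θ j) : ℂ)) y with hS
  have h1 : invFourier (fun j => Complex.exp ((Θ j : ℝ) * Complex.I)) y = C + Complex.I * S := by
    rw [hC, hS, ← invFourier_const_mul]
    simp only [invFourier, ← Finset.sum_add_distrib, ← mul_add]
    refine Finset.sum_congr rfl fun j _ => ?_
    rw [Complex.exp_mul_I]; push_cast; ring
  have h2 : invFourier (fun j => Complex.exp ((-Θ j : ℝ) * Complex.I)) y = C - Complex.I * S := by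
    rw [hC, hS, ← invFourier_const_mul, ← invFourier_sub]
    refine congrArg (fun f => invFourier f y) (funext fun j => ?_)
    rw [Complex.exp_mul_I]; push_cast
    rw [Complex.cos_neg, Complex.sin_neg]; ring
  have h3 := parallelogram_law_with_norm ℂ C (Complex.I * S)
  rw [norm_mul, Complex.norm_I, one_mul] at h3
  rw [h1, h2]
  nlinarith

theorem tiltedKet_apply (z : Register 𝒦 E) (θ : ℝ) (c j : Fin (k + 1)) (b : Bool × Bool) :
    tiltedKet z θ c (j, b) = if j = c then
      ((if b = (false, false) then (Real.cos θ : ℂ) else 0) +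
        if b = (false, true) then (Real.sin θ : ℂ) else 0) • z else 0 := by
  rw [tiltedKet, PiLp.add_apply, PiLp.smul_apply, PiLp.smul_apply, ket_apply, ket_apply]
  by_cases h : j = c
  · by_cases h1 : b = (false, false)
    · subst h1; simp [h]
    · by_cases h2 : b = (false, true)
      · subst h2; simp [h]
      · simp [h1, h2]
  · simp [h]

theorem sum_norm_sq_idealOutcome {z : Register 𝒦 E} (hz : ‖z‖ = 1) {ω : ℂ} (hω : ‖ω‖ = 1)
    (Θ : Fin (k + 1) → ℝ) (y : Fin (k + 1)) :
    ∑ b, ‖counterFourier.symm (∑ c : Fin (k + 1),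
      ((1 / √((k + 1 : ℕ) : ℝ) : ℝ) : ℂ) • ω • tiltedKet z (Θ c) c) (y, b)‖ ^ 2 =
    (‖invFourier (fun j => (Real.cos (Θ j) : ℂ)) y‖ ^ 2 +
      ‖invFourier (fun j => (Real.sin (Θ j) : ℂ)) y‖ ^ 2) / (k + 1 : ℕ) := by
  have hcomp : ∀ (j : Fin (k + 1)) (b : Bool × Bool), (∑ c : Fin (k + 1),
      ((1 / √((k + 1 : ℕ) : ℝ) : ℝ) : ℂ) • ω • tiltedKet z (Θ c) c) (j, b) =
      (((1 / √((k + 1 : ℕ) : ℝ) : ℝ) : ℂ) * ω *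
        ((if b = (false, false) then (Real.cos (Θ j) : ℂ) else 0) +
          if b = (false, true) then (Real.sin (Θ j) : ℂ) else 0)) • z := by
    intro j b
    rw [WithLp.ofLp_sum, Finset.sum_apply, Finset.sum_eq_single j]
    · rw [PiLp.smul_apply, PiLp.smul_apply, tiltedKet_apply, if_pos rfl, ← mul_smul, ← mul_smul]
    · intro c _ hc
      rw [PiLp.smul_apply, PiLp.smul_apply, tiltedKet_apply, if_neg hc.symm, smul_zero, smul_zero]
    · simp
  have hM : (0 : ℝ) < (k + 1 : ℕ) := by positivity
  have hamp : ∀ b, ‖counterFourier.symm (∑ c : Fin (k + 1),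
      ((1 / √((k + 1 : ℕ) : ℝ) : ℝ) : ℂ) • ω • tiltedKet z (Θ c) c) (y, b)‖ ^ 2 =
      ‖invFourier (fun j => (if b = (false, false) then (Real.cos (Θ j) : ℂ) else 0) +
          if b = (false, true) then (Real.sin (Θ j) : ℂ) else 0) y‖ ^ 2 / (k + 1 : ℕ) := by
    intro b
    rw [counterFourier_symm_apply]
    rw [Finset.sum_congr rfl fun j _ => by rw [hcomp, ← mul_smul], ← Finset.sum_smul, norm_smul, hz,
      mul_one]
    have : ∀ j, star (fourierMatrix k) y j * (((1 / √((k + 1 : ℕ) : ℝ) : ℝ) : ℂ) * ω *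
        ((if b = (false, false) then (Real.cos (Θ j) : ℂ) else 0) +
          if b = (false, true) then (Real.sin (Θ j) : ℂ) else 0)) =
        (((1 / √((k + 1 : ℕ) : ℝ) : ℝ) : ℂ) * ω) * (star (fourierMatrix k) y j *
        ((if b = (false, false) then (Real.cos (Θ j) : ℂ) else 0) +
          if b = (false, true) then (Real.sin (Θ j) : ℂ) else 0)) := fun j => by ring
    simp only [this, ← Finset.mul_sum]
    rw [norm_mul, norm_mul, hω, mul_one, mul_pow, Complex.norm_real, Real.norm_eq_abs, sq_abs,
      div_pow, Real.sq_sqrt hM.le, one_pow, invFourier]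
    ring
  rw [Fintype.sum_prod_type]
  simp only [Fintype.sum_bool, hamp]
  simp [invFourier, add_div, add_comm]

theorem free_toUnitary {A 𝓗 : Type*} [Fintype A] [NormedAddCommGroup 𝓗] [InnerProductSpace ℂ 𝓗]
    (W : JointSpace A 𝓗 ≃ₗᵢ[ℂ] JointSpace A 𝓗) (O : Fin T → (𝓗 ≃ₗᵢ[ℂ] 𝓗)) :
    (Gate.free (T := T) W).toUnitary O = W := rfl

theorem meanCircuit_toUnitary_ket {L H ε' : ℝ} {z : Register 𝒦 E} (hz : ‖z‖ = 1)
    (O : Fin T → (Register 𝒦 E ≃ₗᵢ[ℂ] Register 𝒦 E)) (σ : Fin (k + 1) → Fin T) :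
    (meanCircuit z hz L H ε' σ).toUnitary O (ket (0, false, false) z) =
      counterFourier.symm (∑ c : Fin (k + 1), ((1 / √((k + 1 : ℕ) : ℝ) : ℝ) : ℂ) •
        Circuit.toUnitary O (circuitS z hz L H ε' (σ 0) ++ (List.finRange k).flatMap
          fun s : Fin k => circuitGrover z hz L H ε' (σ s.succ) ((s : ℕ) + 1))
            (ket (c, false, false) z)) := by
  rw [meanCircuit, Circuit.toUnitary_append, List.append_assoc, Circuit.toUnitary_append,
    Circuit.toUnitary_singleton, Circuit.toUnitary_singleton]
  rw [free_toUnitary, free_toUnitary, counterFourier_ket_zero, map_sum]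
  simp only [map_smul]

theorem sum_norm_sq_apply_le {V : Type*} [NormedAddCommGroup V] (Ψ Ψ' : JointSpace (Ancilla k) V)
    (R : Finset (Fin (k + 1))) :
    ∑ y ∈ R, ∑ b, ‖Ψ (y, b)‖ ^ 2 ≤
      11 / 10 * (∑ y ∈ R, ∑ b, ‖Ψ' (y, b)‖ ^ 2) + 11 * ‖Ψ - Ψ'‖ ^ 2 := by
  have hsplit : ∀ y b, ‖Ψ (y, b)‖ ^ 2 ≤ 11 / 10 * ‖Ψ' (y, b)‖ ^ 2 + 11 * ‖(Ψ - Ψ') (y, b)‖ ^ 2 := by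
    intro y b
    have h1 : ‖Ψ (y, b)‖ ≤ ‖Ψ' (y, b)‖ + ‖(Ψ - Ψ') (y, b)‖ := by
      rw [PiLp.sub_apply]
      exact norm_le_norm_add_norm_sub' _ _
    have h2 := pow_le_pow_left₀ (norm_nonneg _) h1 2
    nlinarith [sq_nonneg (‖Ψ' (y, b)‖ - 10 * ‖(Ψ - Ψ') (y, b)‖)]
  have hrest : ∑ y ∈ R, ∑ b, ‖(Ψ - Ψ') (y, b)‖ ^ 2 ≤ ‖Ψ - Ψ'‖ ^ 2 := by
    rw [PiLp.norm_sq_eq_of_L2, Fintype.sum_prod_type]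
    exact Finset.sum_le_univ_sum_of_nonneg fun y => Finset.sum_nonneg fun b _ => sq_nonneg _
  calc ∑ y ∈ R, ∑ b, ‖Ψ (y, b)‖ ^ 2
      ≤ ∑ y ∈ R, ∑ b, (11 / 10 * ‖Ψ' (y, b)‖ ^ 2 + 11 * ‖(Ψ - Ψ') (y, b)‖ ^ 2) :=
        Finset.sum_le_sum fun y _ => Finset.sum_le_sum fun b _ => hsplit y b
    _ = 11 / 10 * (∑ y ∈ R, ∑ b, ‖Ψ' (y, b)‖ ^ 2) +
        11 * ∑ y ∈ R, ∑ b, ‖(Ψ - Ψ') (y, b)‖ ^ 2 := by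
        simp only [Finset.sum_add_distrib, Finset.mul_sum]
    _ ≤ _ := by linarith

theorem outcomeProbability_eq {L H ε' : ℝ} {z : Register 𝒦 E} (hz : ‖z‖ = 1)
    (O : Fin T → (Register 𝒦 E ≃ₗᵢ[ℂ] Register 𝒦 E)) (σ : Fin (k + 1) → Fin T)
    (y : Fin (k + 1)) :
    outcomeProbability z hz L H ε' σ O y =
      ∑ b, ‖(meanCircuit z hz L H ε' σ).toUnitary O (ket (0, false, false) z) (y, b)‖ ^ 2 := rfl

theorem sum_outcomeProbability_le {L H ε' : ℝ} (h0 : 0 < ε') (h2 : ε' < 2) {z : Register 𝒦 E}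
    (hz : ‖z‖ = 1) {O : Fin T → (Register 𝒦 E ≃ₗᵢ[ℂ] Register 𝒦 E)} (σ : Fin (k + 1) → Fin T)
    {p θ : Fin (k + 1) → ℝ} (hp : ∀ s, rotationWeight L H (O (σ s) z) = p s) (hp0 : ∀ s, 0 ≤ p s)
    (hp1 : ∀ s, p s ≤ 1) (hθ : ∀ s, p s * Real.cos (θ s) = (1 - p s) * Real.sin (θ s))
    (R : Finset (Fin (k + 1))) :
    ∑ y ∈ R, outcomeProbability z hz L H ε' σ O y ≤
      11 / 20 * ((∑ y ∈ R, ‖invFourier (fun j => Complex.exp ((totalAngle θ j : ℝ) * Complex.I)) y‖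
        ^ 2) + ∑ y ∈ R, ‖invFourier (fun j => Complex.exp ((-totalAngle θ j : ℝ) * Complex.I)) y‖
          ^ 2) / (k + 1 : ℕ) + 176 * ((k + 1 : ℕ) : ℝ) ^ 3 * ε' ^ 2 := by
  obtain ⟨ω, hω, hpre⟩ := norm_prefix_sub_le h0 h2 hz σ hp hp0 hp1 hθ
  have hM : (0 : ℝ) < (k + 1 : ℕ) := by positivity
  have hq0 : 0 ≤ 1 / √((k + 1 : ℕ) : ℝ) := by positivity
  have hq2 : (1 / √((k + 1 : ℕ) : ℝ)) ^ 2 = 1 / (k + 1 : ℕ) := by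
    rw [div_pow, Real.sq_sqrt hM.le, one_pow]
  have herr : ‖(meanCircuit z hz L H ε' σ).toUnitary O (ket (0, false, false) z) -
      counterFourier.symm (∑ c : Fin (k + 1), ((1 / √((k + 1 : ℕ) : ℝ) : ℝ) : ℂ) • ω •
        tiltedKet z (totalAngle θ c) c)‖ ^ 2 ≤ 16 * ((k + 1 : ℕ) : ℝ) ^ 3 * ε' ^ 2 := by
    rw [meanCircuit_toUnitary_ket, ← map_sub, LinearIsometryEquiv.norm_map,
      ← Finset.sum_sub_distrib]
    -- With M = k+1, the triangle inequality adds M branches of weight M^(-1/2) and error 4Mε'. The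
    -- squared error is therefore at most 16M³ε'².
    have h1 := norm_sum_le_of_le Finset.univ fun c _ =>
      (norm_smul_le ((1 / √((k + 1 : ℕ) : ℝ) : ℝ) : ℂ) (Circuit.toUnitary O
        (circuitS z hz L H ε' (σ 0) ++ (List.finRange k).flatMap
          fun s : Fin k => circuitGrover z hz L H ε' (σ s.succ) ((s : ℕ) + 1))
            (ket (c, false, false) z) - ω • tiltedKet z (totalAngle θ c) c)).trans
        (mul_le_mul_of_nonneg_left (hpre c) (norm_nonneg _))
    simp only [smul_sub] at h1
    rw [Finset.sum_const, Finset.card_univ, Fintype.card_fin, nsmul_eq_mul, Complex.norm_real,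
      Real.norm_of_nonneg hq0] at h1
    refine (pow_le_pow_left₀ (norm_nonneg _) h1 2).trans (le_of_eq ?_)
    rw [mul_pow, mul_pow, hq2]
    field_simp
    ring
  simp only [outcomeProbability_eq]
  refine (sum_norm_sq_apply_le _ (counterFourier.symm (∑ c : Fin (k + 1),
    ((1 / √((k + 1 : ℕ) : ℝ) : ℝ) : ℂ) • ω • tiltedKet z (totalAngle θ c) c)) R).trans ?_
  simp only [sum_norm_sq_idealOutcome hz hω, norm_sq_add_norm_sq_exp, ← Finset.sum_div,
    Finset.sum_add_distrib]
  refine add_le_add (le_of_eq ?_) (by linarith)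
  ring

theorem sum_outcomeProbability {L H ε' : ℝ} {z : Register 𝒦 E} (hz : ‖z‖ = 1)
    (O : Fin T → (Register 𝒦 E ≃ₗᵢ[ℂ] Register 𝒦 E)) (σ : Fin (k + 1) → Fin T) :
    ∑ y, outcomeProbability z hz L H ε' σ O y = 1 := by
  have h : ‖(meanCircuit z hz L H ε' σ).toUnitary O (ket (0, false, false) z)‖ ^ 2 = 1 := by
    rw [LinearIsometryEquiv.norm_map, norm_ket hz, one_pow]
  rw [PiLp.norm_sq_eq_of_L2, Fintype.sum_prod_type] at h
  simpa only [outcomeProbability_eq] using h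

end Outcome

/-! ### Encoded probabilities and the estimate of the mean -/

section Encoding

variable {𝒦 : Type*} [NormedAddCommGroup 𝒦] [InnerProductSpace ℂ 𝒦] {E : Finset ℝ}

theorem massAt_nonneg {Ω : Type*} [Fintype Ω] (P : PMF Ω) (X : Ω → ℝ) (x : ℝ) :
    0 ≤ massAt P X x :=
  Finset.sum_nonneg fun ω _ => by split_ifs <;> simp

theorem sum_massAt_mul {Ω : Type*} [Fintype Ω] (P : PMF Ω) (X : Ω → ℝ) (E : Finset ℝ)
    (g : ℝ → ℝ) :
    ∑ x : E, massAt P X x * g x = ∑ ω, if X ω ∈ E then (P ω).toReal * g (X ω) else 0 := by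
  simp only [massAt, Finset.sum_mul]
  rw [Finset.sum_comm]
  refine Finset.sum_congr rfl fun ω _ => ?_
  rw [Finset.sum_coe_sort E fun x => (if X ω = x then (P ω).toReal else 0) * g x]
  simp only [ite_mul, zero_mul]
  rw [Finset.sum_ite_eq]

theorem sum_toReal_eq_one {Ω : Type*} [Fintype Ω] (P : PMF Ω) : ∑ ω, (P ω).toReal = 1 := by
  rw [← ENNReal.toReal_sum fun ω _ => P.apply_ne_top ω, ← tsum_fintype (L := .unconditional _),
    P.tsum_coe, ENNReal.toReal_one]

/-- The encoding constrains only the values in E. Since O z has norm 1, the masses over E already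
sum to 1, so no mass lies outside E. On [L,H] the truncation is inactive and the weight is affine in
the value. -/
theorem rotationWeight_eq {z : Register 𝒦 E} (hz : ‖z‖ = 1)
    {O : Register 𝒦 E ≃ₗᵢ[ℂ] Register 𝒦 E} {Ω : Type*} [Fintype Ω] {P : PMF Ω} {X : Ω → ℝ}
    (hO : IsQuantumRandomVariable z O P X) {L H : ℝ} (hLH : L < H)
    (hX : ∀ ω ∈ P.support, X ω ∈ Set.Icc L H) :
    rotationWeight L H (O z) = (expectedValue P X - L) / (H - L) := by
  obtain ⟨ψ, hψ, hO⟩ := hO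
  have hsq : ∀ x : E, ‖O z x‖ ^ 2 = massAt P X x := fun x => by
    rw [hO, norm_smul, hψ, mul_one, Complex.norm_real, Real.norm_of_nonneg (Real.sqrt_nonneg _),
      Real.sq_sqrt (massAt_nonneg P X x)]
  have htot : ∑ ω, (if X ω ∈ E then (P ω).toReal else 0) = 1 := by
    have h := sum_massAt_mul P X E fun _ => 1
    simp only [mul_one] at h
    rw [← h, ← Finset.sum_congr rfl fun x _ => hsq x, ← PiLp.norm_sq_eq_of_L2,
      LinearIsometryEquiv.norm_map, hz, one_pow]
  have hmem : ∀ ω, X ω ∉ E → (P ω).toReal = 0 := by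
    have h0 : ∑ ω, ((P ω).toReal - if X ω ∈ E then (P ω).toReal else 0) = 0 := by
      rw [Finset.sum_sub_distrib, htot, sum_toReal_eq_one, sub_self]
    rw [Finset.sum_eq_zero_iff_of_nonneg fun ω _ => by split_ifs <;> simp] at h0
    intro ω hω
    simpa [hω] using h0 ω (Finset.mem_univ _)
  have hD : 0 < H - L := sub_pos.2 hLH
  rw [rotationWeight, Finset.sum_congr rfl fun x _ => by rw [hsq x],
    sum_massAt_mul P X E fun x => clampUnit ((x - L) / (H - L))]
  have hterm : ∀ ω, (if X ω ∈ E then (P ω).toReal * clampUnit ((X ω - L) / (H - L)) else 0) =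
      (P ω).toReal * X ω / (H - L) - (P ω).toReal * (L / (H - L)) := by
    intro ω
    by_cases h : X ω ∈ E
    · rw [if_pos h]
      by_cases hs : ω ∈ P.support
      · obtain ⟨h1, h2⟩ := hX ω hs
        have h3 : clampUnit ((X ω - L) / (H - L)) = (X ω - L) / (H - L) := by
          rw [clampUnit, min_eq_right ((div_le_one hD).2 (by linarith)),
            max_eq_right (div_nonneg (by linarith) hD.le)]
        rw [h3]; ring
      · rw [PMF.mem_support_iff, not_not] at hs
        simp [hs]
    · rw [if_neg h, hmem ω h]; simp
  rw [Finset.sum_congr rfl fun ω _ => hterm ω, Finset.sum_sub_distrib, ← Finset.sum_mul,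
    ← Finset.sum_div, sum_toReal_eq_one, expectedValue]
  ring

end Encoding

/-! ### Comparison of angles with means, and the classical postprocessing -/

section Estimate

/-- The relation on p says (s, c) = N(p, 1-p) with N = s+c, and the unit norm gives N²(p²+(1-p)²) =
1. The cross product of two such vectors is NN'(p-q). -/
theorem cross_sq_mul {s c s' c' p q : ℝ} (h : s ^ 2 + c ^ 2 = 1) (h' : s' ^ 2 + c' ^ 2 = 1)
    (hp : p * c = (1 - p) * s) (hq : q * c' = (1 - q) * s') :
    (s * c' - c * s') ^ 2 * ((p ^ 2 + (1 - p) ^ 2) * (q ^ 2 + (1 - q) ^ 2)) = (p - q) ^ 2 := by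
  have hs : s = p * (s + c) := by linarith
  have hc : c = (1 - p) * (s + c) := by linarith
  have hs' : s' = q * (s' + c') := by linarith
  have hc' : c' = (1 - q) * (s' + c') := by linarith
  have hN : (s + c) ^ 2 * (p ^ 2 + (1 - p) ^ 2) = 1 := by
    linear_combination h - (s + p * (s + c)) * hs - (c + (1 - p) * (s + c)) * hc
  have hN' : (s' + c') ^ 2 * (q ^ 2 + (1 - q) ^ 2) = 1 := by
    linear_combination h' - (s' + q * (s' + c')) * hs' - (c' + (1 - q) * (s' + c')) * hc'
  have hcross : s * c' - c * s' = (s + c) * (s' + c') * (p - q) := by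
    linear_combination (s' + c') * (1 - q) * hs - (s' + c') * q * hc + s * hc' - c * hs'
  rw [hcross]
  linear_combination (p - q) ^ 2 * ((s' + c') ^ 2 * (q ^ 2 + (1 - q) ^ 2)) * hN + (p - q) ^ 2 * hN'

/-- Used with u = |p-q|. Up to the constant, u²/(ρ+2u) is smallest at u = e, where 2u is negligible
beside ρ ≥ 1/2. The constant is just above (1999/2000)². -/
theorem sq_mul_le_of_far {e u ρ ρ' : ℝ} (he : 0 < e) (he1 : e ≤ 1 / 10000) (hu : e ≤ u)
    (hρ : 1 / 2 ≤ ρ) (hρ' : ρ' ≤ ρ + 2 * u) :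
    999001 / 1000000 * e ^ 2 * ρ' ≤ u ^ 2 * ρ := by
  obtain ⟨d, rfl⟩ : ∃ d, u = e + d := ⟨u - e, by ring⟩
  have hd : 0 ≤ d := by linarith
  have h1 : 999001 / 1000000 * e ^ 2 * ρ' ≤ 999001 / 1000000 * e ^ 2 * (ρ + 2 * (e + d)) :=
    mul_le_mul_of_nonneg_left hρ' (by positivity)
  have h2 : d * (2 * e + d) * (1 / 2) ≤ d * (2 * e + d) * ρ :=
    mul_le_mul_of_nonneg_left hρ (by positivity)
  have h3 : e ^ 2 * (1 / 2) ≤ e ^ 2 * ρ := mul_le_mul_of_nonneg_left hρ (by positivity)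
  have h4 : e ^ 2 * e ≤ e ^ 2 * (1 / 10000) := mul_le_mul_of_nonneg_left he1 (by positivity)
  have h5 : (e * d) * e ≤ (e * d) * (1 / 10000) := mul_le_mul_of_nonneg_left he1 (by positivity)
  have h6 : 0 ≤ e * d := by positivity
  have h7 : 0 ≤ d ^ 2 := by positivity
  have h8 : 0 ≤ e ^ 2 := by positivity
  linarith

theorem sq_mul_le_of_near {e u ρ ρ' : ℝ} (he1 : e ≤ 1 / 10000) (hu0 : 0 ≤ u)
    (hu : u ≤ e / 2) (hρ : 1 / 2 ≤ ρ) (hρ' : ρ - 2 * u ≤ ρ') :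
    4 * (u ^ 2 * ρ) ≤ 1002001 / 1000000 * e ^ 2 * ρ' := by
  have h1 : ρ ≤ 1002001 / 1000000 * ρ' := by linarith
  have h2 : (2 * u) ^ 2 ≤ e ^ 2 := pow_le_pow_left₀ (by positivity) (by linarith) 2
  calc 4 * (u ^ 2 * ρ) = (2 * u) ^ 2 * ρ := by ring
    _ ≤ e ^ 2 * ρ := mul_le_mul_of_nonneg_right h2 (by linarith)
    _ ≤ e ^ 2 * (1002001 / 1000000 * ρ') := mul_le_mul_of_nonneg_left h1 (sq_nonneg e)
    _ = _ := by ring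

theorem abs_sq_sum_sub_le {p q : ℝ} (hp0 : 0 ≤ p) (hp1 : p ≤ 1) (hq0 : 0 ≤ q) (hq1 : q ≤ 1) :
    |(p ^ 2 + (1 - p) ^ 2) - (q ^ 2 + (1 - q) ^ 2)| ≤ 2 * |p - q| := by
  rw [show (p ^ 2 + (1 - p) ^ 2) - (q ^ 2 + (1 - q) ^ 2) = 2 * (p + q - 1) * (p - q) by ring,
    abs_mul]
  exact mul_le_mul_of_nonneg_right (abs_le.2 ⟨by linarith, by linarith⟩) (abs_nonneg _)

theorem half_le_sq_sum (p : ℝ) : 1 / 2 ≤ p ^ 2 + (1 - p) ^ 2 := by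
  nlinarith [sq_nonneg (2 * p - 1)]

theorem cross_ge_of_far {s c s' c' p q e : ℝ} (h : s ^ 2 + c ^ 2 = 1) (h' : s' ^ 2 + c' ^ 2 = 1)
    (hp : p * c = (1 - p) * s) (hq : q * c' = (1 - q) * s') (hp0 : 0 ≤ p) (hp1 : p ≤ 1)
    (hq0 : 0 ≤ q) (hq1 : q ≤ 1) (he : 0 < e) (he1 : e ≤ 1 / 10000) (hpq : e ≤ |p - q|) :
    1999 / 1000 * (e / (q ^ 2 + (1 - q) ^ 2)) ≤ 2 * |s * c' - c * s'| := by
  have hcr := cross_sq_mul h h' hp hq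
  have hle := (abs_le.1 (abs_sq_sum_sub_le hp0 hp1 hq0 hq1)).2
  have hρ := half_le_sq_sum q
  have hρ' := half_le_sq_sum p
  generalize q ^ 2 + (1 - q) ^ 2 = ρ at *
  generalize p ^ 2 + (1 - p) ^ 2 = ρ' at *
  have key := sq_mul_le_of_far he he1 hpq hρ (ρ' := ρ') (by linarith)
  rw [sq_abs, ← hcr] at key
  have hsq : (1999 / 1000 * (e / ρ)) ^ 2 ≤ (2 * |s * c' - c * s'|) ^ 2 := by
    rw [mul_pow, mul_pow, sq_abs, div_pow e, mul_div_assoc', div_le_iff₀ (by positivity)]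
    refine le_of_mul_le_mul_right ?_ (by linarith : 0 < ρ')
    have : 0 ≤ e ^ 2 * ρ' := by positivity
    linarith
  exact (pow_le_pow_iff_left₀ (by positivity) (by positivity) two_ne_zero).1 hsq

theorem cross_le_of_near {s c s' c' p q e : ℝ} (h : s ^ 2 + c ^ 2 = 1) (h' : s' ^ 2 + c' ^ 2 = 1)
    (hp : p * c = (1 - p) * s) (hq : q * c' = (1 - q) * s') (hp0 : 0 ≤ p) (hp1 : p ≤ 1)
    (hq0 : 0 ≤ q) (hq1 : q ≤ 1) (he : 0 < e) (he1 : e ≤ 1 / 10000) (hpq : |p - q| ≤ e / 2) :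
    2 * |s * c' - c * s'| ≤ 1001 / 1000 * (e / (q ^ 2 + (1 - q) ^ 2)) := by
  have hcr := cross_sq_mul h h' hp hq
  have hle := (abs_le.1 (abs_sq_sum_sub_le hp0 hp1 hq0 hq1)).1
  have hρ := half_le_sq_sum q
  have hρ' := half_le_sq_sum p
  generalize q ^ 2 + (1 - q) ^ 2 = ρ at *
  generalize p ^ 2 + (1 - p) ^ 2 = ρ' at *
  have key := sq_mul_le_of_near he1 (abs_nonneg _) hpq hρ (ρ' := ρ') (by linarith)
  rw [sq_abs, ← hcr] at key
  have hsq : (2 * |s * c' - c * s'|) ^ 2 ≤ (1001 / 1000 * (e / ρ)) ^ 2 := by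
    rw [mul_pow, mul_pow, sq_abs, div_pow e, mul_div_assoc', le_div_iff₀ (by positivity)]
    refine le_of_mul_le_mul_right ?_ (by linarith : 0 < ρ')
    linarith
  exact (pow_le_pow_iff_left₀ (by positivity) (by positivity) two_ne_zero).1 hsq

/-- The angle of the good amplitude when the mean is `p`. -/
noncomputable def meanAngle (p : ℝ) : ℝ := Real.arctan (p / (1 - p))

theorem meanAngle_spec {p : ℝ} (hp1 : p < 1) :
    p * Real.cos (meanAngle p) = (1 - p) * Real.sin (meanAngle p) := by
  have h1 : 1 - p ≠ 0 := by linarith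
  have hc : Real.cos (meanAngle p) ≠ 0 := (Real.cos_arctan_pos _).ne'
  have ht := Real.tan_arctan (p / (1 - p))
  rw [← meanAngle, Real.tan_eq_sin_div_cos, div_eq_div_iff hc h1] at ht
  linarith

/-- With s = |sin α| and c = |cos α| the fraction is (s² - sc)/(s² - c²) = s/(s+c). This inverts tan
θ = p/(1-p), and it equals 1/2 in the exceptional case s = c. -/
theorem meanEstimate_sin_sq (L H α : ℝ) :
    ∃ p, 0 ≤ p ∧ p ≤ 1 ∧ p * |Real.cos α| = (1 - p) * |Real.sin α| ∧
      meanEstimate L H (Real.sin α ^ 2) = p * (H - L) + L := by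
  set s := |Real.sin α| with hs
  set c := |Real.cos α| with hc
  have hs0 : 0 ≤ s := abs_nonneg _
  have hc0 : 0 ≤ c := abs_nonneg _
  have hsc : s ^ 2 + c ^ 2 = 1 := by rw [hs, hc, sq_abs, sq_abs, Real.sin_sq_add_cos_sq]
  have hN : 0 < s + c := by nlinarith
  refine ⟨s / (s + c), by positivity, (div_le_one hN).2 (by linarith), by field_simp; ring, ?_⟩
  rw [meanEstimate, ← sq_abs, ← hs]
  congr 2
  have hsqrt : √(s ^ 2 * (1 - s ^ 2)) = s * c := by
    rw [show s ^ 2 * (1 - s ^ 2) = (s * c) ^ 2 by rw [← hsc]; ring, Real.sqrt_sq (by positivity)]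
  rw [hsqrt]
  split_ifs with h
  · have : s = c := by nlinarith [sq_nonneg (s - c), sq_nonneg (s + c)]
    rw [← this, div_eq_div_iff two_ne_zero (by linarith)]; ring
  · have h1 : 2 * s ^ 2 - 1 ≠ 0 := fun h' => h (by linarith)
    rw [div_eq_div_iff h1 hN.ne', ← hsc]; ring

/-- The estimate sees α only through |sin α| and |cos α|. An outcome whose estimate is far off is
thus far from both frequencies θ and -θ. -/
theorem abs_cross_abs_le (α θ : ℝ) (hs : 0 ≤ Real.sin θ) (hc : 0 ≤ Real.cos θ) :
    |(|Real.sin α|) * Real.cos θ - |Real.cos α| * Real.sin θ| ≤ |Real.sin (α - θ)| ∧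
      |(|Real.sin α|) * Real.cos θ - |Real.cos α| * Real.sin θ| ≤ |Real.sin (α + θ)| := by
  have h1 : (|Real.sin α|) * Real.cos θ = |Real.sin α * Real.cos θ| := by
    rw [abs_mul, abs_of_nonneg hc]
  have h2 : (|Real.cos α|) * Real.sin θ = |Real.cos α * Real.sin θ| := by
    rw [abs_mul, abs_of_nonneg hs]
  rw [h1, h2, Real.sin_sub, Real.sin_add]
  refine ⟨abs_abs_sub_abs_le_abs_sub _ _, ?_⟩
  have := abs_abs_sub_abs_le_abs_sub (Real.sin α * Real.cos θ) (-(Real.cos α * Real.sin θ))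
  rwa [abs_neg, sub_neg_eq_add] at this

end Estimate

/-! ### Counting the quantum experiments -/

section Counting

variable {𝒦 : Type*} [NormedAddCommGroup 𝒦] [InnerProductSpace ℂ 𝒦] {E : Finset ℝ}
  {T k : ℕ}

theorem countP_adjoint {A 𝓗 : Type*} [Fintype A] [NormedAddCommGroup 𝓗] [InnerProductSpace ℂ 𝓗]
    {q : Gate A 𝓗 T → Bool} (hq : ∀ g, q g.adjoint = q g) (C : Circuit A 𝓗 T) :
    C.adjoint.countP q = C.countP q := by
  rw [Circuit.adjoint, List.countP_reverse, List.countP_map]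
  congr 1
  exact funext hq

variable {q : Gate (Ancilla k) (Register 𝒦 E) T → Bool} {r : Fin T → Bool}

/-- The counts are made for any predicate that sees only the oracle index. They then apply to the
total number and to a single oracle. -/
theorem countP_circuitV (hfree : ∀ W, q (.free W) = false)
    (hexp : ∀ i inv c, q (.experiment i inv c) = r i) (L H : ℝ) (i : Fin T) :
    (circuitV L H i).countP q = if r i then 2 else 0 := by
  have hq : ∀ g, q (Gate.adjoint g) = q g := by
    rintro (W | ⟨i, inv, c⟩)
    · rw [Gate.adjoint, hfree, hfree]
    · rw [Gate.adjoint, hexp, hexp]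
  have hU : (circuitU (𝒦 := 𝒦) (E := E) (k := k) L H i).countP q = if r i then 1 else 0 := by
    rw [circuitU]
    cases h : r i <;> simp [hfree, hexp, h]
  rw [circuitV, List.countP_append, List.countP_append, countP_adjoint hq, hU]
  cases h : r i <;> simp [hfree]

theorem countP_circuitS (hfree : ∀ W, q (.free W) = false)
    (hexp : ∀ i inv c, q (.experiment i inv c) = r i) (z : Register 𝒦 E) (hz : ‖z‖ = 1)
    (L H ε' : ℝ) (i : Fin T) :
    (circuitS z hz L H ε' i).countP q =
      if r i then 2 * (2 * fixIterations ε' + 1) else 0 := by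
  have hq : ∀ g, q (Gate.adjoint g) = q g := by
    rintro (W | ⟨i, inv, c⟩)
    · rw [Gate.adjoint, hfree, hfree]
    · rw [Gate.adjoint, hexp, hexp]
  have hV := countP_circuitV hfree hexp L H i
  rw [circuitS, List.countP_append, hV, List.countP_flatMap]
  simp only [Function.comp_def, List.countP_append, countP_adjoint hq, hV]
  cases h : r i
  · simp [phaseGate, hfree]
  · simp [phaseGate, hfree]; ring

theorem countP_circuitGrover (hfree : ∀ W, q (.free W) = false)
    (hexp : ∀ i inv c, q (.experiment i inv c) = r i) (z : Register 𝒦 E) (hz : ‖z‖ = 1)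
    (L H ε' : ℝ) (i : Fin T) (s : ℕ) :
    (circuitGrover z hz L H ε' i s).countP q =
      2 * if r i then 2 * (2 * fixIterations ε' + 1) else 0 := by
  have hq : ∀ g, q (Gate.adjoint g) = q g := by
    rintro (W | ⟨i, inv, c⟩)
    · rw [Gate.adjoint, hfree, hfree]
    · rw [Gate.adjoint, hexp, hexp]
  have hS := countP_circuitS hfree hexp z hz L H ε' i
  simp only [circuitGrover, List.countP_append, countP_adjoint hq, hS]
  simp only [phaseGate, signGate, List.countP_singleton, hfree, Bool.false_eq_true, if_false]
  ring

theorem countP_meanCircuit (hfree : ∀ W, q (.free W) = false)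
    (hexp : ∀ i inv c, q (.experiment i inv c) = r i) (z : Register 𝒦 E) (hz : ‖z‖ = 1)
    (L H ε' : ℝ) (σ : Fin (k + 1) → Fin T) :
    (meanCircuit z hz L H ε' σ).countP q =
      (if r (σ 0) then 2 * (2 * fixIterations ε' + 1) else 0) +
        ∑ s : Fin k, 2 * if r (σ s.succ) then 2 * (2 * fixIterations ε' + 1) else 0 := by
  rw [meanCircuit, List.countP_append, List.countP_append, List.countP_append,
    countP_circuitS hfree hexp, List.countP_flatMap, Fin.sum_univ_def]
  simp only [Function.comp_def, countP_circuitGrover hfree hexp]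
  simp [hfree]

theorem experiments_meanCircuit (z : Register 𝒦 E) (hz : ‖z‖ = 1)
    (L H ε' : ℝ) (σ : Fin (k + 1) → Fin T) :
    (meanCircuit z hz L H ε' σ).experiments = 2 * (2 * fixIterations ε' + 1) * (2 * k + 1) := by
  rw [Circuit.experiments, countP_meanCircuit (r := fun _ => true) (fun _ => rfl)
    (fun _ _ _ => rfl)]
  simp; ring

/-- By injectivity an oracle occurs in at most one place, at worst in a Grover iteration, which runs
a search and its inverse. -/
theorem experimentsOn_meanCircuit_le (z : Register 𝒦 E) (hz : ‖z‖ = 1)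
    (L H ε' : ℝ) (σ : Fin (k + 1) → Fin T) (hσ : Function.Injective σ) (i : Fin T) :
    (meanCircuit z hz L H ε' σ).experimentsOn i ≤ 4 * (2 * fixIterations ε' + 1) := by
  rw [Circuit.experimentsOn, countP_meanCircuit (r := fun j => decide (j = i)) (fun _ => rfl)
    (fun _ _ _ => rfl)]
  set N := 2 * (2 * fixIterations ε' + 1) with hN
  have h : ∑ s : Fin (k + 1), (if decide (σ s = i) = true then N else 0) ≤ N := by
    by_cases hi : ∃ s, σ s = i
    · obtain ⟨s, rfl⟩ := hi
      rw [Finset.sum_eq_single s]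
      · simp
      · intro s' _ hs'
        simp [hσ.ne hs']
      · simp
    · rw [Finset.sum_eq_zero]
      · exact Nat.zero_le _
      · intro s _
        simpa using fun h => absurd ⟨s, h⟩ hi
  rw [Fin.sum_univ_succ] at h
  rw [← Finset.mul_sum]
  omega

end Counting

/-! ### Success probability and the main theorem -/

section Success

variable {𝒦 : Type*} [NormedAddCommGroup 𝒦] [InnerProductSpace ℂ 𝒦] {E : Finset ℝ}
  {T k : ℕ}

theorem sin_meanAngle_nonneg {p : ℝ} (hp0 : 0 ≤ p) (hp1 : p < 1) : 0 ≤ Real.sin (meanAngle p) := by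
  rw [meanAngle, Real.sin_arctan]
  have : 0 < 1 - p := by linarith
  positivity

/-- The energy of the ideal signal outside the accepted frequencies. -/
theorem sum_norm_sq_rejected_le {e ϑ : ℝ} {Θ θ : Fin (k + 1) → ℝ}
    (hΘ : ∀ j : Fin k, Θ j.succ = Θ j.castSucc + 2 * θ j.succ) {ρ : ℝ} (he : 0 < e) (he1 : e ≤ 1)
    (hρ0 : 0 < ρ) (hρ1 : ρ ≤ 1) (hθ : ∀ j, 2 * |Real.sin (θ j - ϑ)| ≤ 1001 / 1000 * (e / ρ))
    (R : Finset (Fin (k + 1)))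
    (hR : ∀ y ∈ R, 1999 / 1000 * (e / ρ) ≤
      2 * |Real.sin (Real.pi * (y : ℕ) / (k + 1 : ℕ) - ϑ)|) :
    ∑ y ∈ R, ‖invFourier (fun j => Complex.exp ((Θ j : ℝ) * Complex.I)) y‖ ^ 2 ≤
      11 / 10 * ((k + 1 : ℕ) * (1002 / 1999) ^ 2) + 22 * (1001 / e) := by
  -- The ramp slope 1/n is at most e/1000, which raises 1001 to 1002 in the ratio. Its length is
  -- small beside the counter dimension, later at least 10⁷/e.
  set n := ⌈1000 / e⌉₊ with hn
  have hn1 : 1000 / e ≤ n := Nat.le_ceil _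
  have hn2 : (n : ℝ) ≤ 1001 / e := by
    have h1 : (n : ℝ) < 1000 / e + 1 := Nat.ceil_lt_add_one (by positivity)
    have h2 : 1 ≤ 1 / e := (one_le_div he).2 he1
    have h3 : 1001 / e = 1000 / e + 1 / e := by ring
    linarith
  have hn0 : 0 < n := Nat.ceil_pos.2 (by positivity)
  have hn0' : (0 : ℝ) < n := by exact_mod_cast hn0
  have heρ : e ≤ e / ρ := (le_div_iff₀ hρ0).2 (by nlinarith)
  have hinv : 1 / (n : ℝ) ≤ 1 / 1000 * (e / ρ) := by
    have h1 : 1 / (n : ℝ) ≤ e / 1000 := by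
      rw [div_le_iff₀ hn0']
      rw [div_le_iff₀ he] at hn1
      linarith
    linarith
  have hquot : (1001 / 1000 * (e / ρ) + 1 / n) / (1999 / 1000 * (e / ρ)) ≤ 1002 / 1999 := by
    rw [div_le_iff₀ (by positivity)]
    linarith
  have key := sum_norm_sq_invFourier_le (θ := ϑ) (κ := 1001 / 1000 * (e / ρ))
    (K := 1999 / 1000 * (e / ρ)) (fun j => Complex.exp ((Θ j : ℝ) * Complex.I))
    (fun j => Complex.norm_exp_ofReal_mul_I _) (by positivity) (by positivity) hn0
    (fun j => by
      rw [← Complex.exp_add, ← add_mul, ← Complex.ofReal_add, norm_exp_sub_exp, hΘ]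
      convert hθ j.succ using 4
      ring) R hR
  refine key.trans (add_le_add ?_ (by linarith))
  have h0 : 0 ≤ (1001 / 1000 * (e / ρ) + 1 / n) / (1999 / 1000 * (e / ρ)) := by positivity
  gcongr

theorem abs_meanEstimate_sub {L H μ : ℝ} (hLH : L < H) (p : ℝ) :
    |p * (H - L) + L - μ| = |p - (μ - L) / (H - L)| * (H - L) := by
  have hD : 0 < H - L := sub_pos.2 hLH
  nth_rewrite 3 [← abs_of_pos hD]
  rw [← abs_mul, sub_mul, div_mul_cancel₀ _ hD.ne']
  congr 1; ring

/-- A rejected outcome corresponds to a mean parameter more than ε/(H-L) from the true one. The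
chord estimate and the folding of α give the distance to both signal frequencies. -/
theorem far_of_rejected {L H μ ε : ℝ} (hLH : L < H) (hε : 0 < ε)
    (he1 : ε / (H - L) ≤ 1 / 10000) (hq0 : 0 ≤ (μ - L) / (H - L)) (hq1 : (μ - L) / (H - L) < 1)
    {y : Fin (k + 1)} (hy : ¬|meanEstimate L H (amplitudeEstimate k y) - μ| ≤ ε) :
    1999 / 1000 * (ε / (H - L) / (((μ - L) / (H - L)) ^ 2 + (1 - (μ - L) / (H - L)) ^ 2)) ≤
        2 * |Real.sin (Real.pi * (y : ℕ) / (k + 1 : ℕ) - meanAngle ((μ - L) / (H - L)))| ∧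
      1999 / 1000 * (ε / (H - L) / (((μ - L) / (H - L)) ^ 2 + (1 - (μ - L) / (H - L)) ^ 2)) ≤
        2 * |Real.sin (Real.pi * (y : ℕ) / (k + 1 : ℕ) - -meanAngle ((μ - L) / (H - L)))| := by
  have hD : 0 < H - L := sub_pos.2 hLH
  set α := Real.pi * (y : ℕ) / (k + 1 : ℕ) with hα
  obtain ⟨p, hp0, hp1, hp, hest⟩ := meanEstimate_sin_sq L H α
  rw [amplitudeEstimate, ← hα, hest, abs_meanEstimate_sub hLH, ← le_div_iff₀ hD, not_le] at hy
  have hfar := cross_ge_of_far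
    (by rw [sq_abs, sq_abs, Real.sin_sq_add_cos_sq]) (Real.sin_sq_add_cos_sq _) hp
    (meanAngle_spec hq1) hp0 hp1 hq0 hq1.le (by positivity) he1 hy.le
  obtain ⟨h1, h2⟩ := abs_cross_abs_le α (meanAngle ((μ - L) / (H - L)))
    (sin_meanAngle_nonneg hq0 hq1) (Real.cos_arctan_pos _).le
  rw [sub_neg_eq_add]
  constructor <;> linarith

theorem two_thirds_le_successProbability {z : Register 𝒦 E} (hz : ‖z‖ = 1)
    {O : Fin T → (Register 𝒦 E ≃ₗᵢ[ℂ] Register 𝒦 E)} (σ : Fin (k + 1) → Fin T)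
    {L H μ ε : ℝ} (hLH : L < H) (hε : 0 < ε) (he1 : ε / (H - L) ≤ 1 / 10000)
    (heq : ε / (H - L) ≤ (μ - L) / (H - L)) (heq1 : ε / (H - L) ≤ 1 - (μ - L) / (H - L))
    (hO : ∀ i, |rotationWeight L H (O i z) - (μ - L) / (H - L)| ≤ ε / (H - L) / 2)
    (hk : 10 ^ 7 * ((H - L) / ε) ≤ (k + 1 : ℕ)) (hk' : ((k + 1 : ℕ) : ℝ) ≤ 2 * 10 ^ 7 * ((H - L) / ε)) :
    2 / 3 ≤ successProbability z hz L H (1 / 10 ^ 14 * (ε / (H - L)) ^ 2) σ O μ ε := by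
  classical
  have hD : 0 < H - L := sub_pos.2 hLH
  have hrecip : (H - L) / ε = 1 / (ε / (H - L)) := by rw [one_div_div]
  rw [hrecip] at hk hk'
  have he : 0 < ε / (H - L) := by positivity
  set e := ε / (H - L) with hedef
  set q := (μ - L) / (H - L) with hq
  have hq0 : 0 < q := by linarith
  have hq1 : q < 1 := by linarith
  set p : Fin (k + 1) → ℝ := fun s => rotationWeight L H (O (σ s) z) with hp
  have hpq : ∀ s, |p s - q| ≤ e / 2 := fun s => hO (σ s)
  have hp0 : ∀ s, 0 ≤ p s := fun s => by have := (abs_le.1 (hpq s)).1; linarith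
  have hp1 : ∀ s, p s < 1 := fun s => by have := (abs_le.1 (hpq s)).2; linarith
  set θ : Fin (k + 1) → ℝ := fun s => meanAngle (p s) with hθ
  have hθspec : ∀ s, p s * Real.cos (θ s) = (1 - p s) * Real.sin (θ s) :=
    fun s => meanAngle_spec (hp1 s)
  set R : Finset (Fin (k + 1)) := Finset.univ.filter
    fun y => ¬|meanEstimate L H (amplitudeEstimate k y) - μ| ≤ ε with hR
  have hnear : ∀ s, 2 * |Real.sin (θ s - meanAngle q)| ≤
      1001 / 1000 * (e / (q ^ 2 + (1 - q) ^ 2)) := fun s => by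
    rw [Real.sin_sub]
    exact cross_le_of_near (Real.sin_sq_add_cos_sq _) (Real.sin_sq_add_cos_sq _) (hθspec s)
      (meanAngle_spec hq1) (hp0 s) (hp1 s).le hq0.le hq1.le he he1 (hpq s)
  have hρ0 : 0 < q ^ 2 + (1 - q) ^ 2 := by positivity
  have hρ1 : q ^ 2 + (1 - q) ^ 2 ≤ 1 := by nlinarith
  have hplus := sum_norm_sq_rejected_le (totalAngle_succ θ) he (by linarith) hρ0 hρ1 hnear R
    (fun y hy => (far_of_rejected hLH hε he1 hq0.le hq1 (Finset.mem_filter.1 hy).2).1)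
  have hminus := sum_norm_sq_rejected_le (ϑ := -meanAngle q) (Θ := fun j => -totalAngle θ j)
    (θ := fun j => -θ j) (fun j => by rw [totalAngle_succ]; ring) he (by linarith) hρ0 hρ1
    (fun s => by
      rw [← neg_sub', Real.sin_neg, abs_neg]; exact hnear s) R
    (fun y hy => (far_of_rejected hLH hε he1 hq0.le hq1 (Finset.mem_filter.1 hy).2).2)
  have hε0 : 0 < 1 / 10 ^ 14 * e ^ 2 := by positivity
  have hε2 : 1 / 10 ^ 14 * e ^ 2 < 2 := by nlinarith
  have hfail := sum_outcomeProbability_le (L := L) (H := H) hε0 hε2 hz (O := O) σ (p := p)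
    (fun s => rfl) hp0 (fun s => (hp1 s).le) hθspec R
  have hsucc : successProbability z hz L H (1 / 10 ^ 14 * e ^ 2) σ O μ ε =
      1 - ∑ y ∈ R, outcomeProbability z hz L H (1 / 10 ^ 14 * e ^ 2) σ O y := by
    refine eq_sub_of_add_eq (Eq.trans ?_ (sum_outcomeProbability (k := k) (L := L) (H := H)
      (ε' := 1 / 10 ^ 14 * e ^ 2) hz O σ))
    rw [successProbability, hR, Finset.sum_filter, ← Finset.sum_add_distrib]
    refine Finset.sum_congr rfl fun y _ => ?_
    by_cases h : |meanEstimate L H (amplitudeEstimate k y) - μ| ≤ ε <;> simp [h]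
  rw [hsucc]
  have hM : (0 : ℝ) < (k + 1 : ℕ) := by positivity
  generalize ((k + 1 : ℕ) : ℝ) = M at *
  have h1 : 22 * (1001 / e) ≤ 22 * 1001 / 10 ^ 7 * M := by
    rw [show 22 * (1001 / e) = 22 * 1001 / 10 ^ 7 * (10 ^ 7 * (1 / e)) by ring]
    exact mul_le_mul_of_nonneg_left hk (by norm_num)
  -- Each sum is at most (1.1·(1002/1999)² + 0.0023)M, so the whole is about 0.307. Together with
  -- the 1/100 for the imperfect searches it stays below 1/3.
  have h2 : 11 / 20 * ((∑ y ∈ R, ‖invFourier (fun j =>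
        Complex.exp ((totalAngle θ j : ℝ) * Complex.I)) y‖ ^ 2) +
      ∑ y ∈ R, ‖invFourier (fun j =>
        Complex.exp ((-totalAngle θ j : ℝ) * Complex.I)) y‖ ^ 2) / M ≤ 32 / 100 := by
    rw [div_le_iff₀ hM]
    linarith
  -- This dictates ε' of order e²: M³ε'² is of order e when M is of order 1/e.
  have h3 : 176 * M ^ 3 * (1 / 10 ^ 14 * e ^ 2) ^ 2 ≤ 1 / 100 := by
    have hMe : M * e ≤ 2 * 10 ^ 7 := by
      have := mul_le_mul_of_nonneg_right hk' he.le
      rwa [mul_assoc, one_div, inv_mul_cancel₀ he.ne', mul_one] at this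
    have h4 : (M * e) ^ 3 ≤ (2 * 10 ^ 7) ^ 3 := pow_le_pow_left₀ (by positivity) hMe 3
    have h5 : (M * e) ^ 3 * e ≤ (2 * 10 ^ 7) ^ 3 * 1 :=
      mul_le_mul h4 (by linarith) he.le (by positivity)
    rw [show 176 * M ^ 3 * (1 / 10 ^ 14 * e ^ 2) ^ 2 = 176 / 10 ^ 28 * ((M * e) ^ 3 * e) by ring]
    calc 176 / 10 ^ 28 * ((M * e) ^ 3 * e) ≤ 176 / 10 ^ 28 * ((2 * 10 ^ 7) ^ 3 * 1) :=
          mul_le_mul_of_nonneg_left h5 (by norm_num)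
      _ ≤ 1 / 100 := by norm_num
  linarith

theorem ten_le_log {t : ℝ} (ht : 40000 ≤ t) : 10 ≤ Real.log t := by
  rw [Real.le_log_iff_exp_le (by linarith)]
  refine le_trans ?_ ht
  have h := Real.exp_one_lt_d9
  calc Real.exp 10 = Real.exp 1 ^ 10 := by rw [← Real.exp_nat_mul]; norm_num
    _ ≤ 2.7182818286 ^ 10 := pow_le_pow_left₀ (Real.exp_pos 1).le h.le 10
    _ ≤ 40000 := by norm_num

/-- The logarithm is log(4·10¹⁴) + 2 log(1/e). The constant plus the 1 from rounding is below 35 ≤ 4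
log(1/e), because log(1/e) ≥ 10. -/
theorem fixIterations_le {e : ℝ} (he : 0 < e) (he1 : 40000 ≤ 1 / e) :
    (fixIterations (1 / 10 ^ 14 * e ^ 2) : ℝ) ≤ 6 * Real.log (1 / e) := by
  have hlog := ten_le_log he1
  have hc0 : 0 ≤ Real.log (4 * 10 ^ 14) := Real.log_nonneg (by norm_num)
  have hc : Real.log (4 * 10 ^ 14) ≤ (49 : ℕ) * Real.log 2 := by
    rw [← Real.log_pow]
    exact Real.log_le_log (by norm_num) (by norm_num)
  have h1 : Real.log (4 / (1 / 10 ^ 14 * e ^ 2)) =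
      Real.log (4 * 10 ^ 14) + (2 : ℕ) * Real.log (1 / e) := by
    rw [show 4 / (1 / 10 ^ 14 * e ^ 2) = (4 * 10 ^ 14) * (1 / e) ^ 2 by field_simp,
      Real.log_mul (by positivity) (by positivity), Real.log_pow]
  generalize Real.log (4 * 10 ^ 14) = c at *
  generalize Real.log (1 / e) = Λ at *
  push_cast at hc h1
  have h2 := Real.log_two_lt_d9
  have h3 : (fixIterations (1 / 10 ^ 14 * e ^ 2) : ℝ) <
      Real.log (4 / (1 / 10 ^ 14 * e ^ 2)) + 1 :=
    Nat.ceil_lt_add_one (by rw [h1]; linarith)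
  rw [h1] at h3
  linarith

end Success

theorem theorem3p1 :
    ∃ a b cε cm cT C : ℝ, 0 < a ∧ 0 < b ∧ 0 < cε ∧ 0 < cm ∧ 0 < cT ∧ 0 < C ∧
      ∀ (𝒦 : Type*) [NormedAddCommGroup 𝒦] [InnerProductSpace ℂ 𝒦] [CompleteSpace 𝒦]
        (E : Finset ℝ) (z : Register 𝒦 E) (hz : ‖z‖ = 1)
        (T m : ℕ) (Ω : Fin T → Type*) [∀ i, Fintype (Ω i)]
        (P : ∀ i, PMF (Ω i)) (X : ∀ i, Ω i → ℝ)
        (O : Fin T → (Register 𝒦 E ≃ₗᵢ[ℂ] Register 𝒦 E))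
        (L H μ δ ε : ℝ),
        L < H → 0 < ε → δ < ε / 2 →
        (∀ i, IsQuantumRandomVariable z (O i) (P i) (X i)) →
        (∀ i, ∀ ω ∈ (P i).support, X i ω ∈ Set.Icc L H) →
        (∀ i, |expectedValue (P i) (X i) - μ| ≤ δ) →
        ε ≤ cε * ((μ - L) * (H - μ) / (H - L)) →
        cm * Real.log ((H - L) / ε) ≤ m →
        cT * ((H - L) / ε) ≤ T →
        ⌈b * ((H - L) / ε)⌉₊ + 1 ≤ T ∧
        ∀ σ : Fin (⌈b * ((H - L) / ε)⌉₊ + 1) → Fin T,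
          2 / 3 ≤ successProbability z hz L H (a * (ε / (H - L)) ^ 2) σ O μ ε ∧
          ((meanCircuit z hz L H (a * (ε / (H - L)) ^ 2) σ).experiments : ℝ)
            ≤ C * ((H - L) / ε * Real.log ((H - L) / ε)) ∧
          (Function.Injective σ →
            ∀ i, (meanCircuit z hz L H (a * (ε / (H - L)) ^ 2) σ).experimentsOn i ≤ m) := by
  -- With Λ = log(1/e) ≥ 10 and l ≤ 6Λ: 4(2l+1) ≤ 52Λ experiments per oracle, k+1 ≤ 2·10⁷/e, and in
  -- total 2(2l+1)(2k+1) ≤ 26Λ · 4·10⁷/e.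
  refine ⟨1 / 10 ^ 14, 10 ^ 7, 1 / 10000, 52, 2 * 10 ^ 7, 104 * 10 ^ 7, by norm_num, by norm_num,
    by norm_num, by norm_num, by norm_num, by norm_num, ?_⟩
  intro 𝒦 _ _ _ E z hz T m Ω _ P X O L H μ δ ε hLH hε hδ hO hX hE hcε hcm hcT
  have hD : 0 < H - L := sub_pos.2 hLH
  -- In scale-free form, e ≤ 10⁻⁴q(1-q). As e > 0 this forces 0 < q < 1, and it gives e ≤ q, e ≤ 1-q
  -- and e ≤ 1/40000.
  have hprod : ε / (H - L) ≤ 1 / 10000 * ((μ - L) / (H - L) * (1 - (μ - L) / (H - L))) := by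
    rw [div_le_iff₀ hD]
    refine hcε.trans (le_of_eq ?_)
    field_simp
    ring
  have he : 0 < ε / (H - L) := by positivity
  have hrecip : (H - L) / ε = 1 / (ε / (H - L)) := by rw [one_div_div]
  have hq0 : 0 < (μ - L) / (H - L) := by
    by_contra h
    nlinarith
  have hq1 : (μ - L) / (H - L) < 1 := by
    by_contra h
    nlinarith
  have he4 : ε / (H - L) ≤ 1 / 40000 := by
    nlinarith [sq_nonneg (2 * ((μ - L) / (H - L)) - 1)]
  have hinv : 40000 ≤ (H - L) / ε := by
    rw [hrecip, le_div_iff₀ he]; linarith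
  have hlog := ten_le_log hinv
  set k := ⌈(10 ^ 7 : ℝ) * ((H - L) / ε)⌉₊ with hk
  have hk1 : (10 ^ 7 : ℝ) * ((H - L) / ε) ≤ k := Nat.le_ceil _
  have hk2 : (k : ℝ) < 10 ^ 7 * ((H - L) / ε) + 1 := Nat.ceil_lt_add_one (by positivity)
  have hM : ((k + 1 : ℕ) : ℝ) ≤ 2 * 10 ^ 7 * ((H - L) / ε) := by push_cast; linarith
  refine ⟨by exact_mod_cast hM.trans hcT, fun σ => ⟨?_, ?_, ?_⟩⟩
  · refine two_thirds_le_successProbability hz σ hLH hε (by linarith) (by nlinarith) (by nlinarith)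
      (fun i => ?_) (by push_cast; linarith) hM
    rw [rotationWeight_eq hz (hO i) hLH (hX i), ← sub_div, abs_div, abs_of_pos hD, div_div,
      mul_comm (H - L) 2, ← div_div]
    refine div_le_div_of_nonneg_right ?_ hD.le
    rw [sub_sub_sub_cancel_right]
    exact (hE i).trans hδ.le
  · have hl := fixIterations_le he (by rw [← hrecip]; exact hinv)
    rw [← hrecip] at hl
    rw [experiments_meanCircuit]
    push_cast
    push_cast at hM
    have h1 : 2 * (2 * (fixIterations (1 / 10 ^ 14 * (ε / (H - L)) ^ 2) : ℝ) + 1) ≤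
        26 * Real.log ((H - L) / ε) := by linarith
    have h2 : 2 * (k : ℝ) + 1 ≤ 4 * 10 ^ 7 * ((H - L) / ε) := by linarith
    calc _ ≤ 26 * Real.log ((H - L) / ε) * (4 * 10 ^ 7 * ((H - L) / ε)) :=
          mul_le_mul h1 h2 (by positivity) (by linarith)
      _ = _ := by ring
  · intro hσ i
    have hl := fixIterations_le he (by rw [← hrecip]; exact hinv)
    rw [← hrecip] at hl
    have h := experimentsOn_meanCircuit_le z hz L H (1 / 10 ^ 14 * (ε / (H - L)) ^ 2) σ hσ i
    refine h.trans ?_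
    have h1 : 4 * (2 * (fixIterations (1 / 10 ^ 14 * (ε / (H - L)) ^ 2) : ℝ) + 1) ≤ m := by linarith
    exact_mod_cast h1
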